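/- Let $M$ be a smooth $n$-dimensional manifold and let $(x^\mu,y^a)$ be the coordinates on $TM$ induced by a chart of $M$; all indices run from $1$ to $n$ and repeated indices are summed. Let $N^a_\mu(x,y)$ be a smooth nonlinear connection and $\lambda_i=\lambda_i^\alpha\delta_\alpha+\lambda_i^a\dot\partial_a$ ($i=1,\dots,n$) smooth vector fields on $TM$ (or on an open subset of $TM$, such as $TM$ without the zero section) whose horizontal parts are linearly independent and whose vertical parts are linearly independent (an extended absolute parallelism space). Here $\dot\partial_a=\partial/\partial y^a$ and $\delta_\mu=\partial/\partial x^\mu-N^a_\mu\dot\partial_a$. Let $(\lambda_{i\beta})$ be the inverse matrix of $(\lambda_i^\alpha)$, $g_{\alpha\beta}=\lambda_{i\alpha}\lambda_{i\beta}$, $g^{\alpha\beta}=\lambda_i^\alpha\lambda_i^\beta$, $|\lambda|=\det(\lambda_{i\beta})$. Put $K_{(\mu\nu)}=\frac12(K_{\mu\nu}+K_{\nu\mu})$ and write $K=g^{\mu\nu}K_{\mu\nu}$ for traces. *Connections.* The canonical connection has coefficients $\Gamma^\alpha_{\mu\nu}=\lambda_i^\alpha\delta_\nu\lambda_{i\mu}$,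 $C^\alpha_{\mu c}=\lambda_i^\alpha\dot\partial_c\lambda_{i\mu}$; the natural metric connection $\mathring D$ has $\mathring\Gamma^\alpha_{\mu\nu}=\frac12g^{\alpha\epsilon}(\delta_\mu g_{\epsilon\nu}+\delta_\nu g_{\epsilon\mu}-\delta_\epsilon g_{\mu\nu})$, $\mathring C^\alpha_{\mu c}=\frac12g^{\alpha\epsilon}\dot\partial_cg_{\mu\epsilon}$, i.e. $\mathring D_{\delta_\nu}\delta_\mu=\mathring\Gamma^\alpha_{\mu\nu}\delta_\alpha$, $\mathring D_{\dot\partial_c}\delta_\mu=\mathring C^\alpha_{\mu c}\delta_\alpha$. With $\mathbf R(X,Y)=\mathring D_X\mathring D_Y-\mathring D_Y\mathring D_X-\mathring D_{[X,Y]}$ define $\mathring R^\alpha_{\beta\mu\nu}$ and $\mathring P^\alpha_{\beta\nu c}$ by $\mathbf R(\delta_\mu,\delta_\nu)\delta_\beta=\mathring R^\alpha_{\beta\mu\nu}\delta_\alpha$, $\mathbf R(\dot\partial_c,\delta_\nu)\delta_\beta=\mathring P^\alpha_{\beta\nu c}\delta_\alpha$, and $\mathring R_{\beta\nu}=\mathring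 R^\alpha_{\beta\nu\alpha}$, $\mathring{\mathcal R}=g^{\alpha\beta}\mathring R_{\alpha\beta}$, $\mathring G_{\mu\nu}=\mathring R_{\mu\nu}-\frac12g_{\mu\nu}\mathring{\mathcal R}$. Let $R^a_{\mu\nu}=\delta_\nu N^a_\mu-\delta_\mu N^a_\nu$. *Tensors.* $\Lambda^\alpha_{\mu\nu}=\Gamma^\alpha_{\mu\nu}-\Gamma^\alpha_{\nu\mu}$, $C_\mu=\Lambda^\alpha_{\mu\alpha}$, $\gamma^\alpha_{\mu\nu}=\Gamma^\alpha_{\mu\nu}-\mathring\Gamma^\alpha_{\mu\nu}$, $\gamma^\alpha_{\mu c}=C^\alpha_{\mu c}-\mathring C^\alpha_{\mu c}$, $\Omega^\alpha_{\mu\nu}=\gamma^\alpha_{\mu\nu}+\gamma^\alpha_{\nu\mu}$, $\sigma_{\mu\nu}=\gamma^\beta_{\alpha\mu}\gamma^\alpha_{\beta\nu}$, $\varpi_{\mu\nu}=\gamma^\beta_{\alpha\mu}\gamma^\alpha_{\nu\beta}+\gamma^\beta_{\mu\alpha}\gamma^\alpha_{\beta\nu}$, $Q_{\mu\nu}=\gamma^\epsilon_{\mu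 a}R^a_{\nu\epsilon}$, $N_\beta=\dot\partial_aN^a_\beta$, $Z_{\mu\nu}=C_\mu N_\nu$. *Field equations.* Regard $\mathcal H=|\lambda|\,g^{\mu\nu}(\Lambda^\alpha_{\epsilon\mu}\Lambda^\epsilon_{\alpha\nu}-C_\mu C_\nu)$ as a function of the independent variables $\lambda_{j\beta}$, $\lambda_{j\beta,\gamma}=\partial\lambda_{j\beta}/\partial x^\gamma$, $\lambda_{j\beta;a}=\partial\lambda_{j\beta}/\partial y^a$ (with $N^a_\mu$ not depending on them), and put $$\frac{\delta\mathcal H}{\delta\lambda_{j\beta}}=\frac{\partial\mathcal H}{\partial\lambda_{j\beta}}-\frac{\partial}{\partial x^\gamma}\frac{\partial\mathcal H}{\partial\lambda_{j\beta,\gamma}}-\frac{\partial}{\partial y^a}\frac{\partial\mathcal H}{\partial\lambda_{j\beta;a}},\qquad E_{\mu\nu}=g_{\mu\beta}\,\frac1{|\lambda|}\frac{\delta\mathcal H}{\delta\lambda_{j\beta}}\lambda_{j\nu}.$$ The horizontal field equations are $E_{\mu\nu}=0$. Then, at every point and for all indices: 1. $E_{(\mu\nu)}=0$ if and only if $\mathring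 R_{(\mu\nu)}-\frac12g_{\mu\nu}\mathring{\mathcal R}=T_{(\mu\nu)}$, where $$T_{(\mu\nu)}=\tfrac12g_{\mu\nu}(\sigma-\varpi-Q+2Z)-(\sigma_{\mu\nu}-\varpi_{\mu\nu}-Q_{(\mu\nu)})+\bigl(\tfrac12N_\beta\Omega^\beta_{\mu\nu}-Z_{(\mu\nu)}\bigr).$$ 2. If $E_{(\mu\nu)}=0$, then $$\mathring G_{\mu\nu}=\tfrac12g_{\mu\nu}(\sigma-\varpi)+(\varpi_{\mu\nu}-\sigma_{\mu\nu})+\tfrac12g_{\mu\nu}(2Z-Q)+\tfrac12N_\beta\Omega^\beta_{\mu\nu}-Z_{(\mu\nu)}+Q_{(\mu\nu)}-\tfrac12\bigl(\mathring C^\alpha_{\mu a}R^a_{\nu\alpha}+\mathring C^\alpha_{\nu a}R^a_{\alpha\mu}+\mathring C^\alpha_{\alpha a}R^a_{\mu\nu}\bigr).$$ 3. With $\mathring G^\mu_\sigma=g^{\mu\epsilon}\mathring G_{\epsilon\sigma}$, $\mathring P^\mu_a=-g^{\mu\epsilon}\mathring P^\beta_{\epsilon\beta a}$, $\mathring P^{\alpha\mu}{}_{\sigma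 a}=g^{\mu\epsilon}\mathring P^\alpha_{\epsilon\sigma a}$, $$\delta_\mu\mathring G^\mu_\sigma+\mathring\Gamma^\mu_{\epsilon\mu}\mathring G^\epsilon_\sigma-\mathring\Gamma^\epsilon_{\sigma\mu}\mathring G^\mu_\epsilon=R^a_{\sigma\mu}\mathring P^\mu_a+\tfrac12R^a_{\alpha\mu}\mathring P^{\alpha\mu}{}_{\sigma a}.$$ -/

import Mathlib

open scoped Manifold ContDiff Topology

noncomputable section

namespace EAP

/-! ## Coordinates on the tangent bundle -/

/-- Coordinates `(x, y) = (x^μ, y^a)` on the tangent bundle of an `n`-dimensional manifold. -/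
abbrev Phase (n : ℕ) : Type := EuclideanSpace ℝ (Fin n) × EuclideanSpace ℝ (Fin n)

variable {n : ℕ}

/-- The partial derivative `∂f/∂x^μ`. -/
def dX (μ : Fin n) (f : Phase n → ℝ) (p : Phase n) : ℝ :=
  fderiv ℝ f p (EuclideanSpace.single μ 1, 0)

/-- The partial derivative `∂f/∂y^a`, also written `f_{;a}`. -/
def dY (a : Fin n) (f : Phase n → ℝ) (p : Phase n) : ℝ :=
  fderiv ℝ f p (0, EuclideanSpace.single a 1)

/-! ## The local components of an EAP-structure -/

/-- The components, in one chart of the tangent bundle, of a nonlinear connection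
`N a μ = N^a_μ` and of `n` vector fields `λ_i = λ_i^α δ_α + λ_i^a ∂̇_a`, written in the adapted
basis: `lamH i α = λ_i^α` and `lamV i a = λ_i^a`. -/
structure LocalCoeff (n : ℕ) where
  N : Fin n → Fin n → Phase n → ℝ
  lamH : Fin n → Fin n → Phase n → ℝ
  lamV : Fin n → Fin n → Phase n → ℝ

/-! ## Linear connections on the horizontal bundle -/

/-- The part of a `d`-connection that acts on horizontal vector fields: its coefficients
`Γ α μ ν = Γ^α_{μν}` and `C α μ c = C^α_{μc}`, i.e. `D_{δ_ν} δ_μ = Γ^α_{μν} δ_α` and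
`D_{∂̇_c} δ_μ = C^α_{μc} δ_α`. -/
structure HConn (n : ℕ) where
  Γ : Fin n → Fin n → Fin n → Phase n → ℝ
  C : Fin n → Fin n → Fin n → Phase n → ℝ

namespace LocalCoeff

variable (A : LocalCoeff n)

/-- The horizontal vector field `δ_μ = ∂_μ - N^a_μ ∂̇_a` of the adapted basis. -/
def delta (μ : Fin n) (p : Phase n) : Phase n :=
  (EuclideanSpace.single μ 1, WithLp.toLp 2 fun a => -A.N a μ p)

/-- The vertical vector field `∂̇_c` of the adapted basis. -/
def vert (c : Fin n) (_p : Phase n) : Phase n := (0, EuclideanSpace.single c 1)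

/-- The horizontal derivative `δ_μ f`. -/
def dH (μ : Fin n) (f : Phase n → ℝ) (p : Phase n) : ℝ := fderiv ℝ f p (A.delta μ p)

/-- The horizontal components `X^ν = dx^ν(X)` of a vector field. -/
def hComp (X : Phase n → Phase n) (ν : Fin n) (p : Phase n) : ℝ := (X p).1 ν

/-- The vertical components `X^a = δy^a(X)` of a vector field, where
`δy^a = dy^a + N^a_ν dx^ν`. -/
def vComp (X : Phase n → Phase n) (a : Fin n) (p : Phase n) : ℝ :=
  (X p).2 a + ∑ ν, A.N a ν p * (X p).1 ν

/-- The covariant derivative `D_X Z` of the horizontal vector field `Z = Z^α δ_α`; fields and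
results are given by their horizontal components. -/
def cov (D : HConn n) (X : Phase n → Phase n) (Z : Fin n → Phase n → ℝ) (α : Fin n)
    (p : Phase n) : ℝ :=
  fderiv ℝ (Z α) p (X p)
    + ∑ ν, ∑ ε, hComp X ν p * D.Γ α ε ν p * Z ε p
    + ∑ c, ∑ ε, A.vComp X c p * D.C α ε c p * Z ε p

/-- The curvature `𝐑(X, Y) Z = D_X D_Y Z - D_Y D_X Z - D_{[X, Y]} Z` on horizontal `Z`. -/
def curv (D : HConn n) (X Y : Phase n → Phase n) (Z : Fin n → Phase n → ℝ) (α : Fin n)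
    (p : Phase n) : ℝ :=
  A.cov D X (A.cov D Y Z) α p - A.cov D Y (A.cov D X Z) α p
    - A.cov D (VectorField.lieBracket ℝ X Y) Z α p

/-- The components of `δ_β`. -/
def deltaComp (β α : Fin n) (_p : Phase n) : ℝ := if α = β then 1 else 0

/-- `R^α_{βμν}`, where `𝐑(δ_μ, δ_ν) δ_β = R^α_{βμν} δ_α`. -/
def curvHH (D : HConn n) (α β μ ν : Fin n) (p : Phase n) : ℝ :=
  A.curv D (A.delta μ) (A.delta ν) (deltaComp β) α p

/-- `P^α_{βνc}`, where `𝐑(∂̇_c, δ_ν) δ_β = P^α_{βνc} δ_α`. -/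
def curvHV (D : HConn n) (α β ν c : Fin n) (p : Phase n) : ℝ :=
  A.curv D (vert c) (A.delta ν) (deltaComp β) α p

/-- The curvature `R^a_{μν} = δ_ν N^a_μ - δ_μ N^a_ν` of the nonlinear connection. -/
def RN (a μ ν : Fin n) (p : Phase n) : ℝ := A.dH ν (A.N a μ) p - A.dH μ (A.N a ν) p

/-- `N_β = ∂N^a_β/∂y^a`. -/
def divN (β : Fin n) (p : Phase n) : ℝ := ∑ a, dY a (A.N a β) p

/-! ## Frame, metric and the two connections -/

/-- The matrix `λ_i^α` (row `α`, column `i`). -/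
def frame (p : Phase n) : Matrix (Fin n) (Fin n) ℝ := Matrix.of fun α i => A.lamH i α p

/-- The inverse matrix `λ_{iβ}` (row `i`, column `β`): `λ_i^α λ_{iβ} = δ^α_β`. -/
def coframe (p : Phase n) : Matrix (Fin n) (Fin n) ℝ := (A.frame p)⁻¹

/-- `g_{αβ} = λ_{iα} λ_{iβ}`. -/
def g (α β : Fin n) (p : Phase n) : ℝ := ∑ i, A.coframe p i α * A.coframe p i β

/-- `g^{αβ} = λ_i^α λ_i^β`. -/
def gInv (α β : Fin n) (p : Phase n) : ℝ := ∑ i, A.lamH i α p * A.lamH i β p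

/-- The canonical `d`-connection: `Γ^α_{μν} = λ_i^α δ_ν λ_{iμ}`, `C^α_{μc} = λ_i^α ∂̇_c λ_{iμ}`. -/
def canonical : HConn n where
  Γ α μ ν p := ∑ i, A.lamH i α p * A.dH ν (fun q => A.coframe q i μ) p
  C α μ c p := ∑ i, A.lamH i α p * dY c (fun q => A.coframe q i μ) p

/-- The natural metric `d`-connection:
`Γ°^α_{μν} = ½ g^{αε} (δ_μ g_{εν} + δ_ν g_{εμ} - δ_ε g_{μν})`, `C°^α_{μc} = ½ g^{αε} ∂̇_c g_{με}`. -/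
def natural : HConn n where
  Γ α μ ν p := (1 / 2) * ∑ ε, A.gInv α ε p *
    (A.dH μ (A.g ε ν) p + A.dH ν (A.g ε μ) p - A.dH ε (A.g μ ν) p)
  C α μ c p := (1 / 2) * ∑ ε, A.gInv α ε p * dY c (A.g μ ε) p

/-! ## The Euler–Lagrange expression and the horizontal field equations -/

/-- The Lagrangian `ℋ = |λ| g^{μν} (Λ^α_{εμ} Λ^ε_{αν} - C_μ C_ν)` as a function of the independent
variables `l i β = λ_{iβ}`, `lx i β γ = λ_{iβ,γ}`, `ly i β a = λ_{iβ;a}`. The values `N^a_ν` of the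
nonlinear connection enter as parameters that do not depend on these variables. -/
def lagrangian (Nv : Fin n → Fin n → ℝ) (l : Matrix (Fin n) (Fin n) ℝ)
    (lx ly : Fin n → Fin n → Fin n → ℝ) : ℝ :=
  let up : Matrix (Fin n) (Fin n) ℝ := l⁻¹
  let gUp : Fin n → Fin n → ℝ := fun μ ν => ∑ i, up μ i * up ν i
  let Γ : Fin n → Fin n → Fin n → ℝ := fun α μ ν =>
    ∑ i, up α i * (lx i μ ν - ∑ a, Nv a ν * ly i μ a)
  let Λ : Fin n → Fin n → Fin n → ℝ := fun α μ ν => Γ α μ ν - Γ α ν μ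
  let C : Fin n → ℝ := fun μ => ∑ α, Λ α μ α
  let H : Fin n → Fin n → ℝ := fun μ ν => (∑ α, ∑ ε, Λ α ε μ * Λ ε α ν) - C μ * C ν
  l.det * ∑ μ, ∑ ν, gUp μ ν * H μ ν

/-- `N^a_ν` at a point. -/
def NAt (p : Phase n) (a ν : Fin n) : ℝ := A.N a ν p

/-- `λ_{iβ,γ}` at a point. -/
def coframeX (p : Phase n) (i β γ : Fin n) : ℝ := dX γ (fun q => A.coframe q i β) p

/-- `λ_{iβ;a}` at a point. -/
def coframeY (p : Phase n) (i β a : Fin n) : ℝ := dY a (fun q => A.coframe q i β) p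

/-- `∂ℋ/∂λ_{jβ}` along `λ`. -/
def dLdl (j β : Fin n) (p : Phase n) : ℝ :=
  lineDeriv ℝ (fun l : Matrix (Fin n) (Fin n) ℝ =>
    lagrangian (A.NAt p) l (A.coframeX p) (A.coframeY p)) (A.coframe p) (Matrix.single j β 1)

/-- `∂ℋ/∂λ_{jβ,γ}` along `λ`. -/
def dLdlx (j β γ : Fin n) (p : Phase n) : ℝ :=
  lineDeriv ℝ (fun v : Fin n → Fin n → Fin n → ℝ =>
    lagrangian (A.NAt p) (A.coframe p) v (A.coframeY p)) (A.coframeX p)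
    (Pi.single j (Pi.single β (Pi.single γ 1)))

/-- `∂ℋ/∂λ_{jβ;a}` along `λ`. -/
def dLdly (j β a : Fin n) (p : Phase n) : ℝ :=
  lineDeriv ℝ (fun v : Fin n → Fin n → Fin n → ℝ =>
    lagrangian (A.NAt p) (A.coframe p) (A.coframeX p) v) (A.coframeY p)
    (Pi.single j (Pi.single β (Pi.single a 1)))

/-- The Euler–Lagrange expression
`δℋ/δλ_{jβ} = ∂ℋ/∂λ_{jβ} - ∂/∂x^γ (∂ℋ/∂λ_{jβ,γ}) - ∂/∂y^a (∂ℋ/∂λ_{jβ;a})`. -/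
def eulerLagrange (j β : Fin n) (p : Phase n) : ℝ :=
  A.dLdl j β p - ∑ γ, dX γ (A.dLdlx j β γ) p - ∑ a, dY a (A.dLdly j β a) p

/-- `E^β_σ = |λ|⁻¹ (δℋ/δλ_{jβ}) λ_{jσ}`, with `|λ| = det (λ_{jβ})`. -/
def EMixed (β σ : Fin n) (p : Phase n) : ℝ :=
  (A.coframe p).det⁻¹ * ∑ j, A.eulerLagrange j β p * A.coframe p j σ

/-- `E_{μν} = g_{μβ} E^β_ν`; the horizontal field equations are `E_{μν} = 0`. -/
def E (μ ν : Fin n) (p : Phase n) : ℝ := ∑ β, A.g μ β p * A.EMixed β ν p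

/-! ## Tensors -/

/-- The symmetric part `K_{(μν)} = ½ (K_{μν} + K_{νμ})`. -/
def symm (K : Fin n → Fin n → Phase n → ℝ) (μ ν : Fin n) (p : Phase n) : ℝ :=
  (K μ ν p + K ν μ p) / 2

/-- The trace `K = g^{μν} K_{μν}`. -/
def trace (K : Fin n → Fin n → Phase n → ℝ) (p : Phase n) : ℝ :=
  ∑ μ, ∑ ν, A.gInv μ ν p * K μ ν p

/-- The contortion components `γ^α_{μν} = Γ^α_{μν} - Γ°^α_{μν}`. -/
def contH (α μ ν : Fin n) (p : Phase n) : ℝ := A.canonical.Γ α μ ν p - A.natural.Γ α μ ν p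

/-- The contortion components `γ^α_{μc} = C^α_{μc} - C°^α_{μc}`. -/
def contV (α μ c : Fin n) (p : Phase n) : ℝ := A.canonical.C α μ c p - A.natural.C α μ c p

/-- `Ω^α_{μν} = γ^α_{μν} + γ^α_{νμ}`. -/
def Omega (α μ ν : Fin n) (p : Phase n) : ℝ := A.contH α μ ν p + A.contH α ν μ p

/-- The torsion components `Λ^α_{μν} = Γ^α_{μν} - Γ^α_{νμ}`. -/
def Lam (α μ ν : Fin n) (p : Phase n) : ℝ := A.canonical.Γ α μ ν p - A.canonical.Γ α ν μ p

/-- The basic vector `C_μ = Λ^α_{μα}`. -/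
def basic (μ : Fin n) (p : Phase n) : ℝ := ∑ α, A.Lam α μ α p

/-- `σ_{μν} = γ^β_{αμ} γ^α_{βν}`. -/
def sigma (μ ν : Fin n) (p : Phase n) : ℝ := ∑ α, ∑ β, A.contH β α μ p * A.contH α β ν p

/-- `ϖ_{μν} = γ^β_{αμ} γ^α_{νβ} + γ^β_{μα} γ^α_{βν}`. -/
def varpi (μ ν : Fin n) (p : Phase n) : ℝ :=
  ∑ α, ∑ β, (A.contH β α μ p * A.contH α ν β p + A.contH β μ α p * A.contH α β ν p)

/-- `Q_{βμ} = γ^ε_{βa} R^a_{με}`. -/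
def Q (β μ : Fin n) (p : Phase n) : ℝ := ∑ ε, ∑ a, A.contV ε β a p * A.RN a μ ε p

/-- `Z_{μν} = C_μ N_ν`. -/
def Z (μ ν : Fin n) (p : Phase n) : ℝ := A.basic μ p * A.divN ν p

/-- The horizontal Ricci tensor `R°_{βν} = R°^α_{βνα}` of the natural metric `d`-connection. -/
def ricci (β ν : Fin n) (p : Phase n) : ℝ := ∑ α, A.curvHH A.natural α β ν α p

/-- The horizontal Ricci scalar `R° = g^{αβ} R°_{αβ}`. -/
def scalar (p : Phase n) : ℝ := A.trace A.ricci p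

/-- The horizontal Einstein tensor `G°_{μν} = R°_{μν} - ½ g_{μν} R°`. -/
def einstein (μ ν : Fin n) (p : Phase n) : ℝ := A.ricci μ ν p - 1 / 2 * A.g μ ν p * A.scalar p

/-- The horizontal geometric energy–momentum tensor `T_{(μν)}`. -/
def energyMomentum (μ ν : Fin n) (p : Phase n) : ℝ :=
  1 / 2 * A.g μ ν p *
      (A.trace A.sigma p - A.trace A.varpi p - A.trace A.Q p + 2 * A.trace A.Z p)
    - (A.sigma μ ν p - A.varpi μ ν p - symm A.Q μ ν p)
    + (1 / 2 * ∑ β, A.divN β p * A.Omega β μ ν p - symm A.Z μ ν p)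

/-- The cyclic sum `𝔖_{μ,ν,α} C°^α_{μa} R^a_{να}
  = C°^α_{μa} R^a_{να} + C°^α_{νa} R^a_{αμ} + C°^α_{αa} R^a_{μν}`. -/
def cyclicCR (μ ν : Fin n) (p : Phase n) : ℝ :=
  ∑ α, ∑ a, (A.natural.C α μ a p * A.RN a ν α p + A.natural.C α ν a p * A.RN a α μ p
    + A.natural.C α α a p * A.RN a μ ν p)

/-- `G°^μ_σ = g^{με} G°_{εσ}`. -/
def einsteinMixed (μ σ : Fin n) (p : Phase n) : ℝ := ∑ ε, A.gInv μ ε p * A.einstein ε σ p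

/-- The divergence `K^μ_{σ|μ} = δ_μ K^μ_σ + Γ°^μ_{εμ} K^ε_σ - Γ°^ε_{σμ} K^μ_ε` with respect to the
natural metric `d`-connection. -/
def divergence (K : Fin n → Fin n → Phase n → ℝ) (σ : Fin n) (p : Phase n) : ℝ :=
  ∑ μ, (A.dH μ (K μ σ) p
    + ∑ ε, (A.natural.Γ μ ε μ p * K ε σ p - A.natural.Γ ε σ μ p * K μ ε p))

/-- `P°_{εa} = - P°^β_{εβa}`. -/
def PLow (ε a : Fin n) (p : Phase n) : ℝ := -∑ β, A.curvHV A.natural β ε β a p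

/-- `P°^μ_a = g^{με} P°_{εa}`. -/
def PUp (μ a : Fin n) (p : Phase n) : ℝ := ∑ ε, A.gInv μ ε p * A.PLow ε a p

/-- `P°^{αμ}_{σa} = g^{με} P°^α_{εσa}`. -/
def PUpUp (α μ σ a : Fin n) (p : Phase n) : ℝ :=
  ∑ ε, A.gInv μ ε p * A.curvHV A.natural α ε σ a p

end LocalCoeff

/-! ## EAP-spaces over a manifold -/

section Manifold

variable {M : Type*} [TopologicalSpace M] [ChartedSpace (EuclideanSpace ℝ (Fin n)) M]

/-- The tangent vector `y^a ∂_a` at the point with coordinates `x^μ` in the chart `e`. -/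
def tangentPoint (e : OpenPartialHomeomorph M (EuclideanSpace ℝ (Fin n))) (p : Phase n) :
    TangentBundle (𝓡 n) M :=
  ⟨e.symm p.1, mfderiv (𝓡 n) (𝓡 n) e.symm p.1 p.2⟩

/-- The coordinate image of a subset of the tangent bundle in the chart induced by `e`. -/
def chartDom (W : Set (TangentBundle (𝓡 n) M))
    (e : OpenPartialHomeomorph M (EuclideanSpace ℝ (Fin n))) : Set (Phase n) :=
  {p | p.1 ∈ e.target ∧ tangentPoint e p ∈ W}

/-- The coordinate change `x ↦ x'` from the chart `e` to the chart `e'`. -/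
def trans (e e' : OpenPartialHomeomorph M (EuclideanSpace ℝ (Fin n)))
    (x : EuclideanSpace ℝ (Fin n)) : EuclideanSpace ℝ (Fin n) := e' (e.symm x)

/-- The Jacobian matrix `∂x'^i/∂x^j` of the coordinate change from `e` to `e'`. -/
def jac (e e' : OpenPartialHomeomorph M (EuclideanSpace ℝ (Fin n))) (i j : Fin n)
    (x : EuclideanSpace ℝ (Fin n)) : ℝ :=
  fderiv ℝ (trans e e') x (EuclideanSpace.single j 1) i

/-- The induced coordinate change `(x, y) ↦ (x', y')`, `y'^i = (∂x'^i/∂x^j) y^j`, on the tangent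
bundle. -/
def transT (e e' : OpenPartialHomeomorph M (EuclideanSpace ℝ (Fin n))) (p : Phase n) : Phase n :=
  (trans e e' p.1, fderiv ℝ (trans e e') p.1 p.2)

variable (n M) [IsManifold (𝓡 n) ∞ M] in
/-- An extended absolute parallelism space over the open subset `domain` of the tangent bundle
of `M` (for instance all of `TM`, or `TM` without the zero section): a smooth nonlinear connection
and `n` smooth vector fields whose horizontal parts and whose vertical parts are linearly
independent, given by their components in the charts of `M` and the corresponding transformation
laws. Values of `coeff` at partial homeomorphisms that are not charts are irrelevant. -/
structure EAPSpace where
  domain : Set (TangentBundle (𝓡 n) M)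
  isOpen_domain : IsOpen domain
  coeff : OpenPartialHomeomorph M (EuclideanSpace ℝ (Fin n)) → LocalCoeff n
  smooth_N : ∀ e ∈ IsManifold.maximalAtlas (𝓡 n) ∞ M, ∀ a μ,
    ContDiffOn ℝ ∞ ((coeff e).N a μ) (chartDom domain e)
  smooth_lamH : ∀ e ∈ IsManifold.maximalAtlas (𝓡 n) ∞ M, ∀ i α,
    ContDiffOn ℝ ∞ ((coeff e).lamH i α) (chartDom domain e)
  smooth_lamV : ∀ e ∈ IsManifold.maximalAtlas (𝓡 n) ∞ M, ∀ i a,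
    ContDiffOn ℝ ∞ ((coeff e).lamV i a) (chartDom domain e)
  indep_lamH : ∀ e ∈ IsManifold.maximalAtlas (𝓡 n) ∞ M, ∀ p ∈ chartDom domain e,
    LinearIndependent ℝ fun i α => (coeff e).lamH i α p
  indep_lamV : ∀ e ∈ IsManifold.maximalAtlas (𝓡 n) ∞ M, ∀ p ∈ chartDom domain e,
    LinearIndependent ℝ fun i a => (coeff e).lamV i a p
  /-- `N'^{b}_{β} = (∂x'^b/∂x^a) (∂x^α/∂x'^β) N^a_α + (∂x'^b/∂x^a) (∂²x^a/∂x'^c∂x'^β) y'^c`. -/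
  trans_N : ∀ e ∈ IsManifold.maximalAtlas (𝓡 n) ∞ M,
    ∀ e' ∈ IsManifold.maximalAtlas (𝓡 n) ∞ M, ∀ p ∈ chartDom domain e,
    e.symm p.1 ∈ e'.source → ∀ b β,
    (coeff e').N b β (transT e e' p) =
      (∑ a, ∑ α, jac e e' b a p.1 * jac e' e α β (transT e e' p).1 * (coeff e).N a α p)
      + ∑ a, ∑ c, jac e e' b a p.1 *
          fderiv ℝ (jac e' e a c) (transT e e' p).1 (EuclideanSpace.single β 1) *
          (transT e e' p).2 c
  trans_lamH : ∀ e ∈ IsManifold.maximalAtlas (𝓡 n) ∞ M,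
    ∀ e' ∈ IsManifold.maximalAtlas (𝓡 n) ∞ M, ∀ p ∈ chartDom domain e,
    e.symm p.1 ∈ e'.source → ∀ i β,
    (coeff e').lamH i β (transT e e' p) = ∑ α, jac e e' β α p.1 * (coeff e).lamH i α p
  trans_lamV : ∀ e ∈ IsManifold.maximalAtlas (𝓡 n) ∞ M,
    ∀ e' ∈ IsManifold.maximalAtlas (𝓡 n) ∞ M, ∀ p ∈ chartDom domain e,
    e.symm p.1 ∈ e'.source → ∀ i b,
    (coeff e').lamV i b (transT e e' p) = ∑ a, jac e e' b a p.1 * (coeff e).lamV i a p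

end Manifold

end EAP

end

noncomputable section

namespace EAP

/-! ## Smooth functions on an open set as a differential ring -/

section SmoothFn

open TopologicalSpace

section

variable {V : Type*} [TopologicalSpace V]

/-! All three claims are local. On the open coordinate domain the smooth functions form a ring with
commuting derivations along `x` and `y` and with distinguished elements `N^a_μ`. In that ring the
claims become identities of a differential ring, proved by matrix algebra; `Rep` records which ring
element restricts which coordinate expression, so evaluation at a point returns the stated formulas.

Field equations. The canonical connection makes the coframe parallel, hence it is flat and
compatible with `g`. In the frame `λ_i` the natural metric connection therefore has connection form
minus the contortion `γ`. This is skew (`cont_skew`), and its curvature is the frame curvature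
(`mul_curvHH`), so the Ricci contraction is a frame divergence of `γ` plus quadratic terms
(`frame_ricci`). Since the natural connection is symmetric, the torsion is `T_{ijk} = γ_{ijk} -
γ_{ikj}` (`tor_eq_frCont`), and `ℋ/|λ|` is a quadratic polynomial in `T` (`lagrangian_eq`). Its
variations are explicit, and integrating by parts gives the Euler–Lagrange expression in the frame
(`eulerLagrange_frame`). There the density contributes the basic vector and the `y`-dependence of
`N` contributes `N_β`. After symmetrisation the derivative terms and the product `γ_{bia} γ_{akb}`
cancel against twice the Ricci terms (`field_equation_frame`). Back in coordinates this says that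
`E_{(μν)}` is `-2` times the difference of the two sides of claim 1 (`symm_E_eq`), which is an
identity and not merely an equivalence.

Claim 2 adds the skew part of the Ricci tensor. The first Bianchi identity, contracted with a
curvature that is skew for `g`, shows that this part comes only from the vertical bracket `[δ_μ,
δ_ν] = R^a_{μν} ∂̇_a` (`ricci_antisymm`).

Claim 3 is the second Bianchi identity contracted twice. The same vertical brackets leave `R · P`
terms on the right (`bianchi`, `bianchi_contracted`), and subtracting half the trace turns Ricci
into Einstein. -/

/-- Extension by zero of a function on an open set. -/
def zeroExt (U : Opens V) (f : U → ℝ) : V → ℝ := Function.extend Subtype.val f 0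

lemma zeroExt_apply {U : Opens V} (f : U → ℝ) (q : U) : zeroExt U f q = f q :=
  Subtype.val_injective.extend_apply f 0 q

lemma eqOn_zeroExt {U : Opens V} {f : U → ℝ} {F : V → ℝ} (h : ∀ q : U, f q = F q) :
    Set.EqOn (zeroExt U f) F U := fun q hq => by
  rw [← h ⟨q, hq⟩]; exact zeroExt_apply f ⟨q, hq⟩

/-- Ring elements live on the subtype `U`, whereas `fderiv` needs a function on the whole space. As
`U` is open, the choice of extension does not affect derivatives at points of `U`. -/
lemma zeroExt_eventuallyEq {U : Opens V} {f : U → ℝ} {F : V → ℝ} (h : ∀ q : U, f q = F q)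
    (q : U) : zeroExt U f =ᶠ[𝓝 (q : V)] F :=
  Filter.eventuallyEq_of_mem (U.isOpen.mem_nhds q.2) (eqOn_zeroExt h)

end

variable {V : Type*} [NormedAddCommGroup V] [NormedSpace ℝ V]

/-- The algebra of smooth functions on an open subset of a normed space. -/
def smoothFn (U : Opens V) : Subalgebra ℝ (U → ℝ) where
  carrier := {f | ContDiffOn ℝ ∞ (zeroExt U f) U}
  mul_mem' {f g} hf hg := (hf.mul hg).congr (eqOn_zeroExt fun q => by simp [zeroExt_apply])
  add_mem' {f g} hf hg := (hf.add hg).congr (eqOn_zeroExt fun q => by simp [zeroExt_apply])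
  algebraMap_mem' r := (contDiffOn_const (c := r)).congr (eqOn_zeroExt fun q => by simp)

namespace smoothFn

variable {U : Opens V}

lemma contDiffAt (f : smoothFn U) (q : U) : ContDiffAt ℝ ∞ (zeroExt U f) q :=
  ContDiffOn.contDiffAt f.2 (U.isOpen.mem_nhds q.2)

lemma differentiableAt (f : smoothFn U) (q : U) : DifferentiableAt ℝ (zeroExt U f) q :=
  (contDiffAt f q).differentiableAt (by simp)

/-- The element of `smoothFn U` given by a function that is smooth on `U`. -/
def mk (F : V → ℝ) (hF : ContDiffOn ℝ ∞ F U) : smoothFn U :=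
  ⟨fun q => F q, hF.congr (eqOn_zeroExt fun _ => rfl)⟩

/-- Directional derivative along a constant vector, as a derivation of the smooth functions. -/
def dir (v : V) : Derivation ℝ (smoothFn U) (smoothFn U) :=
  Derivation.mk'
    { toFun := fun f => ⟨fun q => fderiv ℝ (zeroExt U f) q v, by
        have h : ContDiffOn ℝ ∞ (fderiv ℝ (zeroExt U f)) U :=
          ContDiffOn.fderiv_of_isOpen f.2 U.isOpen (by simp)
        exact (h.clm_apply contDiffOn_const).congr (eqOn_zeroExt fun _ => rfl)⟩
      map_add' := fun f g => by
        ext q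
        have h := (zeroExt_eventuallyEq (f := ((f + g : smoothFn U) : U → ℝ))
          (F := zeroExt U f + zeroExt U g) (fun q => by simp [zeroExt_apply]) q).fderiv_eq (𝕜 := ℝ)
        simp only [h, fderiv_add (differentiableAt f q) (differentiableAt g q)]
        rfl
      map_smul' := fun c f => by
        ext q
        have h := (zeroExt_eventuallyEq (f := ((c • f : smoothFn U) : U → ℝ))
          (F := c • zeroExt U f) (fun q => by simp [zeroExt_apply]) q).fderiv_eq (𝕜 := ℝ)
        simp only [h, fderiv_const_smul (differentiableAt f q)]
        rfl }
    fun f g => by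
      ext q
      have h := (zeroExt_eventuallyEq (f := ((f * g : smoothFn U) : U → ℝ))
          (F := zeroExt U f * zeroExt U g) (fun q => by simp [zeroExt_apply]) q).fderiv_eq (𝕜 := ℝ)
      simp only [LinearMap.coe_mk, AddHom.coe_mk, h,
        fderiv_mul (differentiableAt f q) (differentiableAt g q)]
      simp [zeroExt_apply]

lemma dir_apply (v : V) (f : smoothFn U) (q : U) :
    (dir v f).1 q = fderiv ℝ (zeroExt U f) q v := rfl

/-- Both sides are values of the second derivative, which is symmetric for smooth functions. -/
lemma dir_comm (v w : V) (f : smoothFn U) : dir v (dir w f) = dir w (dir v f) := by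
  ext q
  have key : ∀ v w : V, (dir v (dir w f)).1 q = fderiv ℝ (fderiv ℝ (zeroExt U f)) q v w := by
    intro v w
    rw [dir_apply, (zeroExt_eventuallyEq (f := (dir w f).1) (F := fun q => fderiv ℝ (zeroExt U f) q w)
      (fun _ => rfl) q).fderiv_eq, fderiv_clm_apply]
    · simp
    · exact ((contDiffAt f q).fderiv_right (m := ∞) (by simp)).differentiableAt (by simp)
    · exact differentiableAt_const _
  rw [key, key]
  exact ((contDiffAt f q).isSymmSndFDerivAt (by simpa using WithTop.coe_le_coe.2 (le_top : (2 : ℕ∞) ≤ ⊤))) v w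

/-- `x` is the restriction of `F` to `U`. -/
def Rep (x : smoothFn U) (F : V → ℝ) : Prop := ∀ q : U, x.1 q = F q

namespace Rep

lemma of_eq {x : smoothFn U} {F : V → ℝ} (h : Rep x F) {y : smoothFn U} (e : y = x) : Rep y F :=
  e ▸ h

variable {x y : smoothFn U} {F G : V → ℝ}

lemma add (hx : Rep x F) (hy : Rep y G) : Rep (x + y) fun q => F q + G q := fun q => by
  simp [hx q, hy q]

lemma sub (hx : Rep x F) (hy : Rep y G) : Rep (x - y) fun q => F q - G q := fun q => by
  simp [hx q, hy q]

lemma neg (hx : Rep x F) : Rep (-x) fun q => - F q := fun q => by simp [hx q]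

lemma mul (hx : Rep x F) (hy : Rep y G) : Rep (x * y) fun q => F q * G q := fun q => by
  simp [hx q, hy q]

lemma smul (c : ℝ) (hx : Rep x F) : Rep (c • x) fun q => c * F q := fun q => by
  simp [hx q]

lemma sum {ι : Type*} {s : Finset ι} {x : ι → smoothFn U} {F : ι → V → ℝ}
    (h : ∀ i, Rep (x i) (F i)) : Rep (∑ i ∈ s, x i) fun q => ∑ i ∈ s, F i q := fun q => by
  simp [fun i => h i q]

lemma dir (v : V) (hx : Rep x F) : Rep (dir v x) fun q => fderiv ℝ F q v := fun q => by
  rw [dir_apply, (zeroExt_eventuallyEq hx q).fderiv_eq]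

end Rep

end smoothFn

end SmoothFn

end EAP

end

noncomputable section

namespace EAP

/-! ## Matrices over a ring with derivations -/

section MatrixDerivation

variable {K : Type*} [CommRing K] [Algebra ℝ K] {ι : Type*}
variable (D : Derivation ℝ K K)

lemma map_der_add (M M' : Matrix ι ι K) : (M + M').map D = M.map D + M'.map D := by
  ext; simp

lemma map_der_sub (M M' : Matrix ι ι K) : (M - M').map D = M.map D - M'.map D := by
  ext; simp

lemma map_der_smul (f : K) (M : Matrix ι ι K) : (f • M).map D = D f • M + f • M.map D := by
  ext; simp [mul_comm]; ring

lemma map_der_sum {κ : Type*} (s : Finset κ) (M : κ → Matrix ι ι K) :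
    (∑ a ∈ s, M a).map D = ∑ a ∈ s, (M a).map D := by
  ext; simp [Matrix.sum_apply]

lemma map_der_mul [Fintype ι] (M M' : Matrix ι ι K) :
    (M * M').map D = M.map D * M' + M * M'.map D := by
  ext i j
  simp only [Matrix.map_apply, Matrix.mul_apply, map_sum, Derivation.leibniz, smul_eq_mul,
    Matrix.add_apply, ← Finset.sum_add_distrib]
  exact Finset.sum_congr rfl fun _ _ => by ring

lemma map_der_one [DecidableEq ι] : (1 : Matrix ι ι K).map D = 0 := by
  ext i j
  by_cases h : i = j <;> simp [h]

end MatrixDerivation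

/-! ## Connections over a differential ring with a nonlinear connection -/

/-- A ring with commuting derivations `∂/∂x^μ`, `∂/∂y^a` and a nonlinear connection `N a μ`. -/
structure DiffRing (ι K : Type*) [CommRing K] [Algebra ℝ K] where
  dx : ι → Derivation ℝ K K
  dy : ι → Derivation ℝ K K
  N : ι → ι → K
  dx_dx : ∀ μ ν f, dx μ (dx ν f) = dx ν (dx μ f)
  dx_dy : ∀ μ a f, dx μ (dy a f) = dy a (dx μ f)
  dy_dy : ∀ a b f, dy a (dy b f) = dy b (dy a f)

namespace DiffRing

variable {K : Type*} [CommRing K] [Algebra ℝ K] {ι : Type*} [Fintype ι]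
variable (B : DiffRing ι K)

/-- The horizontal derivation `δ_μ = ∂_μ - N^a_μ ∂̇_a`. -/
def δ (μ : ι) : Derivation ℝ K K := B.dx μ - ∑ a, B.N a μ • B.dy a

/-- The curvature `R^a_{μν}` of the nonlinear connection. -/
def R (a μ ν : ι) : K := B.δ ν (B.N a μ) - B.δ μ (B.N a ν)

lemma δ_apply (μ : ι) (f : K) : B.δ μ f = B.dx μ f - ∑ a, B.N a μ * B.dy a f := by
  have h := congrFun (map_sum (Derivation.coeFnAddMonoidHom (R := ℝ) (A := K) (M := K))
    (fun a => B.N a μ • B.dy a) Finset.univ) f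
  simp only [Derivation.coeFnAddMonoidHom_apply, Finset.sum_apply, Derivation.smul_apply,
    smul_eq_mul] at h
  rw [δ, Derivation.sub_apply, h]

lemma R_swap (a μ ν : ι) : B.R a ν μ = -B.R a μ ν := by simp [R]

lemma dy_δ (c ν : ι) (f : K) :
    B.dy c (B.δ ν f) = B.δ ν (B.dy c f) - ∑ a, B.dy c (B.N a ν) * B.dy a f := by
  simp only [δ_apply, map_sub, map_sum, Derivation.leibniz, smul_eq_mul, B.dx_dy,
    Finset.sum_add_distrib]
  have h1 : ∑ a, B.N a ν * B.dy c (B.dy a f) = ∑ a, B.N a ν * B.dy a (B.dy c f) :=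
    Finset.sum_congr rfl fun a _ => by rw [B.dy_dy]
  have h2 : ∑ a, B.dy a f * B.dy c (B.N a ν) = ∑ a, B.dy c (B.N a ν) * B.dy a f :=
    Finset.sum_congr rfl fun a _ => mul_comm _ _
  rw [h1, h2]; ring

/-- The horizontal derivations fail to commute only because the `N^a_μ` are themselves
differentiated; the second-order part is symmetric, and the bracket is the vertical derivation with
coefficients `R^a_{μν}`. Every term in `R^a_{μν}` below originates here. -/
lemma δ_δ (μ ν : ι) (f : K) :
    B.δ μ (B.δ ν f) = B.δ ν (B.δ μ f) + ∑ a, B.R a μ ν * B.dy a f := by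
  have h : ∀ μ ν, B.δ μ (B.δ ν f) = B.dx ν (B.dx μ f)
      - ∑ a, B.N a μ * B.dy a (B.dx ν f) - ∑ b, B.N b ν * B.dy b (B.dx μ f)
      + ∑ b, ∑ a, B.N b ν * B.N a μ * B.dy a (B.dy b f)
      - ∑ b, B.δ μ (B.N b ν) * B.dy b f := by
    intro μ ν
    rw [B.δ_apply ν f, map_sub, map_sum]
    simp only [Derivation.leibniz, smul_eq_mul, Finset.sum_add_distrib]
    have h1 : ∀ b, B.δ μ (B.dy b f) = B.dy b (B.dx μ f) - ∑ a, B.N a μ * B.dy a (B.dy b f) := by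
      intro b
      rw [δ_apply, B.dx_dy]
    simp only [h1, mul_sub, Finset.sum_sub_distrib, Finset.mul_sum, ← mul_assoc]
    rw [δ_apply, B.dx_dx]
    have h2 : ∑ b, B.dy b f * B.δ μ (B.N b ν) = ∑ b, B.δ μ (B.N b ν) * B.dy b f :=
      Finset.sum_congr rfl fun a _ => mul_comm _ _
    rw [h2]; ring
  rw [h μ ν, h ν μ, B.dx_dx ν μ]
  have h3 : ∑ b, ∑ a, B.N b ν * B.N a μ * B.dy a (B.dy b f)
      = ∑ b, ∑ a, B.N b μ * B.N a ν * B.dy a (B.dy b f) := by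
    rw [Finset.sum_comm]
    exact Finset.sum_congr rfl fun b _ => Finset.sum_congr rfl fun a _ => by
      rw [B.dy_dy]; ring
  simp only [R, sub_mul, Finset.sum_sub_distrib]
  rw [h3]; ring

/-- The vertical components of the Jacobi identity for `δ_l`, `δ_μ`, `δ_ν`. Regrouping the cyclic
sum by the coefficient being differentiated leaves one commutator acting on each of `N^b_l`,
`N^b_μ`, `N^b_ν`. -/
lemma R_jacobi (b l μ ν : ι) :
    (B.δ l (B.R b μ ν) + ∑ a, B.R a μ ν * B.dy a (B.N b l))
    + (B.δ μ (B.R b ν l) + ∑ a, B.R a ν l * B.dy a (B.N b μ))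
    + (B.δ ν (B.R b l μ) + ∑ a, B.R a l μ * B.dy a (B.N b ν)) = 0 := by
  have h1 := B.δ_δ μ ν (B.N b l)
  have h2 := B.δ_δ ν l (B.N b μ)
  have h3 := B.δ_δ l μ (B.N b ν)
  rw [R, R, R, map_sub, map_sub, map_sub]
  linear_combination -h1 - h2 - h3

/-! ### Curvature of a linear connection -/

/-- The horizontal curvature matrix `(R^α_{β μν})` of a connection with matrices
`Γ ν = (Γ^α_{βν})` and `C a = (C^α_{βa})`. -/
def curvHH (Γ C : ι → Matrix ι ι K) (μ ν : ι) : Matrix ι ι K :=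
  (Γ ν).map (B.δ μ) - (Γ μ).map (B.δ ν) + (Γ μ * Γ ν - Γ ν * Γ μ) - ∑ a, B.R a μ ν • C a

/-- The mixed curvature matrix `(P^α_{β νc})`. -/
def curvHV (Γ C : ι → Matrix ι ι K) (ν c : ι) : Matrix ι ι K :=
  (Γ ν).map (B.dy c) - (C c).map (B.δ ν) + (C c * Γ ν - Γ ν * C c)
    + ∑ a, B.dy c (B.N a ν) • C a

lemma map_δ_δ (M : Matrix ι ι K) (μ ν : ι) : (M.map (B.δ ν)).map (B.δ μ)
    = (M.map (B.δ μ)).map (B.δ ν) + ∑ a, B.R a μ ν • M.map (B.dy a) := by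
  ext i j
  simp [Matrix.sum_apply, B.δ_δ μ ν]

variable (Γ C : ι → Matrix ι ι K)

lemma curvHH_swap (μ ν : ι) : B.curvHH Γ C ν μ = -B.curvHH Γ C μ ν := by
  have h : ∑ a, B.R a ν μ • C a = - ∑ a, B.R a μ ν • C a := by
    simp [B.R_swap _ μ ν]
  simp only [curvHH, h]; abel

/-- The second Bianchi identity. -/
lemma bianchi (l μ ν : ι) :
    ((B.curvHH Γ C μ ν).map (B.δ l) + (Γ l * B.curvHH Γ C μ ν - B.curvHH Γ C μ ν * Γ l))
    + ((B.curvHH Γ C ν l).map (B.δ μ) + (Γ μ * B.curvHH Γ C ν l - B.curvHH Γ C ν l * Γ μ))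
    + ((B.curvHH Γ C l μ).map (B.δ ν) + (Γ ν * B.curvHH Γ C l μ - B.curvHH Γ C l μ * Γ ν))
    = ∑ a, B.R a μ ν • B.curvHV Γ C l a + ∑ a, B.R a ν l • B.curvHV Γ C μ a
      + ∑ a, B.R a l μ • B.curvHV Γ C ν a := by
  have hP : ∀ l μ ν, ∑ a, B.R a μ ν • B.curvHV Γ C l a
      = ∑ a, B.R a μ ν • (Γ l).map (B.dy a) - ∑ a, B.R a μ ν • (C a).map (B.δ l)
        + ((∑ a, B.R a μ ν • C a) * Γ l - Γ l * ∑ a, B.R a μ ν • C a)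
        + ∑ b, (∑ a, B.R a μ ν * B.dy a (B.N b l)) • C b := by
    intro l μ ν
    simp only [curvHV, smul_add, smul_sub, Finset.sum_add_distrib, Finset.sum_sub_distrib,
      Finset.sum_mul, Finset.mul_sum, Matrix.smul_mul, Matrix.mul_smul, Finset.smul_sum,
      Finset.sum_smul, smul_smul]
    rw [Finset.sum_comm (f := fun a b => (B.R a μ ν * B.dy a (B.N b l)) • C b)]
  have hF : ∀ l μ ν, (B.curvHH Γ C μ ν).map (B.δ l)
      = ((Γ ν).map (B.δ μ)).map (B.δ l) - ((Γ μ).map (B.δ ν)).map (B.δ l)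
        + ((Γ μ).map (B.δ l) * Γ ν + Γ μ * (Γ ν).map (B.δ l)
          - ((Γ ν).map (B.δ l) * Γ μ + Γ ν * (Γ μ).map (B.δ l)))
        - (∑ a, B.δ l (B.R a μ ν) • C a + ∑ a, B.R a μ ν • (C a).map (B.δ l)) := by
    intro l μ ν
    simp only [curvHH, map_der_add, map_der_sub, map_der_mul, map_der_sum, map_der_smul,
      Finset.sum_add_distrib]
  -- The undifferentiated `C b` outside the commutators have as total coefficient exactly the cyclic
  -- sum of `R_jacobi`.
  have hJ : (∑ b, B.δ l (B.R b μ ν) • C b + ∑ b, (∑ a, B.R a μ ν * B.dy a (B.N b l)) • C b)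
      + (∑ b, B.δ μ (B.R b ν l) • C b + ∑ b, (∑ a, B.R a ν l * B.dy a (B.N b μ)) • C b)
      + (∑ b, B.δ ν (B.R b l μ) • C b + ∑ b, (∑ a, B.R a l μ * B.dy a (B.N b ν)) • C b) = 0 := by
    simp only [← Finset.sum_add_distrib, ← add_smul, B.R_jacobi, zero_smul,
      Finset.sum_const_zero]
  -- Reordering one second derivative of each `Γ` makes the second derivatives cancel in pairs; the
  -- price is `R • ∂̇Γ`, which is what the mixed curvatures supply.
  rw [hP, hP, hP, hF, hF, hF, B.map_δ_δ (Γ ν) l μ, B.map_δ_δ (Γ l) μ ν, B.map_δ_δ (Γ μ) ν l]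
  rw [← sub_eq_zero, ← neg_eq_zero, ← hJ]
  simp only [curvHH]
  noncomm_ring

/-- The first Bianchi identity of a symmetric connection. -/
lemma bianchi_first (hΓ : ∀ α μ ν, Γ ν α μ = Γ μ α ν) (α β μ ν : ι) :
    B.curvHH Γ C μ ν α β + B.curvHH Γ C ν β α μ + B.curvHH Γ C β μ α ν
    = - ∑ a, (B.R a μ ν * C a α β + B.R a ν β * C a α μ + B.R a β μ * C a α ν) := by
  simp only [curvHH, Matrix.sub_apply, Matrix.add_apply, Matrix.map_apply, Matrix.mul_apply,
    Matrix.sum_apply, Matrix.smul_apply, smul_eq_mul, Finset.sum_add_distrib]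
  -- Symmetry of the second factor pairs the six quadratic terms of the cyclic sum, so that only the
  -- `C` terms survive.
  have h : ∀ μ ν β, ∑ ε, Γ μ α ε * Γ ν ε β = ∑ ε, Γ μ α ε * Γ β ε ν := fun μ ν β =>
    Finset.sum_congr rfl fun ε _ => by rw [hΓ ε β ν]
  rw [hΓ α β ν, hΓ α β μ, hΓ α μ ν, h μ ν β, h ν μ β, h ν β μ, h β ν μ]
  rw [h μ β ν, h β μ ν]
  ring

/-! ### Metric connections -/

variable {Γ C}

/-- Differentiate metric compatibility once more and antisymmetrise: the commutator of `δ_μ` and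
`δ_ν` on `g` is vertical, and compatibility of `C` absorbs it. The curvature thus acts by
infinitesimal isometries of `g`. -/
lemma curvHH_skew {g : Matrix ι ι K}
    (hΓ : ∀ ν, g.map (B.δ ν) = g * Γ ν + (Γ ν).transpose * g)
    (hC : ∀ c, g.map (B.dy c) = g * C c + (C c).transpose * g) (μ ν : ι) :
    g * B.curvHH Γ C μ ν + (B.curvHH Γ C μ ν).transpose * g = 0 := by
  have h := B.map_δ_δ g μ ν
  simp only [hΓ, hC, map_der_add, map_der_mul, smul_add, Finset.sum_add_distrib,
    Matrix.transpose_map] at h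
  have hS : g * (∑ a, B.R a μ ν • C a) + (∑ a, B.R a μ ν • C a).transpose * g
      = ∑ a, B.R a μ ν • (g * C a) + ∑ a, B.R a μ ν • ((C a).transpose * g) := by
    simp [Finset.mul_sum, Finset.sum_mul, Matrix.transpose_sum]
  rw [← hS] at h
  rw [← sub_eq_zero] at h
  rw [← h]
  simp only [curvHH, Matrix.transpose_sub, Matrix.transpose_add, Matrix.transpose_mul]
  noncomm_ring

/-- The same argument with the commutator of `∂̇_c` and `δ_ν`, which is again vertical. -/
lemma curvHV_skew {g : Matrix ι ι K}
    (hΓ : ∀ ν, g.map (B.δ ν) = g * Γ ν + (Γ ν).transpose * g)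
    (hC : ∀ c, g.map (B.dy c) = g * C c + (C c).transpose * g) (ν c : ι) :
    g * B.curvHV Γ C ν c + (B.curvHV Γ C ν c).transpose * g = 0 := by
  have h : (g.map (B.δ ν)).map (B.dy c)
      = (g.map (B.dy c)).map (B.δ ν) - ∑ a, B.dy c (B.N a ν) • g.map (B.dy a) := by
    ext i j
    simp [Matrix.sum_apply, B.dy_δ c ν]
  simp only [hΓ, hC, map_der_add, map_der_mul, smul_add, Finset.sum_add_distrib,
    Matrix.transpose_map] at h
  have hS : g * (∑ a, B.dy c (B.N a ν) • C a) + (∑ a, B.dy c (B.N a ν) • C a).transpose * g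
      = ∑ a, B.dy c (B.N a ν) • (g * C a) + ∑ a, B.dy c (B.N a ν) • ((C a).transpose * g) := by
    simp [Finset.mul_sum, Finset.sum_mul, Matrix.transpose_sum]
  rw [← hS] at h
  rw [← sub_eq_zero] at h
  rw [← h]
  simp only [curvHV, Matrix.transpose_sub, Matrix.transpose_add, Matrix.transpose_mul]
  noncomm_ring

end DiffRing

end EAP

end

/-! ### Contractions of the Bianchi identities for a metric connection -/

noncomputable section

namespace EAP

/-- A ring of functions has zero divisors; division by `2` comes from the `ℝ`-algebra structure. -/
lemma eq_zero_of_eq_neg_self {K : Type*} [CommRing K] [Algebra ℝ K] {x : K} (h : x = -x) :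
    x = 0 := by
  rw [← one_smul ℝ x, ← add_halves (1 : ℝ), add_smul]
  nth_rw 1 [h]
  simp

lemma sum_sum_eq_zero_of_antisymm {K ι : Type*} [CommRing K] [Algebra ℝ K] [Fintype ι]
    {f : ι → ι → K} (h : ∀ i j, f i j = -f j i) : ∑ i, ∑ j, f i j = 0 := by
  refine eq_zero_of_eq_neg_self ?_
  conv_rhs => rw [Finset.sum_comm]
  simp only [← Finset.sum_neg_distrib]
  exact Finset.sum_congr rfl fun i _ => Finset.sum_congr rfl fun j _ => h i j

lemma sum_rotate {K ι κ τ : Type*} [AddCommMonoid K] [Fintype ι] [Fintype κ] [Fintype τ]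
    (f : ι → κ → τ → K) : ∑ i, ∑ j, ∑ k, f i j k = ∑ k, ∑ i, ∑ j, f i j k := by
  exact (Finset.sum_congr rfl fun i _ => Finset.sum_comm).trans Finset.sum_comm

/-- Raising an index converts skewness with respect to `g` into skewness of an actual matrix, which
can then be used entrywise under sums. -/
lemma mul_inverse_skew {K ι : Type*} [CommRing K] [Fintype ι] [DecidableEq ι]
    {g h F : Matrix ι ι K} (hgh : g * h = 1) (hhg : h * g = 1)
    (hsym : h.transpose = h) (hF : g * F + F.transpose * g = 0) :
    (F * h).transpose = -(F * h) := by
  have h1 : h * (g * F + F.transpose * g) * h = 0 := by rw [hF]; simp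
  have h2 : h * (g * F + F.transpose * g) * h = (h * g) * F * h + h * F.transpose * (g * h) := by
    noncomm_ring
  rw [h2, hhg, hgh, one_mul, mul_one] at h1
  rw [Matrix.transpose_mul, hsym]
  exact eq_neg_of_add_eq_zero_right h1

namespace DiffRing

variable {K : Type*} [CommRing K] [Algebra ℝ K] {ι : Type*} [Fintype ι] [DecidableEq ι]
variable (B : DiffRing ι K)

/-- Obtained by differentiating `g * h = 1`: the inverse metric is parallel as well, so raising
indices commutes with covariant differentiation. -/
lemma map_δ_inverse {g h Γ : Matrix ι ι K} (D : Derivation ℝ K K) (hgh : g * h = 1)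
    (hhg : h * g = 1) (hΓ : g.map D = g * Γ + Γ.transpose * g) :
    h.map D = -(Γ * h + h * Γ.transpose) := by
  have h1 : (g * h).map D = 0 := by rw [hgh, map_der_one]
  rw [map_der_mul, hΓ] at h1
  have h2 : h.map D = h * g * h.map D := by rw [hhg, one_mul]
  have h3 : h * (g * h.map D) = h * -((g * Γ + Γ.transpose * g) * h) := by
    rw [eq_neg_of_add_eq_zero_right h1]
  have h4 : h * ((g * Γ + Γ.transpose * g) * h)
      = (h * g) * Γ * h + h * Γ.transpose * (g * h) := by noncomm_ring
  rw [h2, mul_assoc, h3, mul_neg, h4, hhg, hgh]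
  noncomm_ring

/-- The Ricci contraction `R^α_{βνα}` of a horizontal curvature. -/
def ricci (Γ C : ι → Matrix ι ι K) (β ν : ι) : K := ∑ α, B.curvHH Γ C ν α α β

/-- Tracing the first Bianchi identity produces the two Ricci contractions with opposite signs and
the trace `R^α_{αβμ}`. The latter vanishes, because a curvature that is skew for `g` has zero trace.
-/
lemma ricci_antisymm {Γ C : ι → Matrix ι ι K} {g h : Matrix ι ι K} (hgh : g * h = 1)
    (hhg : h * g = 1) (hsym : h.transpose = h) (hsym' : g.transpose = g)
    (hΓ : ∀ ν, g.map (B.δ ν) = g * Γ ν + (Γ ν).transpose * g)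
    (hC : ∀ c, g.map (B.dy c) = g * C c + (C c).transpose * g)
    (hs : ∀ α μ ν, Γ ν α μ = Γ μ α ν) (β μ : ι) :
    B.ricci Γ C β μ - B.ricci Γ C μ β
      = - ∑ α, ∑ a, (C a α β * B.R a μ α + C a α μ * B.R a α β + C a α α * B.R a β μ) := by
  have htr : ∑ α, B.curvHH Γ C β μ α α = 0 := by
    set F := B.curvHH Γ C β μ with hFdef
    have h0 : (F * h).transpose = -(F * h) :=
      mul_inverse_skew hgh hhg hsym (B.curvHH_skew hΓ hC β μ)
    have h1 : ∑ α, F α α = ∑ α, ∑ ρ, (F * h) α ρ * g ρ α := by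
      refine Finset.sum_congr rfl fun α _ => ?_
      rw [← Matrix.mul_apply, mul_assoc, hhg, mul_one]
    rw [h1]
    refine sum_sum_eq_zero_of_antisymm fun i j => ?_
    have h2 := congrFun (congrFun h0 i) j
    have h3 := congrFun (congrFun hsym' i) j
    simp only [Matrix.transpose_apply, Matrix.neg_apply] at h2 h3
    rw [h2, h3]; ring
  have hb : ∑ α, (B.curvHH Γ C μ α α β + B.curvHH Γ C α β α μ + B.curvHH Γ C β μ α α)
      = ∑ α, -∑ a, (B.R a μ α * C a α β + B.R a α β * C a α μ + B.R a β μ * C a α α) :=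
    Finset.sum_congr rfl fun α _ => B.bianchi_first Γ C hs α β μ α
  rw [Finset.sum_add_distrib, Finset.sum_add_distrib, htr, add_zero] at hb
  have hsw : ∑ α, B.curvHH Γ C α β α μ = - B.ricci Γ C μ β := by
    rw [ricci, ← Finset.sum_neg_distrib]
    exact Finset.sum_congr rfl fun α _ => by rw [B.curvHH_swap Γ C β α]; rfl
  rw [hsw] at hb
  rw [sub_eq_add_neg, ricci, hb, Finset.sum_neg_distrib]
  congr 1
  exact Finset.sum_congr rfl fun α _ => Finset.sum_congr rfl fun a _ => by ring

/-- The second Bianchi identity with one index raised. -/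
lemma bianchi_raised {Γ C : ι → Matrix ι ι K} {g h : Matrix ι ι K} (hgh : g * h = 1)
    (hhg : h * g = 1)
    (hΓ : ∀ ν, g.map (B.δ ν) = g * Γ ν + (Γ ν).transpose * g) (l μ ν : ι) :
    ((B.curvHH Γ C μ ν * h).map (B.δ l) + Γ l * (B.curvHH Γ C μ ν * h)
      + (B.curvHH Γ C μ ν * h) * (Γ l).transpose)
    + ((B.curvHH Γ C ν l * h).map (B.δ μ) + Γ μ * (B.curvHH Γ C ν l * h)
      + (B.curvHH Γ C ν l * h) * (Γ μ).transpose)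
    + ((B.curvHH Γ C l μ * h).map (B.δ ν) + Γ ν * (B.curvHH Γ C l μ * h)
      + (B.curvHH Γ C l μ * h) * (Γ ν).transpose)
    = ∑ a, B.R a μ ν • (B.curvHV Γ C l a * h) + ∑ a, B.R a ν l • (B.curvHV Γ C μ a * h)
      + ∑ a, B.R a l μ • (B.curvHV Γ C ν a * h) := by
  have hB := congrArg (· * h) (B.bianchi Γ C l μ ν)
  simp only [add_mul, Finset.sum_mul, Matrix.smul_mul] at hB
  simp only [map_der_mul, map_δ_inverse _ hgh hhg (hΓ _)]
  rw [← hB]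
  noncomm_ring

/-- The contracted second Bianchi identity for a symmetric metric connection. -/
lemma bianchi_contracted {Γ C : ι → Matrix ι ι K} {g h : Matrix ι ι K} (hgh : g * h = 1)
    (hhg : h * g = 1) (hsym : h.transpose = h)
    (hΓ : ∀ ν, g.map (B.δ ν) = g * Γ ν + (Γ ν).transpose * g)
    (hC : ∀ c, g.map (B.dy c) = g * C c + (C c).transpose * g)
    (hs : ∀ α μ ν, Γ ν α μ = Γ μ α ν) (r : ι → ι → K)
    (hr : ∀ β μ, r β μ = ∑ ε, h β ε * B.ricci Γ C ε μ) (σ : ι) :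
    2 * ∑ μ, (B.δ μ (r μ σ) + ∑ ε, (Γ μ μ ε * r ε σ - Γ μ ε σ * r μ ε)) - B.δ σ (∑ β, r β β)
    = 2 * ∑ a, ∑ μ, B.R a σ μ * ∑ ε, h μ ε * (-∑ β, B.curvHV Γ C β a β ε)
      + ∑ a, ∑ α, ∑ μ, B.R a α μ * ∑ ε, h μ ε * B.curvHV Γ C σ a α ε := by
  set X : ι → ι → Matrix ι ι K := fun μ ν => B.curvHH Γ C μ ν * h with hX
  set Y : ι → ι → Matrix ι ι K := fun ν a => B.curvHV Γ C ν a * h with hY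
  have hh : ∀ i j, h i j = h j i := fun i j => (congrFun (congrFun hsym i) j).symm
  have Xs : ∀ μ ν i j, X μ ν i j = -X μ ν j i := fun μ ν i j =>
    (congrFun (congrFun (mul_inverse_skew hgh hhg hsym (B.curvHH_skew hΓ hC μ ν)) j) i)
  have Ys : ∀ ν a i j, Y ν a i j = -Y ν a j i := fun ν a i j =>
    (congrFun (congrFun (mul_inverse_skew hgh hhg hsym (B.curvHV_skew hΓ hC ν a)) j) i)
  have Xa : ∀ μ ν i j, X μ ν i j = -X ν μ i j := fun μ ν i j => by
    simp only [hX]; rw [B.curvHH_swap Γ C ν μ, Matrix.neg_mul, Matrix.neg_apply]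
  -- `X` is skew in its form indices and in its matrix indices, so the mixed Ricci tensor appears
  -- under several contractions with signs; the next three facts list those that the contracted
  -- identity needs.
  have rX : ∀ β μ, r β μ = ∑ α, X μ α α β := by
    intro β μ
    simp only [hr, ricci, hX, Matrix.mul_apply, Finset.mul_sum]
    rw [Finset.sum_comm]
    exact Finset.sum_congr rfl fun α _ => Finset.sum_congr rfl fun ε _ => by
      rw [hh β ε, mul_comm]
  have rX' : ∀ β μ, r β μ = -∑ α, X α μ α β := by
    intro β μ
    rw [rX, ← Finset.sum_neg_distrib]
    exact Finset.sum_congr rfl fun α _ => Xa _ _ _ _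
  have rX'' : ∀ β μ, r β μ = -∑ α, X μ α β α := by
    intro β μ
    rw [rX, ← Finset.sum_neg_distrib]
    exact Finset.sum_congr rfl fun α _ => Xs _ _ _ _
  have PU : ∀ μ a, ∑ ε, h μ ε * (-∑ β, B.curvHV Γ C β a β ε) = -∑ β, Y β a β μ := by
    intro μ a
    simp only [hY, Matrix.mul_apply, mul_neg, Finset.sum_neg_distrib, Finset.mul_sum]
    rw [Finset.sum_comm]
    congr 1
    exact Finset.sum_congr rfl fun α _ => Finset.sum_congr rfl fun ε _ => by
      rw [hh μ ε, mul_comm]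
  have PUU : ∀ α μ a, ∑ ε, h μ ε * B.curvHV Γ C σ a α ε = Y σ a α μ := by
    intro α μ a
    simp only [hY, Matrix.mul_apply]
    exact Finset.sum_congr rfl fun ε _ => by rw [hh μ ε, mul_comm]
  -- The raised identity is used with form indices `(σ, β, α)` and matrix entry `(α, β)`, both
  -- summed. One cyclic term gives the derivative of the scalar, and the other two each give minus
  -- the divergence of Ricci, whence the factor `2`.
  have key : ∑ α, ∑ β,
      ((B.δ σ (X β α α β) + ∑ ε, Γ σ α ε * X β α ε β + ∑ ε, X β α α ε * Γ σ β ε)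
      + (B.δ β (X α σ α β) + ∑ ε, Γ β α ε * X α σ ε β + ∑ ε, X α σ α ε * Γ β β ε)
      + (B.δ α (X σ β α β) + ∑ ε, Γ α α ε * X σ β ε β + ∑ ε, X σ β α ε * Γ α β ε))
      = ∑ α, ∑ β, (∑ a, B.R a β α * Y σ a α β + ∑ a, B.R a α σ * Y β a α β
        + ∑ a, B.R a σ β * Y α a α β) := by
    refine Finset.sum_congr rfl fun α _ => Finset.sum_congr rfl fun β _ => ?_
    have := congrFun (congrFun (B.bianchi_raised (C := C) hgh hhg hΓ σ β α) α) β
    simpa only [Matrix.add_apply, Matrix.map_apply, Matrix.mul_apply (M := Γ _),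
      Matrix.mul_apply (N := (Γ _).transpose), Matrix.transpose_apply, Matrix.sum_apply,
      Matrix.smul_apply, smul_eq_mul] using this
  simp only [Finset.sum_add_distrib] at key
  have t1 : ∑ α, ∑ β, B.δ σ (X β α α β) = B.δ σ (∑ β, r β β) := by
    rw [Finset.sum_comm]; simp only [rX, map_sum]
  have t2 : ∑ α, ∑ β, B.δ β (X α σ α β) = -∑ β, B.δ β (r β σ) := by
    rw [Finset.sum_comm]; simp only [rX', map_sum, map_neg, Finset.sum_neg_distrib, neg_neg]
  have t3 : ∑ α, ∑ β, B.δ α (X σ β α β) = -∑ β, B.δ β (r β σ) := by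
    simp only [rX'', map_sum, map_neg, Finset.sum_neg_distrib, neg_neg]
  have t4 : ∑ α, ∑ β, ∑ ε, Γ σ α ε * X β α ε β = ∑ α, ∑ ε, Γ σ α ε * r ε α := by
    refine Finset.sum_congr rfl fun α _ => ?_
    rw [Finset.sum_comm]
    simp only [rX, Finset.mul_sum]
    exact Finset.sum_congr rfl fun ε _ => Finset.sum_congr rfl fun β _ => by
      rw [Xs, Xa β α]; ring
  have t5 : ∑ α, ∑ β, ∑ ε, X β α α ε * Γ σ β ε = ∑ α, ∑ ε, Γ σ α ε * r ε α := by
    rw [Finset.sum_comm]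
    refine Finset.sum_congr rfl fun α _ => ?_
    rw [Finset.sum_comm]
    simp only [rX, Finset.mul_sum]
    exact Finset.sum_congr rfl fun ε _ => Finset.sum_congr rfl fun β _ => mul_comm _ _
  -- A symmetric connection contracted with a skew pair of indices; the same happens in `t9`.
  have t6 : ∑ α, ∑ β, ∑ ε, Γ β α ε * X α σ ε β = 0 :=
    Finset.sum_eq_zero fun α _ => sum_sum_eq_zero_of_antisymm fun i j => by
      rw [hs α j i, Xs]; ring
  have t7 : ∑ α, ∑ β, ∑ ε, X α σ α ε * Γ β β ε = -∑ β, ∑ ε, Γ β β ε * r ε σ := by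
    rw [Finset.sum_comm, ← Finset.sum_neg_distrib]
    refine Finset.sum_congr rfl fun β _ => ?_
    rw [Finset.sum_comm, ← Finset.sum_neg_distrib]
    refine Finset.sum_congr rfl fun ε _ => ?_
    rw [rX', ← Finset.sum_mul]; ring
  have t8 : ∑ α, ∑ β, ∑ ε, Γ α α ε * X σ β ε β = -∑ β, ∑ ε, Γ β β ε * r ε σ := by
    rw [← Finset.sum_neg_distrib]
    refine Finset.sum_congr rfl fun β _ => ?_
    rw [Finset.sum_comm, ← Finset.sum_neg_distrib]
    refine Finset.sum_congr rfl fun ε _ => ?_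
    rw [rX'', ← Finset.mul_sum]; ring
  have t9 : ∑ α, ∑ β, ∑ ε, X σ β α ε * Γ α β ε = 0 := by
    rw [Finset.sum_comm]
    exact Finset.sum_eq_zero fun α _ => sum_sum_eq_zero_of_antisymm fun i j => by
      rw [hs α j i, Xs]; ring
  have t10 : ∑ α, ∑ β, ∑ a, B.R a β α * Y σ a α β
      = -∑ a, ∑ α, ∑ μ, B.R a α μ * Y σ a α μ := by
    simp only [← Finset.sum_neg_distrib]
    rw [sum_rotate]
    exact Finset.sum_congr rfl fun a _ => Finset.sum_congr rfl fun α _ =>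
      Finset.sum_congr rfl fun β _ => by rw [B.R_swap a α β]; ring
  have t11 : ∑ α, ∑ β, ∑ a, B.R a α σ * Y β a α β
      = ∑ a, ∑ μ, B.R a σ μ * ∑ β, Y β a β μ := by
    simp only [Finset.mul_sum]
    rw [sum_rotate]
    exact Finset.sum_congr rfl fun a _ => Finset.sum_congr rfl fun α _ =>
      Finset.sum_congr rfl fun β _ => by rw [B.R_swap a σ α, Ys]; ring
  have t12 : ∑ α, ∑ β, ∑ a, B.R a σ β * Y α a α β
      = ∑ a, ∑ μ, B.R a σ μ * ∑ β, Y β a β μ := by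
    simp only [Finset.mul_sum]
    rw [sum_rotate]
    exact Finset.sum_congr rfl fun a _ => Finset.sum_comm
  rw [t1, t2, t3, t4, t5, t6, t7, t8, t9, t10, t11, t12] at key
  simp only [PU, PUU, Finset.sum_add_distrib, Finset.sum_sub_distrib]
  have t13 : ∑ μ, ∑ ε, Γ μ ε σ * r μ ε = ∑ α, ∑ ε, Γ σ α ε * r ε α := by
    rw [Finset.sum_comm]
    exact Finset.sum_congr rfl fun ε _ => Finset.sum_congr rfl fun β _ => by rw [hs]
  rw [t13]
  simp only [mul_neg, Finset.sum_neg_distrib]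
  linear_combination -key

end DiffRing

end EAP

end

/-! ### Contortion, curvature and the Ricci contraction in the frame -/

noncomputable section

namespace EAP

/-- Jacobi's formula for a derivation. -/
lemma derivation_det {K ι : Type*} [CommRing K] [Algebra ℝ K] [Fintype ι] [DecidableEq ι]
    (D : Derivation ℝ K K) (M : Matrix ι ι K) :
    D M.det = ∑ i, ∑ j, M.adjugate j i * D (M i j) := by
  have hprod : ∀ (s : Finset ι) (f : ι → K),
      D (∏ i ∈ s, f i) = ∑ i ∈ s, (∏ j ∈ s.erase i, f j) * D (f i) := by
    intro s f
    induction s using Finset.induction_on with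
    | empty => simp
    | insert a s ha ih =>
      rw [Finset.prod_insert ha, Derivation.leibniz, ih, Finset.sum_insert ha,
        Finset.erase_insert ha, smul_eq_mul, smul_eq_mul, Finset.mul_sum, add_comm]
      congr 1
      refine Finset.sum_congr rfl fun i hi => ?_
      have hne : a ≠ i := fun h => ha (h ▸ hi)
      rw [Finset.erase_insert_of_ne hne,
        Finset.prod_insert (fun h => ha (Finset.mem_of_mem_erase h)), mul_assoc]
  -- Laplace expansion along the differentiated row, so it remains to differentiate the permutation
  -- expansion one row at a time.
  have hrow : ∀ i, ∑ j, M.adjugate j i * D (M i j)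
      = (M.updateRow i fun j => D (M i j)).det := by
    intro i
    rw [Matrix.det_eq_sum_mul_adjugate_row _ i]
    refine Finset.sum_congr rfl fun j _ => ?_
    rw [Matrix.updateRow_self, mul_comm, Matrix.adjugate_apply, Matrix.adjugate_apply,
      Matrix.updateRow_idem]
  simp only [hrow]
  rw [← Matrix.det_transpose, Matrix.det_apply, map_sum]
  simp only [← Matrix.det_transpose (M.updateRow _ _), Matrix.det_apply]
  rw [Finset.sum_comm]
  refine Finset.sum_congr rfl fun τ _ => ?_
  rw [← Finset.smul_sum, Units.smul_def, Units.smul_def, map_zsmul, hprod]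
  congr 1
  simp only [Matrix.transpose_apply]
  refine Finset.sum_congr rfl fun i _ => ?_
  rw [← Finset.mul_prod_erase Finset.univ _ (Finset.mem_univ i), Matrix.updateRow_self, mul_comm]
  congr 1
  refine Finset.prod_congr rfl fun j hj => ?_
  rw [Matrix.updateRow_ne (Finset.ne_of_mem_erase hj)]

namespace DiffRing

section

variable {K : Type*} [CommRing K] {ι : Type*} [Fintype ι]

/-- `γ_{ijk}` in the frame, from the contortion matrices `γ_ν`. -/
def frameThird (γ : ι → Matrix ι ι K) (V : Matrix ι ι K) (i j k : ι) : K := ∑ ν, γ ν i j * V ν k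

/-- The contortion matrices already carry two frame indices; this recovers the remaining coordinate
index from the full frame components. -/
lemma frameThird_mul [DecidableEq ι] {L V : Matrix ι ι K} (hVL : V * L = 1) (γ : ι → Matrix ι ι K) (i j ν : ι) :
    γ ν i j = ∑ k, frameThird γ V i j k * L k ν := by
  simp only [frameThird, Finset.sum_mul]
  rw [Finset.sum_comm]
  have : ∀ μ, ∑ k, γ μ i j * V μ k * L k ν = γ μ i j * (1 : Matrix ι ι K) μ ν := by
    intro μ
    rw [← hVL, Matrix.mul_apply, Finset.mul_sum]
    exact Finset.sum_congr rfl fun _ _ => by ring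
  simp [this, Matrix.one_apply]

end

variable {K : Type*} [CommRing K] [Algebra ℝ K] {ι : Type*} [Fintype ι]
variable (B : DiffRing ι K) (L V : Matrix ι ι K)

/-! ### Frames -/

/-- The derivation `e_k = λ_k^ν δ_ν`. -/
def e (k : ι) : Derivation ℝ K K := ∑ ν, V ν k • B.δ ν

lemma e_apply (k : ι) (f : K) : B.e V k f = ∑ ν, V ν k * B.δ ν f := by
  have h := congrFun (map_sum (Derivation.coeFnAddMonoidHom (R := ℝ) (A := K) (M := K))
    (fun ν => V ν k • B.δ ν) Finset.univ) f
  simp only [Derivation.coeFnAddMonoidHom_apply, Finset.sum_apply, Derivation.smul_apply,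
    smul_eq_mul] at h
  rw [e, h]

/-- Frame components of the coefficients of the canonical connection. -/
def can (i j k : ι) : K := ∑ ν, ((L.map (B.δ ν)) * V) i j * V ν k

lemma can_eq_e (i j k : ι) : B.can L V i j k = ∑ μ, B.e V k (L i μ) * V μ j := by
  simp only [can, e_apply, Matrix.mul_apply, Matrix.map_apply, Finset.sum_mul]
  rw [Finset.sum_comm]
  exact Finset.sum_congr rfl fun _ _ => Finset.sum_congr rfl fun _ _ => by ring

/-- Frame components of the torsion. -/
def tor (i j k : ι) : K := B.can L V i j k - B.can L V i k j

/-- Frame components of the basic vector. -/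
def bas (c : ι) : K := ∑ m, B.tor L V m c m

lemma tor_swap (i j k : ι) : B.tor L V i k j = -B.tor L V i j k := by simp [tor]

/-- The frame contortion matrix along a derivation `D`, for a connection matrix `Γ`. -/
def cont (D : Derivation ℝ K K) (Γ : Matrix ι ι K) : Matrix ι ι K := L.map D * V - L * Γ * V

variable {B L V} [DecidableEq ι]

lemma cont_mul (hVL : V * L = 1) (D : Derivation ℝ K K) (Γ : Matrix ι ι K) :
    L * Γ = L.map D - cont L V D Γ * L := by
  rw [cont, sub_mul, mul_assoc, mul_assoc (L * Γ), hVL]; simp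

/-- With `g = LᵀL`, the parallelism of `L` already accounts for the whole derivative of `g`. A
difference of two metric connections is skew for `g`, and in the orthonormal frame this is ordinary
skewness. -/
lemma cont_skew (hLV : L * V = 1) {D : Derivation ℝ K K} {Γ : Matrix ι ι K}
    (hΓ : (L.transpose * L).map D = (L.transpose * L) * Γ + Γ.transpose * (L.transpose * L)) :
    (cont L V D Γ).transpose = -cont L V D Γ := by
  have hVL' : V.transpose * L.transpose = 1 := by
    rw [← Matrix.transpose_mul, hLV, Matrix.transpose_one]
  have h := congrArg (fun M => V.transpose * M * V) hΓ
  have ht : L.transpose.map D = (L.map D).transpose := Matrix.transpose_map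
  simp only [map_der_mul, ht] at h
  have h1 : V.transpose * ((L.map D).transpose * L + L.transpose * L.map D) * V
      = V.transpose * (L.map D).transpose * (L * V)
        + (V.transpose * L.transpose) * L.map D * V := by noncomm_ring
  have h2 : V.transpose * (L.transpose * L * Γ + Γ.transpose * (L.transpose * L)) * V
      = (V.transpose * L.transpose) * L * Γ * V
        + V.transpose * Γ.transpose * L.transpose * (L * V) := by noncomm_ring
  rw [h1, h2, hLV, hVL', one_mul, one_mul, mul_one, mul_one] at h
  rw [cont, Matrix.transpose_sub, Matrix.transpose_mul, Matrix.transpose_mul, Matrix.transpose_mul,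
    neg_sub, sub_eq_sub_iff_add_eq_add, h]
  noncomm_ring

/-- Curvature is covariant under the change of gauge by `L`. In the frame gauge the canonical
connection has form zero, so the given connection has form minus the contortion, and the bracketed
matrix is the curvature of that form. -/
lemma mul_curvHH (hVL : V * L = 1) (Γ C : ι → Matrix ι ι K) (μ ν : ι) :
    L * B.curvHH Γ C μ ν =
      (-(cont L V (B.δ ν) (Γ ν)).map (B.δ μ) + (cont L V (B.δ μ) (Γ μ)).map (B.δ ν)
        + (cont L V (B.δ μ) (Γ μ) * cont L V (B.δ ν) (Γ ν)
          - cont L V (B.δ ν) (Γ ν) * cont L V (B.δ μ) (Γ μ))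
        + ∑ a, B.R a μ ν • cont L V (B.dy a) (C a)) * L := by
  have hΓ : ∀ ν, L * Γ ν = L.map (B.δ ν) - cont L V (B.δ ν) (Γ ν) * L := fun ν =>
    cont_mul hVL _ _
  have hC : ∀ a, L * C a = L.map (B.dy a) - cont L V (B.dy a) (C a) * L := fun a =>
    cont_mul hVL _ _
  generalize hγ : (fun ν => cont L V (B.δ ν) (Γ ν)) = γ at *
  have hγ' : ∀ ν, cont L V (B.δ ν) (Γ ν) = γ ν := fun ν => congrFun hγ ν
  simp only [hγ'] at hΓ ⊢
  have hd : ∀ μ ν, L * (Γ ν).map (B.δ μ) = (L.map (B.δ ν)).map (B.δ μ)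
      - ((γ ν).map (B.δ μ) * L + γ ν * L.map (B.δ μ)) - L.map (B.δ μ) * Γ ν := by
    intro μ ν
    have h := congrArg (fun M => M.map (B.δ μ)) (hΓ ν)
    simp only [map_der_mul, map_der_sub] at h
    rw [← h]; noncomm_ring
  have hq : ∀ μ ν, L * (Γ μ * Γ ν) = L.map (B.δ μ) * Γ ν
      - γ μ * (L.map (B.δ ν) - γ ν * L) := by
    intro μ ν
    rw [← mul_assoc, hΓ, sub_mul, mul_assoc, hΓ]
  have hs : L * ∑ a, B.R a μ ν • C a = ∑ a, B.R a μ ν • L.map (B.dy a)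
      - (∑ a, B.R a μ ν • cont L V (B.dy a) (C a)) * L := by
    simp only [Finset.mul_sum, Finset.sum_mul, Matrix.mul_smul, Matrix.smul_mul, hC, smul_sub,
      Finset.sum_sub_distrib]
  rw [curvHH, mul_sub, mul_add, mul_sub, mul_sub, hd, hd, hq, hq, hs, B.map_δ_δ L μ ν]
  noncomm_ring

variable (B)

lemma sum_frame_der (hLV : L * V = 1) (D : Derivation ℝ K K) (i j : ι) :
    ∑ β, L i β * D (V β j) = -∑ β, D (L i β) * V β j := by
  have h0 : (L * V).map D = 0 := by rw [hLV, map_der_one]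
  rw [map_der_mul] at h0
  have h := congrFun (congrFun h0 i) j
  simp only [Matrix.add_apply, Matrix.mul_apply, Matrix.map_apply, Matrix.zero_apply] at h
  linear_combination h

/-- Moving the frame vector `λ_n` inside the derivation costs its own derivative; differentiating `L
* V = 1` expresses that cost through the canonical coefficients. -/
lemma sum_mul_e_cont (hLV : L * V = 1) (hVL : V * L = 1) (γ : ι → Matrix ι ι K) (m j n k : ι) :
    ∑ α, V α n * B.e V k (γ α m j)
      = B.e V k (frameThird γ V m j n) + ∑ s, frameThird γ V m j s * B.can L V s n k := by
  have h1 : ∑ α, γ α m j * B.e V k (V α n)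
      = -∑ s, frameThird γ V m j s * B.can L V s n k := by
    simp only [can_eq_e]
    have h2 : ∀ s, ∑ μ, B.e V k (L s μ) * V μ n = -∑ β, L s β * B.e V k (V β n) := fun s => by
      rw [sum_frame_der hLV]; ring
    simp only [h2, mul_neg, Finset.sum_neg_distrib, neg_neg, Finset.mul_sum]
    rw [Finset.sum_comm]
    refine Finset.sum_congr rfl fun α _ => ?_
    rw [frameThird_mul hVL γ m j α, Finset.sum_mul]
    exact Finset.sum_congr rfl fun _ _ => by ring
  have h3 : B.e V k (frameThird γ V m j n)
      = ∑ α, V α n * B.e V k (γ α m j) + ∑ α, γ α m j * B.e V k (V α n) := by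
    simp only [frameThird, map_sum, Derivation.leibniz, smul_eq_mul, Finset.sum_add_distrib]
    ring
  rw [h3, h1]; ring

/-- The Ricci contraction in the frame, in terms of the contortion. -/
lemma frame_ricci (hLV : L * V = 1) (hVL : V * L = 1) (Γ C : ι → Matrix ι ι K)
    {γ : ι → ι → ι → K}
    (hγ : ∀ i j k, γ i j k = frameThird (fun ν => cont L V (B.δ ν) (Γ ν)) V i j k) (j k : ι) :
    ∑ β, ∑ μ, V β j * V μ k * B.ricci Γ C β μ
      = ∑ m, (B.e V m (γ m j k) - B.e V k (γ m j m))
        + ∑ m, ∑ s, (B.tor L V s k m * γ m j s + γ m s k * γ s j m - γ m s m * γ s j k)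
        + ∑ m, ∑ a, (∑ μ, ∑ α, B.R a μ α * V μ k * V α m) * cont L V (B.dy a) (C a) m j := by
  set c : ι → Matrix ι ι K := fun ν => cont L V (B.δ ν) (Γ ν) with hc
  set F : ι → ι → Matrix ι ι K := fun μ ν =>
    -(c ν).map (B.δ μ) + (c μ).map (B.δ ν) + (c μ * c ν - c ν * c μ)
        + ∑ a, B.R a μ ν • cont L V (B.dy a) (C a) with hF
  have h1 : ∀ μ ν, B.curvHH Γ C μ ν * V = V * F μ ν := by
    intro μ ν
    have h := mul_curvHH (B := B) hVL Γ C μ ν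
    have h2 : B.curvHH Γ C μ ν * V = V * (L * B.curvHH Γ C μ ν) * V := by
      rw [← mul_assoc, hVL, one_mul]
    rw [h2, h, mul_assoc, mul_assoc, hLV, mul_one]
  have h2 : ∑ β, ∑ μ, V β j * V μ k * B.ricci Γ C β μ
      = ∑ m, ∑ μ, ∑ α, V μ k * V α m * F μ α m j := by
    have h3 : ∀ μ, ∑ β, V β j * V μ k * B.ricci Γ C β μ
        = ∑ α, V μ k * ∑ m, V α m * F μ α m j := by
      intro μ
      simp only [ricci, Finset.mul_sum]
      rw [Finset.sum_comm]
      refine Finset.sum_congr rfl fun α _ => ?_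
      have h4 := congrFun (congrFun (h1 μ α) α) j
      rw [Matrix.mul_apply, Matrix.mul_apply] at h4
      rw [← Finset.mul_sum, ← h4, Finset.mul_sum]
      exact Finset.sum_congr rfl fun _ _ => by ring
    rw [Finset.sum_comm]
    simp only [h3, Finset.mul_sum]
    rw [sum_rotate]
    exact Finset.sum_congr rfl fun _ _ => Finset.sum_congr rfl fun _ _ =>
      Finset.sum_congr rfl fun _ _ => by ring
  rw [h2, ← Finset.sum_add_distrib, ← Finset.sum_add_distrib]
  refine Finset.sum_congr rfl fun m _ => ?_
  have e1 : ∀ p q i j, ∑ μ, ∑ α, V μ p * V α q * B.δ μ (c α i j)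
      = B.e V p (γ i j q) + ∑ s, γ i j s * B.can L V s q p := by
    intro p q i j
    simp only [hγ]
    rw [← B.sum_mul_e_cont hLV hVL c i j q p, Finset.sum_comm]
    simp only [e_apply, Finset.mul_sum]
    exact Finset.sum_congr rfl fun _ _ => Finset.sum_congr rfl fun _ _ => by ring
  have e2 : ∀ p q i j s, ∑ μ, ∑ α, V μ p * V α q * (c μ i s * c α s j)
      = γ i s p * γ s j q := by
    intro p q i j s
    simp only [hγ, frameThird, Finset.sum_mul_sum]
    exact Finset.sum_congr rfl fun _ _ => Finset.sum_congr rfl fun _ _ => by ring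
  have e3 : ∑ μ, ∑ α, V μ k * V α m * F μ α m j
      = -(∑ μ, ∑ α, V μ k * V α m * B.δ μ (c α m j))
        + (∑ μ, ∑ α, V μ k * V α m * B.δ α (c μ m j))
        + (∑ s, ∑ μ, ∑ α, V μ k * V α m * (c μ m s * c α s j)
          - ∑ s, ∑ μ, ∑ α, V μ k * V α m * (c α m s * c μ s j))
        + ∑ a, (∑ μ, ∑ α, B.R a μ α * V μ k * V α m) * cont L V (B.dy a) (C a) m j := by
    simp only [Finset.sum_mul]
    rw [← sum_rotate fun μ α s => V μ k * V α m * (c μ m s * c α s j),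
      ← sum_rotate fun μ α s => V μ k * V α m * (c α m s * c μ s j),
      ← sum_rotate fun μ α a => B.R a μ α * V μ k * V α m * cont L V (B.dy a) (C a) m j]
    simp only [← Finset.sum_neg_distrib, ← Finset.sum_add_distrib, ← Finset.sum_sub_distrib]
    refine Finset.sum_congr rfl fun μ _ => Finset.sum_congr rfl fun α _ => ?_
    simp only [hF, Matrix.add_apply, Matrix.sub_apply, Matrix.neg_apply, Matrix.map_apply,
      Matrix.mul_apply, Matrix.sum_apply, Matrix.smul_apply, smul_eq_mul, Finset.sum_sub_distrib,
      mul_add, mul_sub, Finset.mul_sum]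
    have : ∀ a, V μ k * V α m * (B.R a μ α * cont L V (B.dy a) (C a) m j)
      = B.R a μ α * V μ k * V α m * cont L V (B.dy a) (C a) m j := fun a => by ring
    simp only [this]
    ring
  have e4 : ∑ μ, ∑ α, V μ k * V α m * B.δ α (c μ m j)
      = B.e V m (γ m j k) + ∑ s, γ m j s * B.can L V s k m := by
    rw [← e1, Finset.sum_comm]
    exact Finset.sum_congr rfl fun _ _ => Finset.sum_congr rfl fun _ _ => by ring
  have e5 : ∀ s, ∑ μ, ∑ α, V μ k * V α m * (c α m s * c μ s j) = γ m s m * γ s j k := by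
    intro s
    rw [← e2, Finset.sum_comm]
    exact Finset.sum_congr rfl fun _ _ => Finset.sum_congr rfl fun _ _ => by ring
  -- The two derivative terms carry canonical coefficients with their last two indices interchanged;
  -- their difference is the torsion.
  rw [e3, e4, e1]
  simp only [e2, e5, tor, sub_mul, Finset.sum_add_distrib, Finset.sum_sub_distrib]
  have e6 : ∀ s, B.can L V s k m * γ m j s = γ m j s * B.can L V s k m := fun s => mul_comm _ _
  have e7 : ∀ s, B.can L V s m k * γ m j s = γ m j s * B.can L V s m k := fun s => mul_comm _ _
  simp only [e6, e7]
  ring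

end DiffRing

end EAP

end

/-! ### Lagrangian and variations in terms of torsion; Euler–Lagrange expression in the frame -/

noncomputable section

namespace EAP

section Torsion

variable {R ι : Type*} [CommRing R] [Fintype ι] [DecidableEq ι] (T : ι → ι → ι → R) (C : ι → R)

/-- The Lagrangian scalar `T_{ijc} T_{jic} - C_c C_c` of a torsion `T` with basic vector `C`, in an
orthonormal frame. -/
def lagOf (T : ι → ι → ι → R) (C : ι → R) : R :=
  ∑ c, ((∑ i, ∑ j, T i j c * T j i c) - C c * C c)

/-- The variation of the Lagrangian density with respect to the coframe. -/
def lagDerOf (k m : ι) : R :=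
  (if m = k then lagOf T C else 0) - 2 * ∑ i, ∑ c, T m i c * T i k c
    - 2 * ∑ i, ∑ j, T j i m * T i j k + 2 * (C m * C k) + 2 * ∑ c, C c * T m c k

/-- The superpotential, i.e. the variation of the Lagrangian density with respect to the
derivatives of the coframe. -/
def superpotOf (k b c : ι) : R :=
  2 * (T b k c - T c k b - (if k = c then C b else 0) + (if k = b then C c else 0))

end Torsion

namespace DiffRing

variable {K : Type*} [CommRing K] [Algebra ℝ K] {ι : Type*} [Fintype ι] [DecidableEq ι]
variable (B : DiffRing ι K) (L V : Matrix ι ι K)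

/-! ### The Euler-Lagrange expression in the frame -/

/-- The scalar `T_{ijc} T_{jic} - C_c C_c`. -/
def lag : K := lagOf (B.tor L V) (B.bas L V)

/-- Frame components of `|λ|⁻¹ ∂ℋ/∂λ_{kβ}`. -/
def lagDer (k m : ι) : K := lagDerOf (B.tor L V) (B.bas L V) k m

/-- Frame components of `|λ|⁻¹ ∂ℋ/∂λ_{kβ,γ}`. -/
def superpot (k b c : ι) : K := superpotOf (B.tor L V) (B.bas L V) k b c

/-- `∂ℋ/∂λ_{kβ,γ}`. -/
def momentum (k β γ : ι) : K := L.det * ∑ b, ∑ c, V β b * V γ c * B.superpot L V k b c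

/-- `N_γ = ∂̇_a N^a_γ`. -/
def divN (γ : ι) : K := ∑ a, B.dy a (B.N a γ)

/-- The Euler-Lagrange expression `δℋ/δλ_{kβ}`. -/
def eulerLagrange (k β : ι) : K :=
  L.det * ∑ m, V β m * B.lagDer L V k m - ∑ γ, B.dx γ (B.momentum L V k β γ)
    - ∑ a, B.dy a (-∑ γ, B.N a γ * B.momentum L V k β γ)

variable {L V}

/-- The `y`-momentum is `-N^a_γ` times the `x`-momentum, so the two divergences combine into `δ_γ`.
The derivative that falls on `N` itself leaves `N_γ`: this is the source of all `N_β` and `Z` terms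
in the energy–momentum tensor. -/
lemma eulerLagrange_eq (k β : ι) : B.eulerLagrange L V k β =
    L.det * ∑ m, V β m * B.lagDer L V k m - ∑ γ, B.δ γ (B.momentum L V k β γ)
      + ∑ γ, B.divN γ * B.momentum L V k β γ := by
  have h : ∑ a, B.dy a (-∑ γ, B.N a γ * B.momentum L V k β γ)
      = -∑ γ, B.divN γ * B.momentum L V k β γ
        - ∑ γ, ∑ a, B.N a γ * B.dy a (B.momentum L V k β γ) := by
    simp only [map_neg, map_sum, Derivation.leibniz, smul_eq_mul, divN, Finset.sum_mul,
      Finset.sum_add_distrib, Finset.sum_neg_distrib]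
    rw [Finset.sum_comm, Finset.sum_comm (f := fun a γ => B.momentum L V k β γ * B.dy a (B.N a γ))]
    simp only [mul_comm (B.momentum L V k β _)]
    ring
  rw [eulerLagrange, h]
  simp only [δ_apply, Finset.sum_sub_distrib]
  ring

/-- Jacobi's formula for `|λ|` gives a trace of canonical coefficients, and the derivative of the
frame vector gives the other contraction; together they form minus a trace of the torsion. Here
`V.det` plays the role of `|λ|⁻¹`. -/
lemma divergence_frame (hLV : L * V = 1) (hVL : V * L = 1) (c : ι) :
    V.det * ∑ γ, B.δ γ (L.det * V γ c) = -B.bas L V c := by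
  have hdet : V.det * L.det = 1 := by rw [← Matrix.det_mul, hVL, Matrix.det_one]
  have hadj : ∀ i j, V.det * L.adjugate i j = V i j := by
    intro i j
    have h : V.det • L.adjugate = V := by
      have h1 : V * (L * L.adjugate) = V * (L.det • 1) := by rw [Matrix.mul_adjugate]
      rw [← mul_assoc, hVL, one_mul] at h1
      rw [h1, Matrix.mul_smul, smul_smul, hdet, one_smul, mul_one]
    exact congrFun (congrFun h i) j
  have h1 : ∀ γ, V.det * B.δ γ L.det = ∑ m, (L.map (B.δ γ) * V) m m := by
    intro γ
    rw [derivation_det, Finset.mul_sum]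
    refine Finset.sum_congr rfl fun i _ => ?_
    rw [Finset.mul_sum, Matrix.mul_apply]
    refine Finset.sum_congr rfl fun j _ => ?_
    rw [← mul_assoc, hadj, Matrix.map_apply, mul_comm]
  have h2 : ∀ γ, B.δ γ (V γ c) = -∑ m, V γ m * (L.map (B.δ γ) * V) m c := by
    intro γ
    have h3 : (L * V).map (B.δ γ) = 0 := by rw [hLV, map_der_one]
    rw [map_der_mul] at h3
    have h4 : V.map (B.δ γ) = -(V * (L.map (B.δ γ) * V)) := by
      rw [eq_neg_of_add_eq_zero_left h3, mul_neg, neg_neg, ← mul_assoc, hVL, one_mul]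
    have := congrFun (congrFun h4 γ) c
    simpa [Matrix.mul_apply (M := V)] using this
  have h5 : ∀ γ, V.det * B.δ γ (L.det * V γ c)
      = ∑ m, ((L.map (B.δ γ) * V) m m * V γ c - (L.map (B.δ γ) * V) m c * V γ m) := by
    intro γ
    rw [Derivation.leibniz, smul_eq_mul, smul_eq_mul, h2, Finset.sum_sub_distrib, ← Finset.sum_mul,
      ← h1]
    have : ∑ m, V γ m * (L.map (B.δ γ) * V) m c = ∑ m, (L.map (B.δ γ) * V) m c * V γ m :=
      Finset.sum_congr rfl fun _ _ => mul_comm _ _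
    rw [this]
    linear_combination -(∑ m, (L.map (B.δ γ) * V) m c * V γ m) * hdet
  rw [Finset.mul_sum]
  simp only [h5, bas, ← Finset.sum_neg_distrib]
  rw [Finset.sum_comm]
  refine Finset.sum_congr rfl fun m _ => ?_
  simp only [tor, can, Finset.sum_sub_distrib]
  ring

/-- The product rule splits the divergence of the momentum according to where the derivative lands:
on the density `|λ| λ_c` (basic vector), on the superpotential, or on the remaining frame leg
(canonical coefficients). -/
lemma eulerLagrange_frame (hLV : L * V = 1) (hVL : V * L = 1) (i k : ι) :
    V.det * ∑ β, L i β * B.eulerLagrange L V k β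
      = B.lagDer L V k i - ∑ c, B.e V c (B.superpot L V k i c)
        + ∑ b, ∑ c, B.superpot L V k b c * B.can L V i b c
        + ∑ c, B.bas L V c * B.superpot L V k i c
        + ∑ c, (∑ γ, V γ c * B.divN γ) * B.superpot L V k i c := by
  have hdet : V.det * L.det = 1 := by rw [← Matrix.det_mul, hVL, Matrix.det_one]
  have hcol : ∀ f : ι → K, ∑ β, L i β * ∑ m, V β m * f m = f i := by
    intro f
    have h1 : ∀ m, ∑ β, L i β * (V β m * f m) = (1 : Matrix ι ι K) i m * f m := by
      intro m
      rw [← hLV, Matrix.mul_apply, Finset.sum_mul]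
      exact Finset.sum_congr rfl fun _ _ => by ring
    simp only [Finset.mul_sum]
    rw [Finset.sum_comm]
    simp [h1, Matrix.one_apply]
  have hmom : ∀ γ, ∑ β, L i β * B.momentum L V k β γ
      = ∑ c, L.det * V γ c * B.superpot L V k i c := by
    intro γ
    have h1 : ∀ β, L i β * B.momentum L V k β γ
        = L i β * ∑ m, V β m * (L.det * ∑ c, V γ c * B.superpot L V k m c) := by
      intro β
      simp only [momentum, Finset.mul_sum]
      exact Finset.sum_congr rfl fun _ _ => Finset.sum_congr rfl fun _ _ => by ring
    simp only [h1]
    rw [hcol, Finset.mul_sum]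
    exact Finset.sum_congr rfl fun _ _ => by ring
  have hder : ∀ γ, ∑ β, L i β * B.δ γ (B.momentum L V k β γ)
      = ∑ c, B.δ γ (L.det * V γ c) * B.superpot L V k i c
        + L.det * ∑ c, V γ c * B.δ γ (B.superpot L V k i c)
        - L.det * ∑ b, ∑ c, (L.map (B.δ γ) * V) i b * V γ c * B.superpot L V k b c := by
    intro γ
    have h1 := congrArg (B.δ γ) (hmom γ)
    simp only [map_sum, Derivation.leibniz (B.δ γ) (L i _), Derivation.leibniz (B.δ γ) (L.det * _),
      smul_eq_mul, Finset.sum_add_distrib] at h1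
    have h2 : ∑ β, B.momentum L V k β γ * B.δ γ (L i β)
        = L.det * ∑ b, ∑ c, (L.map (B.δ γ) * V) i b * V γ c * B.superpot L V k b c := by
      have h3 : ∀ b c, (L.map (B.δ γ) * V) i b * V γ c * B.superpot L V k b c
          = ∑ β, B.δ γ (L i β) * (V β b * V γ c * B.superpot L V k b c) := by
        intro b c
        rw [Matrix.mul_apply, Finset.sum_mul, Finset.sum_mul]
        exact Finset.sum_congr rfl fun _ _ => by rw [Matrix.map_apply]; ring
      simp only [h3, momentum]
      rw [sum_rotate, Finset.mul_sum]
      refine Finset.sum_congr rfl fun β _ => ?_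
      simp only [← Finset.mul_sum]
      ring
    rw [h2] at h1
    rw [eq_sub_iff_add_eq, h1, add_comm, Finset.mul_sum]
    congr 1
    · exact Finset.sum_congr rfl fun _ _ => by ring
    · exact Finset.sum_congr rfl fun _ _ => by ring
  have hdiv : V.det * ∑ γ, ∑ c, B.δ γ (L.det * V γ c) * B.superpot L V k i c
      = -∑ c, B.bas L V c * B.superpot L V k i c := by
    rw [Finset.sum_comm, Finset.mul_sum, ← Finset.sum_neg_distrib]
    refine Finset.sum_congr rfl fun c _ => ?_
    rw [← Finset.sum_mul, ← mul_assoc, B.divergence_frame hLV hVL, neg_mul]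
  have he : ∑ γ, ∑ c, V γ c * B.δ γ (B.superpot L V k i c)
      = ∑ c, B.e V c (B.superpot L V k i c) := by
    rw [Finset.sum_comm]
    simp only [e_apply]
  have hcan : ∑ γ, ∑ b, ∑ c, (L.map (B.δ γ) * V) i b * V γ c * B.superpot L V k b c
      = ∑ b, ∑ c, B.superpot L V k b c * B.can L V i b c := by
    rw [← sum_rotate fun b c γ => (L.map (B.δ γ) * V) i b * V γ c * B.superpot L V k b c]
    refine Finset.sum_congr rfl fun b _ => Finset.sum_congr rfl fun c _ => ?_
    rw [← Finset.sum_mul, mul_comm]; rfl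
  have hN : ∑ β, L i β * ∑ γ, B.divN γ * B.momentum L V k β γ
      = L.det * ∑ c, (∑ γ, V γ c * B.divN γ) * B.superpot L V k i c := by
    simp only [Finset.mul_sum, Finset.sum_mul]
    rw [Finset.sum_comm, Finset.sum_comm (γ := ι) (α := ι)
      (f := fun c γ => L.det * (V γ c * B.divN γ * B.superpot L V k i c))]
    refine Finset.sum_congr rfl fun γ _ => ?_
    have : ∀ β, L i β * (B.divN γ * B.momentum L V k β γ)
        = B.divN γ * (L i β * B.momentum L V k β γ) := fun _ => by ring
    simp only [this]
    rw [← Finset.mul_sum, hmom, Finset.mul_sum]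
    exact Finset.sum_congr rfl fun _ _ => by ring
  have hD : ∑ β, L i β * ∑ γ, B.δ γ (B.momentum L V k β γ)
      = ∑ γ, ∑ c, B.δ γ (L.det * V γ c) * B.superpot L V k i c
        + L.det * ∑ c, B.e V c (B.superpot L V k i c)
        - L.det * ∑ b, ∑ c, B.superpot L V k b c * B.can L V i b c := by
    have h1 : ∑ β, L i β * ∑ γ, B.δ γ (B.momentum L V k β γ)
        = ∑ γ, ∑ β, L i β * B.δ γ (B.momentum L V k β γ) := by
      simp only [Finset.mul_sum]
      exact Finset.sum_comm
    rw [h1]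
    simp only [hder, Finset.sum_add_distrib, Finset.sum_sub_distrib, ← Finset.mul_sum]
    rw [hcan, he]
  have hE : ∑ β, L i β * B.eulerLagrange L V k β
      = L.det * B.lagDer L V k i - ∑ β, L i β * ∑ γ, B.δ γ (B.momentum L V k β γ)
        + ∑ β, L i β * ∑ γ, B.divN γ * B.momentum L V k β γ := by
    simp only [eulerLagrange_eq, mul_add, mul_sub, Finset.sum_add_distrib,
      Finset.sum_sub_distrib]
    congr 2
    have : ∀ β, L i β * (L.det * ∑ m, V β m * B.lagDer L V k m)
        = L.det * (L i β * ∑ m, V β m * B.lagDer L V k m) := fun _ => by ring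
    simp only [this, ← Finset.mul_sum, hcol]
  rw [hE, hD, hN]
  linear_combination (B.lagDer L V k i - ∑ c, B.e V c (B.superpot L V k i c)
        + ∑ b, ∑ c, B.superpot L V k b c * B.can L V i b c
        + ∑ c, (∑ γ, V γ c * B.divN γ) * B.superpot L V k i c) * hdet - hdiv

end DiffRing

end EAP

end

noncomputable section

namespace EAP

namespace DiffRing

/-! ### The field equations in the frame -/

section

variable {K : Type*} [CommRing K] {ι : Type*} [Fintype ι]

/-- Frame components of `σ_{μν}`. -/
def frSigma (γ : ι → ι → ι → K) (i k : ι) : K := ∑ a, ∑ b, γ b a i * γ a b k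

/-- Frame components of `ϖ_{μν}`. -/
def frVarpi (γ : ι → ι → ι → K) (i k : ι) : K :=
  ∑ a, ∑ b, (γ b a i * γ a k b + γ b i a * γ a b k)

/-- The contraction `γ_{bia} γ_{akb}`. -/
def frCross (γ : ι → ι → ι → K) (i k : ι) : K := ∑ a, ∑ b, γ b i a * γ a k b

lemma frSigma_symm (γ : ι → ι → ι → K) (i k : ι) : frSigma γ i k = frSigma γ k i := by
  rw [frSigma, Finset.sum_comm]
  exact Finset.sum_congr rfl fun _ _ => Finset.sum_congr rfl fun _ _ => mul_comm _ _

lemma frCross_symm (γ : ι → ι → ι → K) (i k : ι) : frCross γ i k = frCross γ k i := by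
  rw [frCross, Finset.sum_comm]
  exact Finset.sum_congr rfl fun _ _ => Finset.sum_congr rfl fun _ _ => mul_comm _ _

lemma frVarpi_symm (γ : ι → ι → ι → K) (i k : ι) : frVarpi γ i k = frVarpi γ k i := by
  rw [frVarpi, Finset.sum_comm]
  exact Finset.sum_congr rfl fun _ _ => Finset.sum_congr rfl fun _ _ => by ring

end

variable {K : Type*} [CommRing K] [Algebra ℝ K] {ι : Type*} [Fintype ι]
variable {B : DiffRing ι K} {L V : Matrix ι ι K} {γ : ι → ι → ι → K}

lemma bas_eq (hs : ∀ i j k, γ i j k = -γ j i k)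
    (ht : ∀ i j k, B.tor L V i j k = γ i j k - γ i k j) (c : ι) : B.bas L V c = ∑ m, γ m c m := by
  have h0 : ∀ m c, γ m m c = 0 := fun m c => eq_zero_of_eq_neg_self (hs m m c)
  simp [bas, ht, h0]

/-- Writing the torsion as a difference of contortions, one half cancels the second product after
the summation indices are renamed. -/
lemma sum_ricci_quadratic (hs : ∀ i j k, γ i j k = -γ j i k)
    (ht : ∀ i j k, B.tor L V i j k = γ i j k - γ i k j) (j k : ι) :
    ∑ m, ∑ s, (B.tor L V s k m * γ m j s + γ m s k * γ s j m - γ m s m * γ s j k)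
      = frCross γ j k - ∑ s, B.bas L V s * γ s j k := by
  simp only [bas_eq hs ht, ht, sub_mul, Finset.sum_add_distrib, Finset.sum_sub_distrib,
    Finset.sum_mul]
  rw [Finset.sum_comm (f := fun m s => γ m s m * γ s j k),
    Finset.sum_comm (f := fun m s => γ m s k * γ s j m)]
  have h1 : ∑ m, ∑ s, γ s k m * γ m j s = frCross γ j k := by
    rw [frCross, Finset.sum_comm]
    exact Finset.sum_congr rfl fun _ _ => Finset.sum_congr rfl fun _ _ => mul_comm _ _
  rw [h1]; ring

lemma sum_tor_tor (ht : ∀ i j k, B.tor L V i j k = γ i j k - γ i k j)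
    (i k : ι) : ∑ a, ∑ b, B.tor L V b a i * B.tor L V a b k
    = frSigma γ i k - frVarpi γ i k + frCross γ i k := by
  simp only [frSigma, frVarpi, frCross, ← Finset.sum_sub_distrib, ← Finset.sum_add_distrib, ht]
  exact Finset.sum_congr rfl fun _ _ => Finset.sum_congr rfl fun _ _ => by ring

lemma lag_eq [DecidableEq ι] (ht : ∀ i j k, B.tor L V i j k = γ i j k - γ i k j) :
    B.lag L V = ∑ c, (frSigma γ c c - frVarpi γ c c + frCross γ c c)
    - ∑ c, B.bas L V c * B.bas L V c := by
  simp only [lag, lagOf, ← sum_tor_tor ht, Finset.sum_sub_distrib]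
  congr 1
  exact Finset.sum_congr rfl fun c _ => Finset.sum_congr rfl fun _ _ =>
    Finset.sum_congr rfl fun _ _ => mul_comm _ _

/-- This is why `Ω` enters the field equations: symmetrising the torsion part of the superpotential
leaves exactly the symmetric part of `γ_c`. -/
lemma tor_symm (hs : ∀ i j k, γ i j k = -γ j i k)
    (ht : ∀ i j k, B.tor L V i j k = γ i j k - γ i k j) (i k c : ι) : B.tor L V i k c - B.tor L V c k i
    + (B.tor L V k i c - B.tor L V c i k) = γ c i k + γ c k i := by
  simp only [ht]
  rw [hs k c i, hs i c k, hs k i c]; ring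

variable (B L V) [DecidableEq ι]

/-- The superpotential is skew in `b`, `c`, so the canonical coefficients may be replaced by half
the torsion. -/
lemma sum_superpot_can (i k : ι) : ∑ b, ∑ c, B.superpot L V k b c * B.can L V i b c
    = 2 * ∑ b, ∑ c, B.tor L V b k c * B.tor L V i b c
      + 2 * ∑ c, B.bas L V c * B.tor L V i k c := by
  set s : ι → ι → K := fun b c => B.tor L V b k c - B.tor L V c k b
    - (if k = c then B.bas L V b else 0) + (if k = b then B.bas L V c else 0) with hsdef
  have h1 : ∑ b, ∑ c, B.superpot L V k b c * B.can L V i b c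
      = ∑ b, ∑ c, s b c * B.tor L V i b c := by
    have h2 : ∑ b, ∑ c, s b c * B.can L V i c b = -∑ b, ∑ c, s b c * B.can L V i b c := by
      rw [Finset.sum_comm]
      simp only [← Finset.sum_neg_distrib]
      exact Finset.sum_congr rfl fun b _ => Finset.sum_congr rfl fun c _ => by
        simp only [hsdef]; ring
    simp only [tor, mul_sub, Finset.sum_sub_distrib, h2, superpot, superpotOf]
    rw [sub_neg_eq_add, ← two_mul]
    simp only [Finset.mul_sum]
    exact Finset.sum_congr rfl fun b _ => Finset.sum_congr rfl fun c _ => by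
        simp only [hsdef, tor]; ring
  have h3 : ∑ b, ∑ c, B.tor L V c k b * B.tor L V i b c
      = -∑ b, ∑ c, B.tor L V b k c * B.tor L V i b c := by
    rw [Finset.sum_comm]
    simp only [← Finset.sum_neg_distrib]
    exact Finset.sum_congr rfl fun b _ => Finset.sum_congr rfl fun c _ => by
      rw [B.tor_swap L V i b c]; ring
  have h4 : ∑ c, B.bas L V c * B.tor L V i c k = -∑ c, B.bas L V c * B.tor L V i k c := by
    simp only [← Finset.sum_neg_distrib]
    exact Finset.sum_congr rfl fun c _ => by rw [B.tor_swap L V i k c]; ring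
  rw [h1]
  simp only [hsdef, add_mul, sub_mul, Finset.sum_add_distrib, Finset.sum_sub_distrib, ite_mul,
    zero_mul, Finset.sum_ite_eq, Finset.mem_univ, if_true, h3, h4, Finset.sum_ite_irrel,
    Finset.sum_const_zero]
  ring

lemma sum_mul_superpot (v : ι → K) (i k : ι) : ∑ c, v c * B.superpot L V k i c
    = 2 * ∑ c, v c * (B.tor L V i k c - B.tor L V c k i) - 2 * (v k * B.bas L V i)
      + (if k = i then 2 * ∑ c, v c * B.bas L V c else 0) := by
  simp only [superpot, superpotOf, mul_add, mul_sub, mul_ite, mul_zero, Finset.sum_add_distrib,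
    Finset.sum_sub_distrib, Finset.sum_ite_eq, Finset.mem_univ, if_true, Finset.mul_sum,
    Finset.sum_ite_irrel, Finset.sum_const_zero, mul_left_comm _ (2 : K)]

lemma sum_e_superpot (i k : ι) : ∑ c, B.e V c (B.superpot L V k i c)
    = 2 * ∑ c, B.e V c (B.tor L V i k c - B.tor L V c k i) - 2 * B.e V k (B.bas L V i)
      + (if k = i then 2 * ∑ c, B.e V c (B.bas L V c) else 0) := by
  have h2 : ∀ (D : Derivation ℝ K K) (f : K), D (2 * f) = 2 * D f := fun D f => by
    rw [two_mul, map_add, two_mul]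
  have hite : ∀ (D : Derivation ℝ K K) (P : Prop) [Decidable P] (f : K),
      D (if P then f else 0) = if P then D f else 0 := fun D P _ f => by split <;> simp
  simp only [superpot, superpotOf, h2, map_add, map_sub, hite, mul_add, mul_sub, mul_ite, mul_zero,
    Finset.sum_add_distrib, Finset.sum_sub_distrib, Finset.sum_ite_eq, Finset.mem_univ, if_true,
    Finset.mul_sum, Finset.sum_ite_irrel, Finset.sum_const_zero]

variable {B L V}

/-- The symmetrised field equations in the frame: the Euler-Lagrange expression is, up to the
factor `-2`, the Einstein tensor minus the energy-momentum tensor. -/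
lemma field_equation_frame (hs : ∀ i j k, γ i j k = -γ j i k)
    (ht : ∀ i j k, B.tor L V i j k = γ i j k - γ i k j) {rc q El : ι → ι → K} {w : ι → K}
    (hrc : ∀ j k, rc j k = ∑ m, (B.e V m (γ m j k) - B.e V k (γ m j m))
        + ∑ m, ∑ s, (B.tor L V s k m * γ m j s + γ m s k * γ s j m - γ m s m * γ s j k)
        + q j k)
    (hEl : ∀ i k, El i k = B.lagDer L V k i - ∑ c, B.e V c (B.superpot L V k i c)
        + ∑ b, ∑ c, B.superpot L V k b c * B.can L V i b c
        + ∑ c, B.bas L V c * B.superpot L V k i c + ∑ c, w c * B.superpot L V k i c) (i k : ι) :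
    El i k + El k i + 2 * (rc i k + rc k i) - (if i = k then 2 * ∑ j, rc j j else 0)
      = 2 * ((if i = k then ∑ j, frSigma γ j j - ∑ j, frVarpi γ j j - ∑ j, q j j
            + 2 * ∑ j, B.bas L V j * w j else 0)
          - 2 * (frSigma γ i k - frVarpi γ i k) + (q i k + q k i)
          + ∑ c, w c * (γ c i k + γ c k i) - (B.bas L V i * w k + B.bas L V k * w i)) := by
  have hrc' : ∀ j k, rc j k = ∑ m, B.e V m (γ m j k) - B.e V k (B.bas L V j)
      + (frCross γ j k - ∑ s, B.bas L V s * γ s j k) + q j k := by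
    intro j k
    rw [hrc, sum_ricci_quadratic hs ht, Finset.sum_sub_distrib, bas_eq hs ht j, map_sum]
  have hv : ∀ v : ι → K, ∑ c, v c * (B.tor L V i k c - B.tor L V c k i)
      + ∑ c, v c * (B.tor L V k i c - B.tor L V c i k) = ∑ c, v c * (γ c i k + γ c k i) := by
    intro v
    simp only [← Finset.sum_add_distrib, ← mul_add, tor_symm hs ht]
  have he : ∑ c, B.e V c (B.tor L V i k c - B.tor L V c k i)
      + ∑ c, B.e V c (B.tor L V k i c - B.tor L V c i k)
      = ∑ c, B.e V c (γ c i k) + ∑ c, B.e V c (γ c k i) := by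
    simp only [← Finset.sum_add_distrib, ← map_add, tor_symm hs ht]
  have h1 : ∀ i k, ∑ a, ∑ c, B.tor L V i a c * B.tor L V a k c
      = ∑ b, ∑ c, B.tor L V b k c * B.tor L V i b c := fun i k =>
    Finset.sum_congr rfl fun _ _ => Finset.sum_congr rfl fun _ _ => mul_comm _ _
  have h2 : ∀ i k, ∑ c, B.bas L V c * B.tor L V i c k
      = -∑ c, B.bas L V c * B.tor L V i k c := fun i k => by
    simp only [← Finset.sum_neg_distrib]
    exact Finset.sum_congr rfl fun c _ => by rw [B.tor_swap L V i k c]; ring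
  -- Collects the expression into a diagonal part and terms to be symmetrised. The `torsion ·
  -- torsion` sum from `sum_superpot_can` cancels the matching one in `lagDerOf`.
  have hEl' : ∀ i k, El i k = (if k = i then B.lag L V + 2 * ∑ c, B.bas L V c * B.bas L V c
          - 2 * ∑ c, B.e V c (B.bas L V c) + 2 * ∑ c, w c * B.bas L V c else 0)
      - 2 * (frSigma γ i k - frVarpi γ i k + frCross γ i k)
      - 2 * ∑ c, B.e V c (B.tor L V i k c - B.tor L V c k i) + 2 * B.e V k (B.bas L V i)
      + 2 * ∑ c, B.bas L V c * (B.tor L V i k c - B.tor L V c k i)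
      + 2 * ∑ c, w c * (B.tor L V i k c - B.tor L V c k i) - 2 * (w k * B.bas L V i) := by
    intro i k
    rw [hEl, sum_superpot_can, sum_mul_superpot, sum_mul_superpot, sum_e_superpot, lagDer, lagDerOf,
      ← lag, sum_tor_tor ht, h1, h2]
    by_cases h : k = i
    · subst h; simp only [if_true]; ring
    · simp only [if_neg h, if_neg (Ne.symm h)]; ring
  have hsum : ∀ v : ι → K, ∑ c, v c * (γ c i k + γ c k i)
      = ∑ c, v c * γ c i k + ∑ c, v c * γ c k i := fun v => by
    simp only [mul_add, Finset.sum_add_distrib]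
  have hvb := hv (B.bas L V)
  have hvw := hv w
  rw [hsum] at hvb
  rw [hEl' i k, hEl' k i, hrc' i k, hrc' k i, frSigma_symm γ k i, frVarpi_symm γ k i,
    frCross_symm γ k i]
  by_cases h : i = k
  · subst h
    -- Only the diagonal sees the scalar curvature. By skewness the trace `γ_{mjj}` is minus the
    -- basic vector, which reduces the scalar to quantities already present in the Lagrangian.
    have htr : ∑ j, rc j j = -2 * ∑ c, B.e V c (B.bas L V c) + ∑ j, frCross γ j j
        + ∑ c, B.bas L V c * B.bas L V c + ∑ j, q j j := by
      have t1 : ∑ j, ∑ m, B.e V m (γ m j j) = -∑ c, B.e V c (B.bas L V c) := by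
        rw [Finset.sum_comm, ← Finset.sum_neg_distrib]
        refine Finset.sum_congr rfl fun m _ => ?_
        rw [bas_eq hs ht, map_sum, ← Finset.sum_neg_distrib]
        exact Finset.sum_congr rfl fun j _ => by rw [hs m j j, map_neg]
      have t2 : ∑ j, ∑ s, B.bas L V s * γ s j j = -∑ c, B.bas L V c * B.bas L V c := by
        rw [Finset.sum_comm, ← Finset.sum_neg_distrib]
        refine Finset.sum_congr rfl fun m _ => ?_
        rw [← Finset.mul_sum, ← mul_neg]
        congr 1
        rw [bas_eq hs ht, ← Finset.sum_neg_distrib]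
        exact Finset.sum_congr rfl fun j _ => hs m j j
      simp only [hrc', Finset.sum_add_distrib, Finset.sum_sub_distrib, t1, t2]
      ring
    have hwb : ∑ c, w c * B.bas L V c = ∑ j, B.bas L V j * w j :=
      Finset.sum_congr rfl fun _ _ => mul_comm _ _
    simp only [if_true, htr, lag_eq ht, hwb, Finset.sum_add_distrib, Finset.sum_sub_distrib]
    linear_combination -2 * he + 2 * hvb + 2 * hvw
  · simp only [if_neg h, if_neg (Ne.symm h)]
    linear_combination -2 * he + 2 * hvb + 2 * hvw

end DiffRing

end EAP

end

noncomputable section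

namespace EAP

/-! ## Derivatives of the Lagrangian -/

section Lagrangian

open LocalCoeff

variable {n : ℕ}

/-- The torsion in the frame `up`, from the derivatives `D i μ ν = δ_ν λ_{iμ}` of the coframe. -/
def torOf {R ι : Type*} [CommRing R] [Fintype ι] (up : Matrix ι ι R) (D : ι → ι → ι → R)
    (i j c : ι) : R := ∑ μ, ∑ ν, (D i μ ν - D i ν μ) * (up μ j * up ν c)

/-- The basic vector of a torsion in a frame. -/
def basOf {R ι : Type*} [CommRing R] [Fintype ι] (T : ι → ι → ι → R) (c : ι) : R := ∑ m, T m c m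

/-- The derivative `δ_ν λ_{iμ}` of the coframe, as a function of its partial derivatives. -/
def hDerOf (Nv : Fin n → Fin n → ℝ) (lx ly : Fin n → Fin n → Fin n → ℝ) (i μ ν : Fin n) : ℝ :=
  lx i μ ν - ∑ a, Nv a ν * ly i μ a

/-- The scalar is invariant under change of basis, and in the frame `g^{μν}` becomes the identity.
In this form it depends on the coframe only through `det`, `l⁻¹` and the combination `hDerOf`. -/
lemma lagrangian_eq (Nv : Fin n → Fin n → ℝ) (l : Matrix (Fin n) (Fin n) ℝ)
    (lx ly : Fin n → Fin n → Fin n → ℝ) : lagrangian Nv l lx ly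
      = l.det * lagOf (torOf l⁻¹ (hDerOf Nv lx ly)) (basOf (torOf l⁻¹ (hDerOf Nv lx ly))) := by
  set up := l⁻¹ with hup
  set D := hDerOf Nv lx ly with hD
  set Λ : Fin n → Fin n → Fin n → ℝ := fun α μ ν =>
    ∑ i, up α i * D i μ ν - ∑ i, up α i * D i ν μ with hΛ
  have h0 : lagrangian Nv l lx ly = l.det * ∑ μ, ∑ ν, (∑ i, up μ i * up ν i) *
      ((∑ α, ∑ ε, Λ α ε μ * Λ ε α ν) - (∑ α, Λ α μ α) * ∑ α, Λ α ν α) := rfl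
  replace hΛ : ∀ α μ ν, Λ α μ ν = ∑ i, up α i * (D i μ ν - D i ν μ) := fun α μ ν => by
    simp only [hΛ, mul_sub, Finset.sum_sub_distrib]
  set M : Fin n → Matrix (Fin n) (Fin n) ℝ := fun c i ε => ∑ μ, up μ c * (D i ε μ - D i μ ε)
    with hM
  replace hM : ∀ c i ε, M c i ε = ∑ μ, up μ c * (D i ε μ - D i μ ε) := fun _ _ _ => rfl
  have hT : ∀ i j c, torOf up D i j c = (M c * up) i j := by
    intro i j c
    simp only [torOf, Matrix.mul_apply, hM, Finset.sum_mul]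
    exact Finset.sum_congr rfl fun _ _ => Finset.sum_congr rfl fun _ _ => by ring
  have hA : ∀ α ε c, ∑ μ, up μ c * Λ α ε μ = (up * M c) α ε := by
    intro α ε c
    simp only [Matrix.mul_apply, hΛ, hM, Finset.mul_sum]
    rw [Finset.sum_comm]
    exact Finset.sum_congr rfl fun _ _ => Finset.sum_congr rfl fun _ _ => by ring
  have hg : ∀ F : Fin n → Fin n → ℝ, ∑ μ, ∑ ν, (∑ i, up μ i * up ν i) * F μ ν
      = ∑ c, ∑ μ, ∑ ν, (up μ c * up ν c) * F μ ν := by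
    intro F
    simp only [Finset.sum_mul]
    rw [sum_rotate]
  have hB : ∀ c, ∑ μ, up μ c * ∑ α, Λ α μ α = basOf (torOf up D) c := by
    intro c
    simp only [basOf, torOf, hΛ, Finset.mul_sum]
    rw [← sum_rotate fun μ α i => (D i μ α - D i α μ) * (up μ c * up α i)]
    exact Finset.sum_congr rfl fun _ _ => Finset.sum_congr rfl fun _ _ =>
      Finset.sum_congr rfl fun _ _ => by ring
  rw [h0, hg, lagOf]
  congr 1
  refine Finset.sum_congr rfl fun c _ => ?_
  simp only [mul_sub, Finset.sum_sub_distrib]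
  congr 1
  -- Both sides are traces of squares, of `up * M c` and of `M c * up`, hence equal by cyclicity.
  · have h1 : ∑ μ, ∑ ν, up μ c * up ν c * ∑ α, ∑ ε, Λ α ε μ * Λ ε α ν
        = ∑ α, ∑ ε, (up * M c) α ε * (up * M c) ε α := by
      simp only [← hA, Finset.sum_mul_sum]
      simp only [Finset.mul_sum]
      rw [sum_rotate]
      refine Finset.sum_congr rfl fun α _ => ?_
      rw [sum_rotate]
      exact Finset.sum_congr rfl fun _ _ => Finset.sum_congr rfl fun _ _ =>
        Finset.sum_congr rfl fun _ _ => by ring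
    have h2 : ∑ α, ∑ ε, (up * M c) α ε * (up * M c) ε α
        = ((up * M c) * (up * M c)).trace := by
      simp only [Matrix.trace, Matrix.diag_apply, Matrix.mul_apply (M := up * M c)]
    have h3 : ∑ i, ∑ j, torOf up D i j c * torOf up D j i c
        = ((M c * up) * (M c * up)).trace := by
      simp only [Matrix.trace, Matrix.diag_apply, Matrix.mul_apply (M := M c * up), hT]
    rw [h1, h2, h3, mul_assoc, Matrix.trace_mul_comm]
    congr 1
    noncomm_ring
  · rw [← hB, Finset.sum_mul_sum]
    exact Finset.sum_congr rfl fun _ _ => Finset.sum_congr rfl fun _ _ => by ring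

/-- The derivative of `lagOf` along a variation `T'` of the torsion. -/
def lagVar (T T' : Fin n → Fin n → Fin n → ℝ) : ℝ :=
  ∑ c, (2 * (∑ i, ∑ j, T j i c * T' i j c) - 2 * (basOf T c * basOf T' c))

lemma hasDerivAt_lagOf {T : ℝ → Fin n → Fin n → Fin n → ℝ} {T' : Fin n → Fin n → Fin n → ℝ}
    (h : ∀ i j c, HasDerivAt (fun t => T t i j c) (T' i j c) 0) :
    HasDerivAt (fun t => lagOf (T t) (basOf (T t))) (lagVar (T 0) T') 0 := by
  have hb : ∀ c, HasDerivAt (fun t => basOf (T t) c) (basOf T' c) 0 := fun c =>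
    HasDerivAt.fun_sum fun m _ => h m c m
  have h1 : HasDerivAt (fun t => lagOf (T t) (basOf (T t)))
      (∑ c, ((∑ i, ∑ j, (T' i j c * T 0 j i c + T 0 i j c * T' j i c))
        - (basOf T' c * basOf (T 0) c + basOf (T 0) c * basOf T' c))) 0 :=
    HasDerivAt.fun_sum fun c _ => (HasDerivAt.fun_sum fun i _ => HasDerivAt.fun_sum fun j _ =>
      (h i j c).mul (h j i c)).sub ((hb c).mul (hb c))
  convert h1 using 1
  refine Finset.sum_congr rfl fun c _ => ?_
  simp only [Finset.sum_add_distrib]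
  rw [Finset.sum_comm (f := fun i j => T 0 i j c * T' j i c)]
  simp only [mul_comm (T' _ _ _)]
  ring

lemma torOf_add_smul (up : Matrix (Fin n) (Fin n) ℝ) (D D' : Fin n → Fin n → Fin n → ℝ) (t : ℝ)
    (i j c : Fin n) :
    torOf up (fun i μ ν => D i μ ν + t * D' i μ ν) i j c
      = torOf up D i j c + t * torOf up D' i j c := by
  simp only [torOf, Finset.mul_sum, ← Finset.sum_add_distrib]
  exact Finset.sum_congr rfl fun _ _ => Finset.sum_congr rfl fun _ _ => by ring

/-- Serves both kinds of derivative variables: varying either one moves `hDerOf`, and with it the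
torsion, along a line. -/
lemma hasDerivAt_lagrangian_of_affine {Nv : Fin n → Fin n → ℝ} {l : Matrix (Fin n) (Fin n) ℝ}
    {lx ly : ℝ → Fin n → Fin n → Fin n → ℝ} {D D' : Fin n → Fin n → Fin n → ℝ}
    (h : ∀ t, hDerOf Nv (lx t) (ly t) = fun i μ ν => D i μ ν + t * D' i μ ν) :
    HasDerivAt (fun t => lagrangian Nv l (lx t) (ly t))
      (l.det * lagVar (torOf l⁻¹ D) (torOf l⁻¹ D')) 0 := by
  have h1 := hasDerivAt_lagOf (T := fun t => torOf l⁻¹ fun i μ ν => D i μ ν + t * D' i μ ν)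
    (T' := torOf l⁻¹ D') fun i j c => by
      simp only [torOf_add_smul]
      simpa using ((hasDerivAt_id (0 : ℝ)).mul_const (torOf l⁻¹ D' i j c)).const_add
        (torOf l⁻¹ D i j c)
  simp only [zero_mul, add_zero] at h1
  simp only [lagrangian_eq, h]
  exact h1.const_mul _

/-- The variation of the torsion along a variation of `δ_γ λ_{jβ}` alone. -/
lemma lagVar_single (up : Matrix (Fin n) (Fin n) ℝ) (T : Fin n → Fin n → Fin n → ℝ)
    (j β γ : Fin n) :
    lagVar T (torOf up (Pi.single j (Pi.single β (Pi.single γ 1))))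
      = ∑ b, ∑ c, up β b * up γ c * superpotOf T (basOf T) j b c := by
  have hT' : ∀ i m c, torOf up (Pi.single j (Pi.single β (Pi.single γ 1))) i m c
      = if i = j then up β m * up γ c - up β c * up γ m else 0 := by
    intro i m c
    by_cases h : i = j
    · subst h
      have hs : ∀ μ ν, (Pi.single β (Pi.single γ 1) : Fin n → Fin n → ℝ) μ ν
          = if μ = β then if ν = γ then 1 else 0 else 0 := by
        intro μ ν
        by_cases h : μ = β <;> simp [h, Pi.single_apply]
      simp only [torOf, Pi.single_eq_same, sub_mul, Finset.sum_sub_distrib, if_true, hs, ite_mul,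
        one_mul, zero_mul, Finset.sum_ite_eq', Finset.mem_univ, Finset.sum_ite_irrel,
        Finset.sum_const_zero]
      ring
    · simp [torOf, h]
  have hb : ∀ c, basOf (torOf up (Pi.single j (Pi.single β (Pi.single γ 1)))) c
      = up β c * up γ j - up β j * up γ c := by
    intro c
    simp [basOf, hT']
  have h1 : ∀ c, ∑ i, ∑ m, T m i c * torOf up (Pi.single j (Pi.single β (Pi.single γ 1))) i m c
      = ∑ m, T m j c * (up β m * up γ c - up β c * up γ m) := by
    intro c
    rw [Finset.sum_comm]
    simp [hT']
  have h2 : ∑ c, ∑ m, T m j c * (up β c * up γ m) = ∑ b, ∑ c, up β b * up γ c * T c j b :=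
    Finset.sum_congr rfl fun _ _ => Finset.sum_congr rfl fun _ _ => by ring
  have h3 : ∑ c, ∑ m, T m j c * (up β m * up γ c) = ∑ b, ∑ c, up β b * up γ c * T b j c := by
    rw [Finset.sum_comm]
    exact Finset.sum_congr rfl fun _ _ => Finset.sum_congr rfl fun _ _ => by ring
  simp only [lagVar, h1, hb, superpotOf, mul_sub, mul_add, Finset.sum_sub_distrib,
    Finset.sum_add_distrib, ← Finset.mul_sum, h2, h3, mul_left_comm _ (2 : ℝ), mul_ite, mul_zero,
    Finset.sum_ite_eq, Finset.mem_univ, if_true, Finset.sum_ite_irrel, Finset.sum_const_zero]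
  have h4 : ∑ b, up β b * up γ j * basOf T b = ∑ c, basOf T c * (up β c * up γ j) :=
    Finset.sum_congr rfl fun _ _ => by ring
  have h5 : ∑ c, up β j * up γ c * basOf T c = ∑ c, basOf T c * (up β j * up γ c) :=
    Finset.sum_congr rfl fun _ _ => by ring
  rw [h4, h5]
  ring

/-- The Sherman–Morrison formula for a rank-one perturbation `E`: it closes up because `E l⁻¹ E` is
a multiple of `E`. -/
lemma inv_add_smul_single {l : Matrix (Fin n) (Fin n) ℝ} (hl : IsUnit l.det) (k β : Fin n) {t : ℝ}
    (ht : 1 + t * l⁻¹ β k ≠ 0) (μ j : Fin n) :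
    (l + t • (Matrix.single k β 1 : Matrix (Fin n) (Fin n) ℝ))⁻¹ μ j
      = l⁻¹ μ j - t / (1 + t * l⁻¹ β k) * (l⁻¹ μ k * l⁻¹ β j) := by
  set u := l⁻¹ β k with hu
  set E : Matrix (Fin n) (Fin n) ℝ := Matrix.single k β 1 with hE
  have h1 : E * l⁻¹ * E = u • E := by
    rw [hE, Matrix.single_mul_mul_single, one_mul, mul_one, Matrix.smul_single, smul_eq_mul,
      mul_one]
  have hll : l * l⁻¹ = 1 := Matrix.mul_nonsing_inv l hl
  have h2 : (l + t • E) * (l⁻¹ - (t / (1 + t * u)) • (l⁻¹ * E * l⁻¹)) = 1 := by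
    have h3 : (l + t • E) * (l⁻¹ - (t / (1 + t * u)) • (l⁻¹ * E * l⁻¹))
        = l * l⁻¹ + t • (E * l⁻¹) - (t / (1 + t * u)) • (l * l⁻¹ * E * l⁻¹)
          - (t * (t / (1 + t * u))) • (E * l⁻¹ * E * l⁻¹) := by
      simp only [add_mul, mul_sub, Matrix.mul_smul, Matrix.smul_mul, smul_smul, mul_assoc]
      module
    rw [h3, hll, h1, one_mul, Matrix.smul_mul, smul_smul, add_sub_assoc, add_sub_assoc,
      ← sub_smul, ← sub_smul]
    have h4 : t - t / (1 + t * u) - t * (t / (1 + t * u)) * u = 0 := by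
      field_simp; ring
    rw [h4, zero_smul, add_zero]
  rw [Matrix.inv_eq_right_inv h2]
  simp [hE, Matrix.mul_apply, Matrix.single_apply, ite_and]

lemma det_add_smul_single {l : Matrix (Fin n) (Fin n) ℝ} (hl : IsUnit l.det) (k β : Fin n)
    (t : ℝ) : (l + t • Matrix.single k β 1).det = l.det * (1 + t * l⁻¹ β k) := by
  have h1 : l + t • Matrix.single k β 1 = l.updateRow k (l k + t • Pi.single β 1) := by
    ext i j
    by_cases h : i = k
    · subst h; simp [Matrix.single_apply, Pi.single_apply, eq_comm]
    · simp [h, Ne.symm h]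
  have h2 : l.adjugate = l.det • l⁻¹ := by
    rw [Matrix.inv_def, smul_smul, Ring.mul_inverse_cancel _ hl, one_smul]
  rw [h1, Matrix.det_updateRow_add, Matrix.updateRow_eq_self, Matrix.det_updateRow_smul,
    ← Matrix.adjugate_apply, h2, Matrix.smul_apply, smul_eq_mul]
  ring

/-- Only `det l` and the two factors `l⁻¹` in the torsion vary: the determinant yields the diagonal
term of `lagDerOf`, and the two inverse factors yield its four other terms. -/
lemma hasDerivAt_lagrangian_coframe (Nv : Fin n → Fin n → ℝ) {l : Matrix (Fin n) (Fin n) ℝ}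
    (hl : IsUnit l.det) (lx ly : Fin n → Fin n → Fin n → ℝ) (k β : Fin n) :
    HasDerivAt (fun t : ℝ => lagrangian Nv (l + t • Matrix.single k β 1) lx ly)
      (l.det * ∑ m, l⁻¹ β m * lagDerOf (torOf l⁻¹ (hDerOf Nv lx ly))
        (basOf (torOf l⁻¹ (hDerOf Nv lx ly))) k m) 0 := by
  set D := hDerOf Nv lx ly with hD
  set up := l⁻¹ with hup
  set T := torOf up D with hT
  set Tt : ℝ → Fin n → Fin n → Fin n → ℝ := fun t => torOf (l + t • Matrix.single k β 1)⁻¹ D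
    with hTt
  -- The closed form of the inverse is valid only off the zero of this factor, which suffices for a
  -- derivative at `0`.
  have hnear : ∀ᶠ t : ℝ in 𝓝 0, 1 + t * up β k ≠ 0 := by
    have hc : ContinuousAt (fun t : ℝ => 1 + t * up β k) 0 := by fun_prop
    exact hc.eventually_ne (by simp)
  have hinv : ∀ μ j, HasDerivAt (fun t : ℝ => (l + t • (Matrix.single k β 1 : Matrix (Fin n) (Fin n) ℝ))⁻¹ μ j)
      (-(up μ k * up β j)) 0 := by
    intro μ j
    have h1 : HasDerivAt (fun t : ℝ => up μ j - t / (1 + t * up β k) * (up μ k * up β j))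
        (-(up μ k * up β j)) 0 := by
      have h2 : HasDerivAt (fun t : ℝ => 1 + t * up β k) (up β k) 0 := by
        simpa using ((hasDerivAt_id (0 : ℝ)).mul_const (up β k)).const_add 1
      have h3 := (((hasDerivAt_id (0 : ℝ)).div h2 (by simp)).mul_const
        (up μ k * up β j)).const_sub (up μ j)
      simpa using h3
    refine h1.congr_of_eventuallyEq ?_
    filter_upwards [hnear] with t ht
    exact inv_add_smul_single hl k β ht μ j
  have hT0 : Tt 0 = T := by simp [hTt, hT, hup]
  have hTder : ∀ i j c, HasDerivAt (fun t => Tt t i j c)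
      (-(up β j * T i k c) - up β c * T i j k) 0 := by
    intro i j c
    have h1 : HasDerivAt (fun t => Tt t i j c) (∑ μ, ∑ ν, (D i μ ν - D i ν μ) *
        (-(up μ k * up β j) * up ν c + up μ j * -(up ν k * up β c))) 0 := by
      have h2 := HasDerivAt.fun_sum (u := Finset.univ) fun μ _ =>
        HasDerivAt.fun_sum (u := Finset.univ) fun ν _ =>
          ((hinv μ j).mul (hinv ν c)).const_mul (D i μ ν - D i ν μ)
      exact HasDerivAt.congr_deriv h2 (by simp [hup])
    convert h1 using 1
    simp only [hT, torOf, Finset.mul_sum, ← Finset.sum_neg_distrib, ← Finset.sum_sub_distrib]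
    exact Finset.sum_congr rfl fun _ _ => Finset.sum_congr rfl fun _ _ => by ring
  have hdet : HasDerivAt (fun t : ℝ => (l + t • Matrix.single k β 1).det)
      (l.det * up β k) 0 := by
    simp only [det_add_smul_single hl]
    simpa using (((hasDerivAt_id (0 : ℝ)).mul_const (up β k)).const_add 1).const_mul l.det
  have hmain := hdet.mul (hasDerivAt_lagOf hTder)
  simp only [lagrangian_eq]
  refine HasDerivAt.congr_deriv hmain ?_
  rw [hT0]
  simp only [zero_smul, add_zero]
  have hC : ∀ c, basOf (fun i j c => -(up β j * T i k c) - up β c * T i j k) c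
      = -(up β c * basOf T k) - ∑ m, up β m * T m c k := by
    intro c
    simp only [basOf, Finset.sum_sub_distrib, Finset.sum_neg_distrib, ← Finset.mul_sum]
  have h1 : ∑ c, ∑ i, ∑ j, T j i c * (up β j * T i k c)
      = ∑ m, up β m * ∑ i, ∑ c, T m i c * T i k c := by
    simp only [Finset.mul_sum]
    rw [← sum_rotate fun i j c => T j i c * (up β j * T i k c), Finset.sum_comm]
    exact Finset.sum_congr rfl fun _ _ => Finset.sum_congr rfl fun _ _ =>
      Finset.sum_congr rfl fun _ _ => by ring
  have h2 : ∑ c, ∑ i, ∑ j, T j i c * (up β c * T i j k)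
      = ∑ m, up β m * ∑ i, ∑ j, T j i m * T i j k := by
    simp only [Finset.mul_sum]
    exact Finset.sum_congr rfl fun _ _ => Finset.sum_congr rfl fun _ _ =>
      Finset.sum_congr rfl fun _ _ => by ring
  have h3 : ∑ c, basOf T c * (up β c * basOf T k) = ∑ m, up β m * (basOf T m * basOf T k) :=
    Finset.sum_congr rfl fun _ _ => by ring
  have h4 : ∑ c, basOf T c * ∑ m, up β m * T m c k
      = ∑ m, up β m * ∑ c, basOf T c * T m c k := by
    simp only [Finset.mul_sum]
    rw [Finset.sum_comm]
    exact Finset.sum_congr rfl fun _ _ => Finset.sum_congr rfl fun _ _ => by ring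
  have hvar : lagVar T (fun i j c => -(up β j * T i k c) - up β c * T i j k)
      = -2 * (∑ m, up β m * ∑ i, ∑ c, T m i c * T i k c)
        - 2 * (∑ m, up β m * ∑ i, ∑ j, T j i m * T i j k)
        + 2 * (∑ m, up β m * (basOf T m * basOf T k))
        + 2 * ∑ m, up β m * ∑ c, basOf T c * T m c k := by
    rw [← h1, ← h2, ← h3, ← h4]
    simp only [lagVar, hC, mul_sub, mul_neg, Finset.sum_sub_distrib, Finset.sum_neg_distrib,
      ← Finset.mul_sum]
    ring
  rw [hvar]
  simp only [lagDerOf, mul_add, mul_sub, Finset.sum_add_distrib, Finset.sum_sub_distrib, mul_ite,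
    mul_zero, Finset.sum_ite_eq', Finset.mem_univ, if_true, mul_left_comm _ (2 : ℝ),
    ← Finset.mul_sum]
  ring

end Lagrangian

end EAP

end

/-! ### Evaluation at points, metric compatibility and curvature components -/

noncomputable section

namespace EAP

open TopologicalSpace

namespace smoothFn

variable {V : Type*} [NormedAddCommGroup V] [NormedSpace ℝ V] {U : Opens V}

/-- Evaluation at a point. -/
def eval (q : U) : smoothFn U →+* ℝ := (Pi.evalRingHom (fun _ : U => ℝ) q).comp (smoothFn U).subtype

lemma eval_apply (q : U) (x : smoothFn U) : eval q x = x.1 q := rfl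

lemma Rep.eval_eq {x : smoothFn U} {F : V → ℝ} (h : Rep x F) (q : U) : eval q x = F q := h q

lemma isUnit_of_ne_zero {x : smoothFn U} (h : ∀ q, x.1 q ≠ 0) : IsUnit x := by
  have hne : ∀ q ∈ U, zeroExt U x.1 q ≠ 0 := fun q hq => by
    rw [zeroExt_apply x.1 ⟨q, hq⟩]; exact h _
  refine IsUnit.of_mul_eq_one (mk (fun q => (zeroExt U x.1 q)⁻¹) (ContDiffOn.inv x.2 hne)) ?_
  ext q
  change x.1 q * (zeroExt U x.1 q)⁻¹ = 1
  rw [zeroExt_apply, mul_inv_cancel₀ (h q)]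

end smoothFn

open smoothFn

namespace LocalCoeff

variable {n : ℕ}

/-- The local components are smooth on `U` and the horizontal frame is invertible there. -/
structure IsRegularOn (A : LocalCoeff n) (U : Opens (Phase n)) : Prop where
  contDiffOn_N : ∀ a μ, ContDiffOn ℝ ∞ (A.N a μ) U
  contDiffOn_lamH : ∀ i α, ContDiffOn ℝ ∞ (A.lamH i α) U
  isUnit_det : ∀ q ∈ U, IsUnit (A.frame q).det

namespace IsRegularOn

variable {A : LocalCoeff n} {U : Opens (Phase n)} (h : A.IsRegularOn U)

/-- The matrix `(λ_i^α)` of smooth functions. -/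
def V : Matrix (Fin n) (Fin n) (smoothFn U) :=
  Matrix.of fun α i => smoothFn.mk (A.lamH i α) (h.contDiffOn_lamH i α)

/-- The matrix `(λ_{iα})` of smooth functions. -/
def L : Matrix (Fin n) (Fin n) (smoothFn U) := h.V⁻¹

/-- The smooth functions on `U` with the coordinate derivations and the nonlinear connection. -/
def ring : DiffRing (Fin n) (smoothFn U) where
  dx μ := dir (EuclideanSpace.single μ 1, 0)
  dy a := dir (0, EuclideanSpace.single a 1)
  N a μ := smoothFn.mk (A.N a μ) (h.contDiffOn_N a μ)
  dx_dx _ _ f := dir_comm _ _ f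
  dx_dy _ _ f := dir_comm _ _ f
  dy_dy _ _ f := dir_comm _ _ f

lemma map_V (q : U) : h.V.map (eval q) = A.frame q := rfl

lemma isUnit_det_V : IsUnit h.V.det := by
  refine isUnit_of_ne_zero fun q => ?_
  have h1 := RingHom.map_det (eval q) h.V
  rw [RingHom.mapMatrix_apply, map_V] at h1
  rw [← eval_apply, h1]
  exact (h.isUnit_det q q.2).ne_zero

lemma L_mul_V : h.L * h.V = 1 := Matrix.nonsing_inv_mul _ h.isUnit_det_V

lemma V_mul_L : h.V * h.L = 1 := Matrix.mul_nonsing_inv _ h.isUnit_det_V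

lemma map_L (q : U) : h.L.map (eval q) = A.coframe q := by
  have h1 := congrArg (fun M => M.map (eval q)) h.V_mul_L
  simp only [Matrix.map_mul, map_V] at h1
  rw [Matrix.map_one _ (map_zero _) (map_one _)] at h1
  exact (Matrix.inv_eq_right_inv h1).symm

lemma isUnit_det_coframe (h : A.IsRegularOn U) (q : U) : IsUnit (A.coframe q).det := by
  rw [coframe]
  exact Matrix.isUnit_nonsing_inv_det _ (h.isUnit_det q q.2)

lemma inv_coframe (h : A.IsRegularOn U) (q : U) : (A.coframe q)⁻¹ = A.frame q :=
  Matrix.nonsing_inv_nonsing_inv _ (h.isUnit_det q q.2)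

lemma rep_V (α i : Fin n) : Rep (h.V α i) (A.lamH i α) := fun _ => rfl

lemma rep_L (i β : Fin n) : Rep (h.L i β) (fun q => A.coframe q i β) := fun q =>
  congrFun (congrFun (h.map_L q) i) β

lemma rep_N (a μ : Fin n) : Rep (h.ring.N a μ) (A.N a μ) := fun _ => rfl

variable {x : smoothFn U} {F : Phase n → ℝ}

lemma rep_dx (μ : Fin n) (hx : Rep x F) : Rep (h.ring.dx μ x) (dX μ F) := hx.dir _

lemma rep_dy (a : Fin n) (hx : Rep x F) : Rep (h.ring.dy a x) (dY a F) := hx.dir _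

lemma delta_eq (A : LocalCoeff n) (μ : Fin n) (q : Phase n) : A.delta μ q =
    ((EuclideanSpace.single μ 1, 0) : Phase n)
      - ∑ a, A.N a μ q • ((0, EuclideanSpace.single a 1) : Phase n) := by
  refine Prod.ext ?_ ?_
  · simp [delta, Prod.fst_sum]
  · ext a
    simp [delta, Prod.snd_sum, Pi.single_apply]

lemma dH_eq (A : LocalCoeff n) (μ : Fin n) (F : Phase n → ℝ) (q : Phase n) :
    A.dH μ F q = dX μ F q - ∑ a, A.N a μ q * dY a F q := by
  simp only [dH, delta_eq, map_sub, map_sum, map_smul, smul_eq_mul, dX, dY]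

lemma rep_δ (μ : Fin n) (hx : Rep x F) : Rep (h.ring.δ μ x) (A.dH μ F) := by
  refine Rep.of_eq (F := A.dH μ F) (x := h.ring.dx μ x - ∑ a, h.ring.N a μ * h.ring.dy a x) ?_
    (h.ring.δ_apply μ x)
  intro q
  rw [dH_eq]
  exact ((h.rep_dx μ hx).sub (Rep.sum fun a => (h.rep_N a μ).mul (h.rep_dy a hx))) q

lemma rep_R (a μ ν : Fin n) : Rep (h.ring.R a μ ν) (A.RN a μ ν) :=
  (h.rep_δ ν (h.rep_N a μ)).sub (h.rep_δ μ (h.rep_N a ν))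

/-- The metric as a matrix of smooth functions. -/
def g : Matrix (Fin n) (Fin n) (smoothFn U) := h.L.transpose * h.L

/-- The inverse metric as a matrix of smooth functions. -/
def gInv : Matrix (Fin n) (Fin n) (smoothFn U) := h.V * h.V.transpose

lemma rep_g (α β : Fin n) : Rep (h.g α β) (A.g α β) := by
  rw [g, Matrix.mul_apply]
  exact Rep.sum fun i => (h.rep_L i α).mul (h.rep_L i β)

lemma rep_gInv (α β : Fin n) : Rep (h.gInv α β) (A.gInv α β) := by
  rw [gInv, Matrix.mul_apply]
  exact Rep.sum fun i => (h.rep_V α i).mul (h.rep_V β i)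

lemma g_mul_gInv : h.g * h.gInv = 1 := by
  have h1 : h.g * h.gInv = h.L.transpose * (h.L * h.V) * h.V.transpose := by
    rw [g, gInv]; noncomm_ring
  rw [h1, h.L_mul_V, mul_one, ← Matrix.transpose_mul, h.V_mul_L, Matrix.transpose_one]

lemma gInv_mul_g : h.gInv * h.g = 1 := mul_eq_one_comm.1 h.g_mul_gInv

lemma transpose_g : h.g.transpose = h.g := by simp [g]

lemma transpose_gInv : h.gInv.transpose = h.gInv := by simp [gInv]

/-- The natural metric connection along `δ_ν`. -/
def Γ (ν : Fin n) : Matrix (Fin n) (Fin n) (smoothFn U) := fun α μ =>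
  (1 / 2 : ℝ) • ∑ ε, h.gInv α ε *
    (h.ring.δ μ (h.g ε ν) + h.ring.δ ν (h.g ε μ) - h.ring.δ ε (h.g μ ν))

/-- The natural metric connection along `∂̇_c`. -/
def C (c : Fin n) : Matrix (Fin n) (Fin n) (smoothFn U) := fun α μ =>
  (1 / 2 : ℝ) • ∑ ε, h.gInv α ε * h.ring.dy c (h.g μ ε)

lemma rep_Γ (α μ ν : Fin n) : Rep (h.Γ ν α μ) (A.natural.Γ α μ ν) :=
  (Rep.sum fun ε => (h.rep_gInv α ε).mul (((h.rep_δ μ (h.rep_g ε ν)).add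
    (h.rep_δ ν (h.rep_g ε μ))).sub (h.rep_δ ε (h.rep_g μ ν)))).smul (1 / 2)

lemma rep_C (α μ c : Fin n) : Rep (h.C c α μ) (A.natural.C α μ c) :=
  (Rep.sum fun ε => (h.rep_gInv α ε).mul (h.rep_dy c (h.rep_g μ ε))).smul (1 / 2)

lemma Γ_symm (α μ ν : Fin n) : h.Γ ν α μ = h.Γ μ α ν := by
  have hg : h.g μ ν = h.g ν μ := congrFun (congrFun h.transpose_g ν) μ
  simp only [Γ, hg, add_comm]

lemma g_mul_smul_sum (f : Fin n → Fin n → smoothFn U) (ρ μ : Fin n) :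
    ∑ α, h.g ρ α * ((1 / 2 : ℝ) • ∑ ε, h.gInv α ε * f ε μ) = (1 / 2 : ℝ) • f ρ μ := by
  have h1 : h.g * (h.gInv * Matrix.of f) = Matrix.of f := by
    rw [← mul_assoc, h.g_mul_gInv, one_mul]
  have h2 := congrFun (congrFun h1 ρ) μ
  simp only [Matrix.mul_apply, Matrix.of_apply] at h2
  simp only [mul_smul_comm, ← Finset.smul_sum, h2]

lemma half_add_half (x : smoothFn U) : (1 / 2 : ℝ) • x + (1 / 2 : ℝ) • x = x := by
  rw [← add_smul]; norm_num

/-- The Christoffel formula with its index lowered: adding the transposed expression cancels the two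
terms not differentiated along `δ_ν`. -/
lemma metric_Γ (ν : Fin n) :
    h.g.map (h.ring.δ ν) = h.g * h.Γ ν + (h.Γ ν).transpose * h.g := by
  have hs : ∀ i j, h.g i j = h.g j i := fun i j => congrFun (congrFun h.transpose_g j) i
  ext1 ρ μ
  have h1 : (h.g * h.Γ ν) ρ μ = (1 / 2 : ℝ) •
      (h.ring.δ μ (h.g ρ ν) + h.ring.δ ν (h.g ρ μ) - h.ring.δ ρ (h.g μ ν)) := by
    rw [Matrix.mul_apply]
    exact h.g_mul_smul_sum
      (fun ε μ => h.ring.δ μ (h.g ε ν) + h.ring.δ ν (h.g ε μ) - h.ring.δ ε (h.g μ ν)) ρ μ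
  have h2 : ((h.Γ ν).transpose * h.g) ρ μ = (1 / 2 : ℝ) •
      (h.ring.δ ρ (h.g μ ν) + h.ring.δ ν (h.g μ ρ) - h.ring.δ μ (h.g ρ ν)) := by
    rw [← h.g_mul_smul_sum
      (fun ε μ => h.ring.δ μ (h.g ε ν) + h.ring.δ ν (h.g ε μ) - h.ring.δ ε (h.g μ ν)) μ ρ,
      Matrix.mul_apply]
    exact Finset.sum_congr rfl fun α _ => by rw [mul_comm, hs α μ]; rfl
  rw [Matrix.add_apply, h1, h2, Matrix.map_apply, hs μ ρ, ← smul_add]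
  have h3 : h.ring.δ μ (h.g ρ ν) + h.ring.δ ν (h.g ρ μ) - h.ring.δ ρ (h.g μ ν)
      + (h.ring.δ ρ (h.g μ ν) + h.ring.δ ν (h.g ρ μ) - h.ring.δ μ (h.g ρ ν))
      = h.ring.δ ν (h.g ρ μ) + h.ring.δ ν (h.g ρ μ) := by ring
  rw [h3, smul_add, half_add_half]

lemma metric_C (c : Fin n) :
    h.g.map (h.ring.dy c) = h.g * h.C c + (h.C c).transpose * h.g := by
  have hs : ∀ i j, h.g i j = h.g j i := fun i j => congrFun (congrFun h.transpose_g j) i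
  ext1 ρ μ
  have h1 : ∀ ρ μ, (h.g * h.C c) ρ μ = (1 / 2 : ℝ) • h.ring.dy c (h.g μ ρ) := by
    intro ρ μ
    rw [Matrix.mul_apply]
    exact h.g_mul_smul_sum (fun ε μ => h.ring.dy c (h.g μ ε)) ρ μ
  have h2 : ((h.C c).transpose * h.g) ρ μ = (h.g * h.C c) μ ρ := by
    rw [Matrix.mul_apply, Matrix.mul_apply]
    exact Finset.sum_congr rfl fun α _ => by rw [mul_comm, hs α μ]; rfl
  rw [Matrix.add_apply, h2, h1, h1, hs μ ρ, half_add_half]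
  rfl

end IsRegularOn

/-! ### Curvature components -/

section Curvature

variable (A : LocalCoeff n) (D : HConn n)

lemma vComp_delta (μ a : Fin n) (q : Phase n) : A.vComp (A.delta μ) a q = 0 := by
  simp [vComp, delta]

lemma cov_delta (μ : Fin n) (Z : Fin n → Phase n → ℝ) (α : Fin n) (q : Phase n) :
    A.cov D (A.delta μ) Z α q = A.dH μ (Z α) q + ∑ ε, D.Γ α ε μ q * Z ε q := by
  simp only [cov, vComp_delta, zero_mul, Finset.sum_const_zero, add_zero, dH]
  congr 1
  rw [Finset.sum_eq_single μ]
  · simp [hComp, delta]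
  · intro b _ hb
    simp [hComp, delta, hb]
  · simp

lemma cov_vert (c : Fin n) (Z : Fin n → Phase n → ℝ) (α : Fin n) (q : Phase n) :
    A.cov D (vert c) Z α q = dY c (Z α) q + ∑ ε, D.C α ε c q * Z ε q := by
  have h1 : ∀ ν, hComp (vert c) ν q = (0 : ℝ) := fun ν => by simp [hComp, vert]
  simp only [cov, h1, zero_mul, Finset.sum_const_zero, add_zero, dY]
  congr 1
  rw [Finset.sum_eq_single c]
  · simp [vComp, vert]
  · intro b _ hb
    simp [vComp, vert, hb]
  · simp

lemma sum_deltaComp (f : Fin n → ℝ) (β : Fin n) (q : Phase n) :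
    ∑ ε, f ε * deltaComp β ε q = f β := by simp [deltaComp]

/-- Meant for brackets of adapted basis fields, which are vertical; only the value of `X` at the
point enters, so nothing need be known about `X` nearby. -/
lemma cov_deltaComp {X : Phase n → Phase n} {q : Phase n} (hX : (X q).1 = 0) (β α : Fin n) :
    A.cov D X (deltaComp β) α q = ∑ c, (X q).2 c * D.C α β c q := by
  have h0 : fderiv ℝ (deltaComp β α : Phase n → ℝ) q = 0 := by
    change fderiv ℝ (fun _ => if α = β then (1 : ℝ) else 0) q = 0
    simp
  have h1 : ∀ ν, hComp X ν q = 0 := fun ν => by simp [hComp, hX]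
  have h2 : ∀ c, A.vComp X c q = (X q).2 c := fun c => by simp [vComp, hX]
  simp only [cov, h0, h1, h2, sum_deltaComp]
  simp

lemma fderiv_delta {q : Phase n} (hN : ∀ a μ, DifferentiableAt ℝ (A.N a μ) q) (μ : Fin n)
    (v : Phase n) : fderiv ℝ (A.delta μ) q v
      = (0, WithLp.toLp 2 fun a => -fderiv ℝ (A.N a μ) q v) := by
  have h1 : DifferentiableAt ℝ (fun q => WithLp.toLp 2 fun a => -A.N a μ q) q :=
    (differentiableAt_euclidean).2 fun a => (hN a μ).neg
  have h2 : HasFDerivAt (A.delta μ) (ContinuousLinearMap.prod 0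
      (fderiv ℝ (fun q => WithLp.toLp 2 fun a => -A.N a μ q) q)) q :=
    (hasFDerivAt_const (EuclideanSpace.single μ (1 : ℝ)) q).prodMk h1.hasFDerivAt
  rw [h2.fderiv]
  refine Prod.ext rfl ?_
  ext a
  have h3 := ((hasFDerivWithinAt_euclidean.1
    (hasFDerivWithinAt_univ.2 h1.hasFDerivAt) a).hasFDerivAt Filter.univ_mem).unique
    (hN a μ).hasFDerivAt.neg
  exact congrArg (fun f => f v) h3

lemma lieBracket_delta_delta {q : Phase n} (hN : ∀ a μ, DifferentiableAt ℝ (A.N a μ) q)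
    (μ ν : Fin n) : VectorField.lieBracket ℝ (A.delta μ) (A.delta ν) q
      = (0, WithLp.toLp 2 fun a => A.RN a μ ν q) := by
  rw [VectorField.lieBracket, A.fderiv_delta hN, A.fderiv_delta hN]
  refine Prod.ext (by simp) ?_
  ext a
  simp [RN, dH]
  ring

lemma lieBracket_vert_delta {q : Phase n} (hN : ∀ a μ, DifferentiableAt ℝ (A.N a μ) q)
    (c ν : Fin n) : VectorField.lieBracket ℝ (vert c) (A.delta ν) q
      = (0, WithLp.toLp 2 fun a => -dY c (A.N a ν) q) := by
  have h0 : fderiv ℝ (vert c : Phase n → Phase n) q = 0 := by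
    change fderiv ℝ (fun _ => ((0, EuclideanSpace.single c 1) : Phase n)) q = 0
    simp
  rw [VectorField.lieBracket, A.fderiv_delta hN, h0]
  refine Prod.ext (by simp) ?_
  ext a
  simp [dY, vert]

lemma cov_delta_deltaComp (β ν : Fin n) : A.cov D (A.delta ν) (deltaComp β)
    = fun α q => D.Γ α β ν q := by
  ext α q
  rw [cov_delta, sum_deltaComp]
  have : A.dH ν (deltaComp β α) q = 0 := by
    change fderiv ℝ (fun _ => if α = β then (1 : ℝ) else 0) q _ = 0
    simp
  rw [this, zero_add]

lemma cov_vert_deltaComp (β c : Fin n) : A.cov D (vert c) (deltaComp β)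
    = fun α q => D.C α β c q := by
  ext α q
  rw [cov_vert, sum_deltaComp]
  have : dY c (deltaComp β α) q = 0 := by
    change fderiv ℝ (fun _ => if α = β then (1 : ℝ) else 0) q _ = 0
    simp
  rw [this, zero_add]

lemma curvHH_eq {q : Phase n} (hN : ∀ a μ, DifferentiableAt ℝ (A.N a μ) q) (α β μ ν : Fin n) :
    A.curvHH D α β μ ν q = A.dH μ (D.Γ α β ν) q - A.dH ν (D.Γ α β μ) q
      + ((∑ ε, D.Γ α ε μ q * D.Γ ε β ν q) - ∑ ε, D.Γ α ε ν q * D.Γ ε β μ q)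
      - ∑ a, A.RN a μ ν q * D.C α β a q := by
  have hb := A.lieBracket_delta_delta hN μ ν
  rw [curvHH, curv, cov_delta_deltaComp, cov_delta_deltaComp, cov_delta, cov_delta,
    A.cov_deltaComp D (by rw [hb]), hb]
  ring

lemma curvHV_eq {q : Phase n} (hN : ∀ a μ, DifferentiableAt ℝ (A.N a μ) q) (α β ν c : Fin n) :
    A.curvHV D α β ν c q = dY c (D.Γ α β ν) q - A.dH ν (D.C α β c) q
      + ((∑ ε, D.C α ε c q * D.Γ ε β ν q) - ∑ ε, D.Γ α ε ν q * D.C ε β c q)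
      + ∑ a, dY c (A.N a ν) q * D.C α β a q := by
  have hb := A.lieBracket_vert_delta hN c ν
  rw [curvHV, curv, cov_delta_deltaComp, cov_vert_deltaComp, cov_delta, cov_vert,
    A.cov_deltaComp D (by rw [hb]), hb]
  simp only [neg_mul, Finset.sum_neg_distrib]
  ring

end Curvature

namespace IsRegularOn

variable {A : LocalCoeff n} {U : Opens (Phase n)} (h : A.IsRegularOn U)

lemma differentiableAt_N (h : A.IsRegularOn U) (q : U) (a μ : Fin n) : DifferentiableAt ℝ (A.N a μ) q :=
  ((h.contDiffOn_N a μ).contDiffAt (U.isOpen.mem_nhds q.2)).differentiableAt (by simp)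

lemma rep_curvHH (α β μ ν : Fin n) :
    Rep (h.ring.curvHH h.Γ h.C μ ν α β) (A.curvHH A.natural α β μ ν) := by
  intro q
  rw [A.curvHH_eq _ (h.differentiableAt_N q)]
  have hrep := (((h.rep_δ μ (h.rep_Γ α β ν)).sub (h.rep_δ ν (h.rep_Γ α β μ))).add
    ((Rep.sum (s := Finset.univ) fun ε => (h.rep_Γ α ε μ).mul (h.rep_Γ ε β ν)).sub
      (Rep.sum (s := Finset.univ) fun ε => (h.rep_Γ α ε ν).mul (h.rep_Γ ε β μ)))).sub
    (Rep.sum (s := Finset.univ) fun a => (h.rep_R a μ ν).mul (h.rep_C α β a))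
  refine Eq.trans ?_ (hrep q)
  simp only [DiffRing.curvHH, Matrix.sub_apply, Matrix.add_apply, Matrix.map_apply,
    Matrix.mul_apply, Matrix.sum_apply, Matrix.smul_apply, smul_eq_mul]

lemma rep_curvHV (α β ν c : Fin n) :
    Rep (h.ring.curvHV h.Γ h.C ν c α β) (A.curvHV A.natural α β ν c) := by
  intro q
  rw [A.curvHV_eq _ (h.differentiableAt_N q)]
  have hrep := (((h.rep_dy c (h.rep_Γ α β ν)).sub (h.rep_δ ν (h.rep_C α β c))).add
    ((Rep.sum (s := Finset.univ) fun ε => (h.rep_C α ε c).mul (h.rep_Γ ε β ν)).sub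
      (Rep.sum (s := Finset.univ) fun ε => (h.rep_Γ α ε ν).mul (h.rep_C ε β c)))).add
    (Rep.sum (s := Finset.univ) fun a => (h.rep_dy c (h.rep_N a ν)).mul (h.rep_C α β a))
  refine Eq.trans ?_ (hrep q)
  simp only [DiffRing.curvHV, Matrix.sub_apply, Matrix.add_apply, Matrix.map_apply,
    Matrix.mul_apply, Matrix.sum_apply, Matrix.smul_apply, smul_eq_mul]

lemma rep_ricci (β ν : Fin n) : Rep (h.ring.ricci h.Γ h.C β ν) (A.ricci β ν) :=
  Rep.sum fun α => h.rep_curvHH α β ν α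

end IsRegularOn

end LocalCoeff

end EAP

end

noncomputable section

namespace EAP

namespace DiffRing

/-! ### From the frame to coordinates -/

section Pull

variable {K : Type*} [CommRing K] {ι : Type*} [Fintype ι]

/-- Frame components of a covariant 2-tensor. -/
def pull (V X : Matrix ι ι K) : Matrix ι ι K := V.transpose * X * V

lemma pull_apply (V X : Matrix ι ι K) (i k : ι) :
    pull V X i k = ∑ μ, ∑ ν, V μ i * V ν k * X μ ν := by
  simp only [pull, Matrix.mul_apply, Finset.sum_mul, Matrix.transpose_apply]
  rw [Finset.sum_comm]
  exact Finset.sum_congr rfl fun _ _ => Finset.sum_congr rfl fun _ _ => by ring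

/-- Allows a tensor identity in coordinates to be checked on frame components. -/
lemma pull_injective [DecidableEq ι] {L V : Matrix ι ι K} (hVL : V * L = 1)
    {X Y : Matrix ι ι K} (h : pull V X = pull V Y) : X = Y := by
  have hVL' : L.transpose * V.transpose = 1 := by
    rw [← Matrix.transpose_mul, hVL, Matrix.transpose_one]
  have h1 : ∀ X, L.transpose * pull V X * L = X := fun X => by
    have : L.transpose * pull V X * L = (L.transpose * V.transpose) * X * (V * L) := by
      rw [pull]; noncomm_ring
    rw [this, hVL', hVL, one_mul, mul_one]
  rw [← h1 X, h, h1]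

lemma trace_pull (V X : Matrix ι ι K) :
    ∑ μ, ∑ ν, (V * V.transpose) μ ν * X μ ν = ∑ i, pull V X i i := by
  simp only [pull_apply, Matrix.mul_apply, Finset.sum_mul, Matrix.transpose_apply]
  rw [sum_rotate]

end Pull

variable {K : Type*} [CommRing K] [Algebra ℝ K] {ι : Type*} [Fintype ι]
variable (B : DiffRing ι K) (L V : Matrix ι ι K) (Γ C : ι → Matrix ι ι K)

/-- The contortion `γ^α_{μν}`. -/
def contH (α μ ν : ι) : K := (V * cont L V (B.δ ν) (Γ ν) * L) α μ

/-- The contortion `γ^α_{μa}`. -/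
def contV (α μ a : ι) : K := (V * cont L V (B.dy a) (C a) * L) α μ

/-- The tensor `σ_{μν}`. -/
def sigma : Matrix ι ι K := fun μ ν =>
  ∑ α, ∑ β, B.contH L V Γ β α μ * B.contH L V Γ α β ν

/-- The tensor `ϖ_{μν}`. -/
def varpi : Matrix ι ι K := fun μ ν =>
  ∑ α, ∑ β, (B.contH L V Γ β α μ * B.contH L V Γ α ν β
    + B.contH L V Γ β μ α * B.contH L V Γ α β ν)

/-- The tensor `Q_{βμ}`. -/
def Q : Matrix ι ι K := fun β μ => ∑ ε, ∑ a, B.contV L V C ε β a * B.R a μ ε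

/-- The basic vector `C_μ`. -/
def basic (μ : ι) : K := ∑ α, ((V * L.map (B.δ α)) α μ - (V * L.map (B.δ μ)) α α)

/-- The tensor `Z_{μν}`. -/
def Z : Matrix ι ι K := fun μ ν => B.basic L V μ * B.divN ν

/-- The contraction `N_β γ^β_{μν}`. -/
def contN : Matrix ι ι K := fun μ ν => ∑ β, B.divN β * B.contH L V Γ β μ ν

/-- The field equation tensor `E_{μν}`. -/
def E [DecidableEq ι] : Matrix ι ι K := fun μ ν => ∑ β, (L.transpose * L) μ β *
  (V.det * ∑ j, B.eulerLagrange L V j β * L j ν)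

/-- Frame components of the contortion `γ_{ijk}`. -/
def frCont (i j k : ι) : K := frameThird (fun ν => cont L V (B.δ ν) (Γ ν)) V i j k

/-- Frame components of `Q_{βμ}`. -/
def frQ (j k : ι) : K :=
  ∑ m, ∑ a, (∑ μ, ∑ α, B.R a μ α * V μ k * V α m) * cont L V (B.dy a) (C a) m j

variable {L V}

lemma frCont_skew [DecidableEq ι] (hLV : L * V = 1)
    (hΓ : ∀ ν, (L.transpose * L).map (B.δ ν)
      = (L.transpose * L) * Γ ν + (Γ ν).transpose * (L.transpose * L)) (i j k : ι) :
    B.frCont L V Γ i j k = -B.frCont L V Γ j i k := by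
  simp only [frCont, frameThird, ← Finset.sum_neg_distrib]
  refine Finset.sum_congr rfl fun ν _ => ?_
  have h := congrFun (congrFun (cont_skew hLV (hΓ ν)) j) i
  rw [Matrix.transpose_apply, Matrix.neg_apply] at h
  rw [h, neg_mul]

/-- The contortion is the canonical connection minus a symmetric one, and the symmetric part drops
out on antisymmetrising. -/
lemma tor_eq_frCont (hs : ∀ α μ ν, Γ ν α μ = Γ μ α ν) (i j k : ι) :
    B.tor L V i j k = B.frCont L V Γ i j k - B.frCont L V Γ i k j := by
  have h1 : ∀ j k, ∑ ν, (L * Γ ν * V) i j * V ν k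
      = ∑ α, L i α * ∑ ν, ∑ μ, Γ ν α μ * (V μ j * V ν k) := by
    intro j k
    simp only [Matrix.mul_apply, Finset.sum_mul, Finset.mul_sum]
    rw [← sum_rotate fun ν μ α => L i α * (Γ ν α μ * (V μ j * V ν k))]
    exact Finset.sum_congr rfl fun _ _ => Finset.sum_congr rfl fun _ _ =>
      Finset.sum_congr rfl fun _ _ => by ring
  have h2 : ∑ ν, (L * Γ ν * V) i j * V ν k = ∑ ν, (L * Γ ν * V) i k * V ν j := by
    rw [h1, h1]
    refine Finset.sum_congr rfl fun α _ => ?_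
    rw [Finset.sum_comm]
    congr 1
    exact Finset.sum_congr rfl fun _ _ => Finset.sum_congr rfl fun _ _ => by rw [hs]; ring
  simp only [tor, can, frCont, frameThird, cont, Matrix.sub_apply, sub_mul,
    Finset.sum_sub_distrib]
  rw [h2]; ring

lemma sum_basic (i : ι) : ∑ μ, V μ i * B.basic L V μ = B.bas L V i := by
  have h1 : ∑ μ, ∑ α, V μ i * (V * L.map (B.δ α)) α μ = ∑ m, B.can L V m i m := by
    have e1 : ∀ α, ∑ μ, V μ i * (V * L.map (B.δ α)) α μ
        = ∑ m, V α m * (L.map (B.δ α) * V) m i := by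
      intro α
      rw [← Matrix.mul_apply, ← mul_assoc, Matrix.mul_apply]
      exact Finset.sum_congr rfl fun _ _ => mul_comm _ _
    rw [Finset.sum_comm]
    simp only [e1, can]
    rw [Finset.sum_comm]
    exact Finset.sum_congr rfl fun _ _ => Finset.sum_congr rfl fun _ _ => mul_comm _ _
  have h2 : ∑ μ, ∑ α, V μ i * (V * L.map (B.δ μ)) α α = ∑ m, B.can L V m m i := by
    have e1 : ∀ μ, ∑ α, (V * L.map (B.δ μ)) α α = ∑ m, (L.map (B.δ μ) * V) m m := fun μ =>
      Matrix.trace_mul_comm V (L.map (B.δ μ))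
    simp only [← Finset.mul_sum, e1, can]
    rw [Finset.sum_comm]
    simp only [Finset.mul_sum]
    exact Finset.sum_congr rfl fun _ _ => Finset.sum_congr rfl fun _ _ => mul_comm _ _
  simp only [basic, bas, tor, mul_sub, Finset.mul_sum, Finset.sum_sub_distrib, h1, h2]

lemma pull_Z : pull V (B.Z L V)
    = fun i k => B.bas L V i * ∑ γ, V γ k * B.divN γ := by
  ext i k
  rw [pull_apply, ← B.sum_basic, Finset.sum_mul_sum]
  exact Finset.sum_congr rfl fun _ _ => Finset.sum_congr rfl fun _ _ => by rw [Z]; ring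

variable [DecidableEq ι]

lemma contH_mul (hLV : L * V = 1) (α i ν : ι) :
    ∑ μ, B.contH L V Γ α μ ν * V μ i = (V * cont L V (B.δ ν) (Γ ν)) α i := by
  simp only [contH]
  rw [← Matrix.mul_apply, mul_assoc, hLV, mul_one]

lemma pull_sigma (hLV : L * V = 1) : pull V (B.sigma L V Γ) = frSigma (B.frCont L V Γ) := by
  have h1 : ∀ μ ν, B.sigma L V Γ μ ν = ∑ a, ∑ b, cont L V (B.δ μ) (Γ μ) b a
      * cont L V (B.δ ν) (Γ ν) a b := by
    intro μ ν
    have htr : ∀ X Y : Matrix ι ι K, ∑ a, ∑ b, X b a * Y a b = (X * Y).trace := by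
      intro X Y
      rw [Finset.sum_comm]
      simp [Matrix.trace, Matrix.mul_apply]
    simp only [sigma, contH, htr]
    have e1 : V * cont L V (B.δ μ) (Γ μ) * L * (V * cont L V (B.δ ν) (Γ ν) * L)
      = V * (cont L V (B.δ μ) (Γ μ) * (L * V) * cont L V (B.δ ν) (Γ ν) * L) := by noncomm_ring
    rw [e1, Matrix.trace_mul_comm, mul_assoc _ L V, hLV, mul_one, mul_one]
  ext i k
  simp only [pull_apply, h1, frSigma, frCont, frameThird, Finset.sum_mul_sum]
  simp only [Finset.mul_sum]
  rw [sum_rotate]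
  refine Finset.sum_congr rfl fun a _ => ?_
  rw [sum_rotate]
  exact Finset.sum_congr rfl fun _ _ => Finset.sum_congr rfl fun _ _ =>
    Finset.sum_congr rfl fun _ _ => by ring

lemma pull_varpi (hLV : L * V = 1) : pull V (B.varpi L V Γ) = frVarpi (B.frCont L V Γ) := by
  set c : ι → Matrix ι ι K := fun ν => cont L V (B.δ ν) (Γ ν) with hc
  set W : Matrix ι ι K := fun μ ν => ∑ α, ∑ β, B.contH L V Γ β α μ * B.contH L V Γ α ν β with hW
  set w : Matrix ι ι K := fun i k => ∑ a, ∑ b, B.frCont L V Γ b a i * B.frCont L V Γ a k b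
    with hw
  -- The two halves of `ϖ` are transposes of each other, in coordinates and in the frame alike, so
  -- only one has to be transformed.
  have h0 : B.varpi L V Γ = W + W.transpose := by
    ext μ ν
    simp only [varpi, Finset.sum_add_distrib, hW]
    congr 1
    rw [Finset.sum_comm]
    exact Finset.sum_congr rfl fun _ _ => Finset.sum_congr rfl fun _ _ => mul_comm _ _
  have h1 : (frVarpi (B.frCont L V Γ) : Matrix ι ι K) = w + w.transpose := by
    ext i k
    simp only [frVarpi, Finset.sum_add_distrib, hw]
    congr 1
    rw [Finset.sum_comm]
    exact Finset.sum_congr rfl fun _ _ => Finset.sum_congr rfl fun _ _ => mul_comm _ _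
  have h2 : ∀ μ k, ∑ ν, W μ ν * V ν k = ∑ a, ∑ b, c μ b a * B.frCont L V Γ a k b := by
    intro μ k
    have e1 : ∑ ν, W μ ν * V ν k = ∑ β, ((V * c μ * L) * (V * c β)) β k := by
      simp only [hW, Finset.sum_mul]
      rw [Finset.sum_comm, Finset.sum_congr rfl fun α _ => Finset.sum_comm, Finset.sum_comm]
      refine Finset.sum_congr rfl fun β _ => ?_
      rw [Matrix.mul_apply]
      refine Finset.sum_congr rfl fun α _ => ?_
      rw [← B.contH_mul Γ hLV, Finset.mul_sum]
      exact Finset.sum_congr rfl fun _ _ => mul_assoc _ _ _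
    have e2 : ∀ β, (V * c μ * L) * (V * c β) = V * (c μ * c β) := fun β => by
      have : (V * c μ * L) * (V * c β) = V * c μ * (L * V) * c β := by noncomm_ring
      rw [this, hLV, mul_one, mul_assoc]
    rw [e1]
    simp only [e2]
    simp only [Matrix.mul_apply, frCont, frameThird, Finset.mul_sum]
    rw [sum_rotate fun a b ν => c μ b a * (c ν a k * V ν b)]
    refine Finset.sum_congr rfl fun β _ => ?_
    rw [Finset.sum_comm]
    exact Finset.sum_congr rfl fun _ _ => Finset.sum_congr rfl fun _ _ => by ring
  have h3 : pull V W = w := by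
    ext i k
    have e1 : pull V W i k = ∑ μ, V μ i * ∑ ν, W μ ν * V ν k := by
      simp only [pull_apply, Finset.mul_sum]
      exact Finset.sum_congr rfl fun _ _ => Finset.sum_congr rfl fun _ _ => by ring
    rw [e1]
    simp only [h2, hw, Finset.mul_sum]
    rw [← sum_rotate fun a b μ => V μ i * (c μ b a * B.frCont L V Γ a k b)]
    refine Finset.sum_congr rfl fun a _ => Finset.sum_congr rfl fun b _ => ?_
    rw [show B.frCont L V Γ b a i = ∑ ν, c ν b a * V ν i from rfl, Finset.sum_mul]
    exact Finset.sum_congr rfl fun _ _ => by ring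
  have h4 : pull V W.transpose = w.transpose := by
    rw [← h3]
    simp only [pull, Matrix.transpose_mul, Matrix.transpose_transpose, mul_assoc]
  rw [h0, h1, ← h4, ← h3]
  simp only [pull, mul_add, add_mul]

lemma pull_Q (hLV : L * V = 1) : pull V (B.Q L V C) = B.frQ L V C := by
  ext j k
  have h1 : ∀ ε a, ∑ β, B.contV L V C ε β a * V β j
      = ∑ m, V ε m * cont L V (B.dy a) (C a) m j := by
    intro ε a
    simp only [contV]
    rw [← Matrix.mul_apply, ← Matrix.mul_apply, mul_assoc, hLV, mul_one]
  have h2 : pull V (B.Q L V C) j k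
      = ∑ μ, ∑ ε, ∑ a, V μ k * B.R a μ ε * ∑ β, B.contV L V C ε β a * V β j := by
    rw [pull_apply, Finset.sum_comm]
    refine Finset.sum_congr rfl fun μ _ => ?_
    simp only [Q, Finset.mul_sum]
    rw [sum_rotate fun ε a β => V μ k * B.R a μ ε * (B.contV L V C ε β a * V β j)]
    exact Finset.sum_congr rfl fun _ _ => Finset.sum_congr rfl fun _ _ =>
      Finset.sum_congr rfl fun _ _ => by ring
  rw [h2]
  simp only [h1, frQ, Finset.mul_sum, Finset.sum_mul]
  rw [sum_rotate, Finset.sum_comm (γ := ι) (α := ι) (f := fun m a => ∑ μ, ∑ α,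
    B.R a μ α * V μ k * V α m * cont L V (B.dy a) (C a) m j)]
  refine Finset.sum_congr rfl fun a _ => ?_
  rw [sum_rotate]
  exact Finset.sum_congr rfl fun _ _ => Finset.sum_congr rfl fun _ _ =>
    Finset.sum_congr rfl fun _ _ => by ring

lemma pull_contN (hLV : L * V = 1) : pull V (B.contN L V Γ)
    = fun i k => ∑ c, (∑ γ, V γ c * B.divN γ) * B.frCont L V Γ c i k := by
  ext i k
  have h1 : ∀ β ν, ∑ μ, B.contH L V Γ β μ ν * V μ i
      = ∑ c, V β c * cont L V (B.δ ν) (Γ ν) c i := fun β ν => by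
    rw [B.contH_mul Γ hLV, Matrix.mul_apply]
  have h2 : pull V (B.contN L V Γ) i k
      = ∑ β, ∑ ν, B.divN β * V ν k * ∑ μ, B.contH L V Γ β μ ν * V μ i := by
    simp only [pull_apply, contN, Finset.mul_sum]
    rw [sum_rotate]
    refine Finset.sum_congr rfl fun β _ => ?_
    rw [Finset.sum_comm]
    exact Finset.sum_congr rfl fun _ _ => Finset.sum_congr rfl fun _ _ => by ring
  rw [h2]
  simp only [h1, frCont, frameThird, Finset.sum_mul_sum]
  simp only [Finset.mul_sum]
  rw [sum_rotate]
  exact Finset.sum_congr rfl fun _ _ => Finset.sum_congr rfl fun _ _ =>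
    Finset.sum_congr rfl fun _ _ => by ring

lemma pull_E (hLV : L * V = 1) : pull V (B.E L V)
    = fun i k => V.det * ∑ β, L i β * B.eulerLagrange L V k β := by
  set M : Matrix ι ι K := fun β j => V.det * B.eulerLagrange L V j β with hM
  have h1 : B.E L V = L.transpose * L * M * L := by
    ext μ ν
    rw [mul_assoc _ M, Matrix.mul_apply]
    refine Finset.sum_congr rfl fun β _ => ?_
    rw [Matrix.mul_apply (M := M), Finset.mul_sum]
    congr 1
    exact Finset.sum_congr rfl fun _ _ => by simp only [hM]; ring
  have h2 : pull V (B.E L V) = L * M := by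
    have h3 : pull V (B.E L V) = (L * V).transpose * L * M * (L * V) := by
      rw [h1, pull, Matrix.transpose_mul]; noncomm_ring
    rw [h3, hLV, Matrix.transpose_one, one_mul, mul_one]
  rw [h2]
  ext i k
  rw [Matrix.mul_apply, Finset.mul_sum]
  exact Finset.sum_congr rfl fun _ _ => by simp only [hM]; ring

/-- The symmetrised field equations in coordinates. -/
theorem field_equation (hLV : L * V = 1) (hVL : V * L = 1)
    (hΓ : ∀ ν, (L.transpose * L).map (B.δ ν)
      = (L.transpose * L) * Γ ν + (Γ ν).transpose * (L.transpose * L))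
    (hs : ∀ α μ ν, Γ ν α μ = Γ μ α ν) {tr : Matrix ι ι K → K}
    (htr : ∀ X, tr X = ∑ μ, ∑ ν, (V * V.transpose) μ ν * X μ ν) {ric : Matrix ι ι K}
    (hric : ∀ β μ, ric β μ = B.ricci Γ C β μ) (μ ν : ι) :
    B.E L V μ ν + B.E L V ν μ + 2 * (ric μ ν + ric ν μ) - 2 * tr ric * (L.transpose * L) μ ν
      = 2 * ((tr (B.sigma L V Γ) - tr (B.varpi L V Γ) - tr (B.Q L V C) + 2 * tr (B.Z L V))
          * (L.transpose * L) μ ν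
        - 2 * (B.sigma L V Γ μ ν - B.varpi L V Γ μ ν) + (B.Q L V C μ ν + B.Q L V C ν μ)
        + (B.contN L V Γ μ ν + B.contN L V Γ ν μ) - (B.Z L V μ ν + B.Z L V ν μ)) := by
  have hpg : pull V (L.transpose * L) = 1 := by
    have h3 : pull V (L.transpose * L) = (L * V).transpose * (L * V) := by
      rw [pull, Matrix.transpose_mul]; noncomm_ring
    rw [h3, hLV, Matrix.transpose_one, one_mul]
  have hpT : ∀ X, pull V X.transpose = (pull V X).transpose := fun X => by
    simp only [pull, Matrix.transpose_mul, Matrix.transpose_transpose, mul_assoc]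
  have hadd : ∀ X Y, pull V (X + Y) = pull V X + pull V Y := fun X Y => by
    simp only [pull, mul_add, add_mul]
  have hsub : ∀ X Y, pull V (X - Y) = pull V X - pull V Y := fun X Y => by
    simp only [pull, mul_sub, sub_mul]
  have hsmul : ∀ (f : K) X, pull V (f • X) = f • pull V X := fun f X => by
    simp only [pull, Matrix.mul_smul, Matrix.smul_mul]
  have hframe := field_equation_frame (rc := pull V ric) (q := B.frQ L V C)
    (w := fun c => ∑ γ, V γ c * B.divN γ) (B.frCont_skew Γ hLV hΓ) (B.tor_eq_frCont Γ hs)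
    (fun j k => by
      rw [pull_apply]
      simp only [hric]
      exact B.frame_ricci hLV hVL Γ C (γ := B.frCont L V Γ) (fun _ _ _ => rfl) j k)
    (B.eulerLagrange_frame hLV hVL)
  have key : B.E L V + (B.E L V).transpose + (2 : K) • (ric + ric.transpose)
        - (2 * tr ric) • (L.transpose * L)
      = (2 : K) • ((tr (B.sigma L V Γ) - tr (B.varpi L V Γ) - tr (B.Q L V C) + 2 * tr (B.Z L V))
          • (L.transpose * L) - (2 : K) • (B.sigma L V Γ - B.varpi L V Γ)
        + (B.Q L V C + (B.Q L V C).transpose)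
        + (B.contN L V Γ + (B.contN L V Γ).transpose) - (B.Z L V + (B.Z L V).transpose)) := by
    -- In the frame `g` is the identity and traces are diagonal sums, so the claim is the frame
    -- identity, with the Kronecker terms treated by cases.
    apply pull_injective hVL
    simp only [hadd, hsub, hsmul, hpT, hpg, htr, trace_pull]
    ext i k
    have e1 := fun i k => congrFun (congrFun (B.pull_sigma Γ hLV) i) k
    have e2 := fun i k => congrFun (congrFun (B.pull_varpi Γ hLV) i) k
    have e3 := fun i k => congrFun (congrFun (B.pull_Q C hLV) i) k
    have e4 := fun i k => congrFun (congrFun (B.pull_Z (L := L) (V := V)) i) k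
    have e5 := fun i k => congrFun (congrFun (B.pull_contN Γ hLV) i) k
    have e6 := fun i k => congrFun (congrFun (B.pull_E hLV) i) k
    have hsum : ∑ c, (∑ γ, V γ c * B.divN γ) * (B.frCont L V Γ c i k + B.frCont L V Γ c k i)
        = ∑ c, (∑ γ, V γ c * B.divN γ) * B.frCont L V Γ c i k
          + ∑ c, (∑ γ, V γ c * B.divN γ) * B.frCont L V Γ c k i := by
      simp only [mul_add, Finset.sum_add_distrib]
    have hik := hframe i k
    rw [hsum] at hik
    simp only [Matrix.add_apply, Matrix.sub_apply, Matrix.smul_apply, Matrix.transpose_apply,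
      smul_eq_mul, Matrix.one_apply, e1, e2, e3, e4, e5, e6]
    by_cases hk : i = k
    · simp only [hk, if_true] at hik ⊢
      linear_combination hik
    · simp only [if_neg hk] at hik ⊢
      linear_combination hik
  have := congrFun (congrFun key μ) ν
  simpa only [Matrix.add_apply, Matrix.sub_apply, Matrix.smul_apply, Matrix.transpose_apply,
      smul_eq_mul] using this

end DiffRing

end EAP

end

noncomputable section

namespace EAP

/-! ## Coordinate expressions as smooth functions -/

section Map

variable {R S ι : Type*} [CommRing R] [CommRing S] [Fintype ι] (f : R →+* S)

lemma map_torOf (up : Matrix ι ι R) (D : ι → ι → ι → R) (i j c : ι) :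
    f (torOf up D i j c) = torOf (up.map f) (fun i μ ν => f (D i μ ν)) i j c := by
  simp [torOf, map_sum]

lemma map_basOf (T : ι → ι → ι → R) (c : ι) :
    f (basOf T c) = basOf (fun i j c => f (T i j c)) c := by
  simp [basOf, map_sum]

variable [DecidableEq ι]

/-- Polynomial formulas commute with evaluation; this identifies variations computed over `ℝ` at
each point with elements of the ring of smooth functions, which can be differentiated again. -/
lemma map_lagDerOf (T : ι → ι → ι → R) (C : ι → R) (k m : ι) :
    f (lagDerOf T C k m) = lagDerOf (fun i j c => f (T i j c)) (fun c => f (C c)) k m := by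
  have h2 : f 2 = 2 := map_ofNat f 2
  simp [lagDerOf, lagOf, map_sum, apply_ite f, h2]

end Map

lemma map_superpotOf {R S ι : Type*} [CommRing R] [CommRing S] [DecidableEq ι] (f : R →+* S)
    (T : ι → ι → ι → R) (C : ι → R) (k b c : ι) :
    f (superpotOf T C k b c) = superpotOf (fun i j c => f (T i j c)) (fun c => f (C c)) k b c := by
  have h2 : f 2 = 2 := map_ofNat f 2
  simp [superpotOf, apply_ite f, h2]

lemma DiffRing.tor_eq_torOf {K : Type*} [CommRing K] [Algebra ℝ K] {ι : Type*} [Fintype ι]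
    (B : DiffRing ι K) (L V : Matrix ι ι K) :
    B.tor L V = torOf V fun i μ ν => B.δ ν (L i μ) := by
  have h1 : ∀ i j k, B.can L V i j k = ∑ μ, ∑ ν, B.δ ν (L i μ) * (V μ j * V ν k) := by
    intro i j k
    simp only [can, Matrix.mul_apply, Matrix.map_apply, Finset.sum_mul]
    rw [Finset.sum_comm]
    exact Finset.sum_congr rfl fun _ _ => Finset.sum_congr rfl fun _ _ => mul_assoc _ _ _
  ext i j k
  simp only [tor, h1, torOf, sub_mul, Finset.sum_sub_distrib]
  rw [Finset.sum_comm (f := fun μ ν => B.δ ν (L i μ) * (V μ k * V ν j))]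
  simp only [mul_comm (V _ k)]

lemma DiffRing.bas_eq_basOf {K : Type*} [CommRing K] [Algebra ℝ K] {ι : Type*} [Fintype ι]
    (B : DiffRing ι K) (L V : Matrix ι ι K) : B.bas L V = basOf (B.tor L V) := rfl

lemma torOf_sum {ι : Type*} [Fintype ι] {n : ℕ} (up : Matrix (Fin n) (Fin n) ℝ) (w : ι → ℝ)
    (D : ι → Fin n → Fin n → Fin n → ℝ) :
    torOf up (fun i μ ν => ∑ γ, w γ * D γ i μ ν) = fun i j c => ∑ γ, w γ * torOf up (D γ) i j c := by
  ext i j c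
  simp only [torOf, Finset.mul_sum]
  rw [← sum_rotate fun μ ν γ => w γ * ((D γ i μ ν - D γ i ν μ) * (up μ j * up ν c))]
  refine Finset.sum_congr rfl fun μ _ => Finset.sum_congr rfl fun ν _ => ?_
  rw [← Finset.sum_sub_distrib, Finset.sum_mul]
  exact Finset.sum_congr rfl fun _ _ => by ring

lemma lagVar_sum {ι : Type*} [Fintype ι] {n : ℕ} (T : Fin n → Fin n → Fin n → ℝ) (w : ι → ℝ)
    (T' : ι → Fin n → Fin n → Fin n → ℝ) :
    lagVar T (fun i j c => ∑ γ, w γ * T' γ i j c) = ∑ γ, w γ * lagVar T (T' γ) := by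
  have hb : ∀ c, basOf (fun i j c => ∑ γ, w γ * T' γ i j c) c = ∑ γ, w γ * basOf (T' γ) c := by
    intro c
    simp only [basOf, Finset.mul_sum]
    exact Finset.sum_comm
  have h1 : ∀ c, ∑ i, ∑ j, T j i c * ∑ γ, w γ * T' γ i j c
      = ∑ γ, w γ * ∑ i, ∑ j, T j i c * T' γ i j c := by
    intro c
    simp only [Finset.mul_sum]
    rw [← sum_rotate fun i j γ => w γ * (T j i c * T' γ i j c)]
    exact Finset.sum_congr rfl fun _ _ => Finset.sum_congr rfl fun _ _ =>
      Finset.sum_congr rfl fun _ _ => by ring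
  simp only [lagVar, hb, h1]
  have h2 : ∀ γ, w γ * ∑ c, (2 * ∑ i, ∑ j, T j i c * T' γ i j c - 2 * (basOf T c * basOf (T' γ) c))
      = ∑ c, w γ * (2 * ∑ i, ∑ j, T j i c * T' γ i j c - 2 * (basOf T c * basOf (T' γ) c)) :=
    fun γ => Finset.mul_sum _ _ _
  simp only [h2]
  rw [Finset.sum_comm]
  refine Finset.sum_congr rfl fun c _ => ?_
  rw [Finset.mul_sum, Finset.mul_sum, Finset.mul_sum, ← Finset.sum_sub_distrib]
  exact Finset.sum_congr rfl fun _ _ => by ring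

namespace LocalCoeff

open smoothFn TopologicalSpace

variable {n : ℕ}

namespace IsRegularOn

variable {A : LocalCoeff n} {U : Opens (Phase n)} (h : A.IsRegularOn U)

lemma eval_det_L (q : U) : eval q h.L.det = (A.coframe q).det := by
  rw [RingHom.map_det, RingHom.mapMatrix_apply, h.map_L]

lemma hDerOf_eq (q : U) (i μ ν : Fin n) : eval q (h.ring.δ ν (h.L i μ))
    = hDerOf (A.NAt q) (A.coframeX q) (A.coframeY q) i μ ν := by
  rw [(h.rep_δ ν (h.rep_L i μ)).eval_eq, dH_eq]
  rfl

lemma eval_tor (q : U) (i j k : Fin n) : eval q (h.ring.tor h.L h.V i j k)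
    = torOf (A.coframe q)⁻¹ (hDerOf (A.NAt q) (A.coframeX q) (A.coframeY q)) i j k := by
  rw [DiffRing.tor_eq_torOf, map_torOf, h.map_V, h.inv_coframe]
  simp only [h.hDerOf_eq]

lemma rep_dLdl (j β : Fin n) : Rep (h.L.det * ∑ m, h.V β m * h.ring.lagDer h.L h.V j m)
    (A.dLdl j β) := by
  intro q
  have h1 := hasDerivAt_lagrangian_coframe (A.NAt q) (h.isUnit_det_coframe q) (A.coframeX q)
    (A.coframeY q) j β
  rw [dLdl, lineDeriv, h1.deriv, ← eval_apply, map_mul, h.eval_det_L, map_sum]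
  congr 1
  refine Finset.sum_congr rfl fun m _ => ?_
  rw [map_mul, DiffRing.lagDer, map_lagDerOf, DiffRing.bas_eq_basOf]
  simp only [map_basOf, h.eval_tor]
  rw [h.inv_coframe]
  rfl

lemma eval_momentum (q : U) (j β γ : Fin n) : eval q (h.ring.momentum h.L h.V j β γ)
    = (A.coframe q).det * lagVar
      (torOf (A.coframe q)⁻¹ (hDerOf (A.NAt q) (A.coframeX q) (A.coframeY q)))
      (torOf (A.coframe q)⁻¹ (Pi.single j (Pi.single β (Pi.single γ 1)))) := by
  rw [lagVar_single, DiffRing.momentum, map_mul, h.eval_det_L, map_sum]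
  congr 1
  refine Finset.sum_congr rfl fun b _ => ?_
  rw [map_sum]
  refine Finset.sum_congr rfl fun c _ => ?_
  rw [map_mul, map_mul, DiffRing.superpot, map_superpotOf, DiffRing.bas_eq_basOf]
  simp only [map_basOf, h.eval_tor]
  rw [h.inv_coframe]
  rfl

lemma rep_dLdlx (j β γ : Fin n) : Rep (h.ring.momentum h.L h.V j β γ) (A.dLdlx j β γ) := by
  intro q
  have h1 := hasDerivAt_lagrangian_of_affine (Nv := A.NAt q) (l := A.coframe q)
    (lx := fun t => A.coframeX q + t • (Pi.single j (Pi.single β (Pi.single γ 1)) :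
      Fin n → Fin n → Fin n → ℝ))
    (ly := fun _ => A.coframeY q) (D := hDerOf (A.NAt q) (A.coframeX q) (A.coframeY q))
    (D' := Pi.single j (Pi.single β (Pi.single γ 1))) fun t => by
      ext i μ ν
      simp only [hDerOf, Pi.add_apply, Pi.smul_apply, smul_eq_mul]
      ring
  rw [dLdlx, lineDeriv, h1.deriv, ← eval_apply, h.eval_momentum]

/-- Chain rule: raising `λ_{jβ;a}` lowers every `δ_γ λ_{jβ}` by `N^a_γ`, so linearity of the
variation yields a combination of the `x`-momenta. -/
lemma rep_dLdly (j β a : Fin n) :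
    Rep (-∑ γ, h.ring.N a γ * h.ring.momentum h.L h.V j β γ) (A.dLdly j β a) := by
  intro q
  have h1 := hasDerivAt_lagrangian_of_affine (Nv := A.NAt q) (l := A.coframe q)
    (lx := fun _ => A.coframeX q)
    (ly := fun t => A.coframeY q + t • (Pi.single j (Pi.single β (Pi.single a 1)) :
      Fin n → Fin n → Fin n → ℝ))
    (D := hDerOf (A.NAt q) (A.coframeX q) (A.coframeY q))
    (D' := fun i μ ν => ∑ γ, -A.NAt q a γ *
      (Pi.single j (Pi.single β (Pi.single γ 1)) : Fin n → Fin n → Fin n → ℝ) i μ ν) fun t => by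
      ext i μ ν
      have h2 : ∑ γ, -A.NAt q a γ *
          (Pi.single j (Pi.single β (Pi.single γ 1)) : Fin n → Fin n → Fin n → ℝ) i μ ν
          = -∑ b, A.NAt q b ν *
          (Pi.single j (Pi.single β (Pi.single a 1)) : Fin n → Fin n → Fin n → ℝ) i μ b := by
        by_cases hi : i = j
        · subst hi
          by_cases hm : μ = β
          · subst hm
            simp [Pi.single_apply]
          · simp [hm]
        · simp [hi]
      rw [h2]
      simp only [hDerOf, Pi.add_apply, Pi.smul_apply, smul_eq_mul, mul_add,
        Finset.sum_add_distrib, Finset.mul_sum, mul_neg, mul_left_comm t]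
      ring
  rw [dLdly, lineDeriv, h1.deriv, ← eval_apply, torOf_sum, lagVar_sum, map_neg, map_sum,
    Finset.mul_sum, ← Finset.sum_neg_distrib]
  refine Finset.sum_congr rfl fun γ _ => ?_
  rw [map_mul, h.eval_momentum, (h.rep_N a γ).eval_eq, NAt]
  ring

lemma rep_eulerLagrange (j β : Fin n) :
    Rep (h.ring.eulerLagrange h.L h.V j β) (A.eulerLagrange j β) :=
  ((h.rep_dLdl j β).sub (Rep.sum fun γ => h.rep_dx γ (h.rep_dLdlx j β γ))).sub
    (Rep.sum fun a => h.rep_dy a (h.rep_dLdly j β a))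

lemma rep_det_V : Rep h.V.det (fun q => (A.coframe q).det⁻¹) := by
  intro q
  have h1 : h.V.det * h.L.det = 1 := by rw [← Matrix.det_mul, h.V_mul_L, Matrix.det_one]
  have h2 := congrArg (eval q) h1
  rw [map_mul, h.eval_det_L, map_one] at h2
  exact eq_inv_of_mul_eq_one_left h2

lemma rep_E (μ ν : Fin n) : Rep (h.ring.E h.L h.V μ ν) (A.E μ ν) :=
  Rep.sum fun β => (h.rep_g μ β).mul
    (h.rep_det_V.mul (Rep.sum fun j => (h.rep_eulerLagrange j β).mul (h.rep_L j ν)))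

lemma V_mul_cont_mul_L (D : Derivation ℝ (smoothFn U) (smoothFn U))
    (G : Matrix (Fin n) (Fin n) (smoothFn U)) :
    h.V * DiffRing.cont h.L h.V D G * h.L = h.V * h.L.map D - G := by
  have h1 : h.V * DiffRing.cont h.L h.V D G * h.L
      = h.V * h.L.map D * (h.V * h.L) - h.V * h.L * G * (h.V * h.L) := by
    rw [DiffRing.cont]
    simp only [mul_sub, sub_mul, mul_assoc]
  rw [h1, h.V_mul_L, one_mul, mul_one, mul_one]

lemma rep_canonicalΓ (α μ ν : Fin n) :
    Rep ((h.V * h.L.map (h.ring.δ ν)) α μ) (A.canonical.Γ α μ ν) := by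
  rw [Matrix.mul_apply]
  exact Rep.sum fun i => (h.rep_V α i).mul (h.rep_δ ν (h.rep_L i μ))

lemma rep_canonicalC (α μ c : Fin n) :
    Rep ((h.V * h.L.map (h.ring.dy c)) α μ) (A.canonical.C α μ c) := by
  rw [Matrix.mul_apply]
  exact Rep.sum fun i => (h.rep_V α i).mul (h.rep_dy c (h.rep_L i μ))

lemma rep_contH (α μ ν : Fin n) : Rep (h.ring.contH h.L h.V h.Γ α μ ν) (A.contH α μ ν) := by
  rw [DiffRing.contH, h.V_mul_cont_mul_L]
  exact (h.rep_canonicalΓ α μ ν).sub (h.rep_Γ α μ ν)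

lemma rep_contV (α μ a : Fin n) : Rep (h.ring.contV h.L h.V h.C α μ a) (A.contV α μ a) := by
  rw [DiffRing.contV, h.V_mul_cont_mul_L]
  exact (h.rep_canonicalC α μ a).sub (h.rep_C α μ a)

lemma rep_sigma (μ ν : Fin n) : Rep (h.ring.sigma h.L h.V h.Γ μ ν) (A.sigma μ ν) :=
  Rep.sum fun α => Rep.sum fun β => (h.rep_contH β α μ).mul (h.rep_contH α β ν)

lemma rep_varpi (μ ν : Fin n) : Rep (h.ring.varpi h.L h.V h.Γ μ ν) (A.varpi μ ν) :=
  Rep.sum fun α => Rep.sum fun β => ((h.rep_contH β α μ).mul (h.rep_contH α ν β)).add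
    ((h.rep_contH β μ α).mul (h.rep_contH α β ν))

lemma rep_Q (β μ : Fin n) : Rep (h.ring.Q h.L h.V h.C β μ) (A.Q β μ) :=
  Rep.sum fun ε => Rep.sum fun a => (h.rep_contV ε β a).mul (h.rep_R a μ ε)

lemma rep_basic (μ : Fin n) : Rep (h.ring.basic h.L h.V μ) (A.basic μ) :=
  Rep.sum fun α => (h.rep_canonicalΓ α μ α).sub (h.rep_canonicalΓ α α μ)

lemma rep_divN (β : Fin n) : Rep (h.ring.divN β) (A.divN β) :=
  Rep.sum fun a => h.rep_dy a (h.rep_N a β)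

lemma rep_Z (μ ν : Fin n) : Rep (h.ring.Z h.L h.V μ ν) (A.Z μ ν) :=
  (h.rep_basic μ).mul (h.rep_divN ν)

lemma rep_contN (μ ν : Fin n) : Rep (h.ring.contN h.L h.V h.Γ μ ν)
    (fun q => ∑ β, A.divN β q * A.contH β μ ν q) :=
  Rep.sum fun β => (h.rep_divN β).mul (h.rep_contH β μ ν)

lemma rep_trace {X : Matrix (Fin n) (Fin n) (smoothFn U)} {F : Fin n → Fin n → Phase n → ℝ}
    (hX : ∀ μ ν, Rep (X μ ν) (F μ ν)) : Rep (∑ μ, ∑ ν, h.gInv μ ν * X μ ν) (A.trace F) :=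
  Rep.sum fun μ => Rep.sum fun ν => (h.rep_gInv μ ν).mul (hX μ ν)

end IsRegularOn

end LocalCoeff

end EAP

end

noncomputable section

namespace EAP

/-! ## The field equations and the contracted Bianchi identity at a point -/

namespace LocalCoeff.IsRegularOn

open smoothFn TopologicalSpace

variable {n : ℕ} {A : LocalCoeff n} {U : Opens (Phase n)} (h : A.IsRegularOn U)

/-- The evaluated ring identity, from which the first claim follows at once and the second after a
skew correction. -/
lemma symm_E_eq (h : A.IsRegularOn U) (q : U) (μ ν : Fin n) : symm A.E μ ν q
    = -2 * (symm A.ricci μ ν q - 1 / 2 * A.g μ ν q * A.scalar q - A.energyMomentum μ ν q) := by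
  have h1 := congrArg (eval q) (h.ring.field_equation h.Γ h.C h.L_mul_V h.V_mul_L h.metric_Γ
    h.Γ_symm (tr := fun X => ∑ μ, ∑ ν, h.gInv μ ν * X μ ν) (fun _ => rfl)
    (ric := fun β μ => h.ring.ricci h.Γ h.C β μ) (fun _ _ => rfl) μ ν)
  have hg : eval q ((h.L.transpose * h.L) μ ν) = A.g μ ν q := (h.rep_g μ ν).eval_eq q
  have h2 : eval q (2 : smoothFn U) = 2 := map_ofNat _ 2
  simp only [map_add, map_sub, map_mul, hg, h2, (h.rep_E _ _).eval_eq, (h.rep_ricci _ _).eval_eq,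
    (h.rep_trace h.rep_ricci).eval_eq, (h.rep_trace h.rep_sigma).eval_eq,
    (h.rep_trace h.rep_varpi).eval_eq, (h.rep_trace h.rep_Q).eval_eq,
    (h.rep_trace h.rep_Z).eval_eq, (h.rep_sigma _ _).eval_eq, (h.rep_varpi _ _).eval_eq,
    (h.rep_Q _ _).eval_eq, (h.rep_Z _ _).eval_eq, (h.rep_contN _ _).eval_eq] at h1
  have hΩ : ∑ β, A.divN β q * A.Omega β μ ν q
      = ∑ β, A.divN β q * A.contH β μ ν q + ∑ β, A.divN β q * A.contH β ν μ q := by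
    simp only [Omega, mul_add, Finset.sum_add_distrib]
  simp only [symm, energyMomentum, scalar, hΩ]
  linear_combination h1 / 2

lemma ricci_sub_ricci (h : A.IsRegularOn U) (q : U) (μ ν : Fin n) :
    A.ricci μ ν q - A.ricci ν μ q = -A.cyclicCR μ ν q := by
  have h1 := h.ring.ricci_antisymm h.g_mul_gInv h.gInv_mul_g h.transpose_gInv h.transpose_g
    h.metric_Γ h.metric_C h.Γ_symm μ ν
  have hrep : Rep (-∑ α, ∑ a, (h.C a α μ * h.ring.R a ν α + h.C a α ν * h.ring.R a α μ
      + h.C a α α * h.ring.R a μ ν)) fun q => -A.cyclicCR μ ν q :=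
    (Rep.sum fun α => Rep.sum fun a => (((h.rep_C α μ a).mul (h.rep_R a ν α)).add
      ((h.rep_C α ν a).mul (h.rep_R a α μ))).add ((h.rep_C α α a).mul (h.rep_R a μ ν))).neg
  rw [← h1] at hrep
  exact ((h.rep_ricci μ ν).sub (h.rep_ricci ν μ) q).symm.trans (hrep q)

/-- The mixed Ricci tensor as smooth functions. -/
def ricciMixed (β μ : Fin n) : smoothFn U := ∑ ε, h.gInv β ε * h.ring.ricci h.Γ h.C ε μ

/-- The scalar curvature as a smooth function. -/
def scalarFn : smoothFn U := ∑ β, h.ricciMixed β β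

/-- The mixed Einstein tensor as smooth functions. -/
def einsteinFn (μ σ : Fin n) : smoothFn U :=
  h.ricciMixed μ σ - (1 / 2 : ℝ) • ((1 : Matrix (Fin n) (Fin n) (smoothFn U)) μ σ * h.scalarFn)

lemma rep_scalarFn : Rep h.scalarFn A.scalar := by
  refine Rep.of_eq (h.rep_trace h.rep_ricci) ?_
  have hs : ∀ i j, h.gInv i j = h.gInv j i := fun i j => congrFun (congrFun h.transpose_gInv j) i
  rw [Finset.sum_comm]
  exact Finset.sum_congr rfl fun β _ => Finset.sum_congr rfl fun ε _ => by rw [hs]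

lemma rep_einsteinFn (μ σ : Fin n) : Rep (h.einsteinFn μ σ) (A.einsteinMixed μ σ) := by
  have h1 : Rep (∑ ε, h.gInv μ ε * (h.ring.ricci h.Γ h.C ε σ
      - (1 / 2 : ℝ) • h.g ε σ * h.scalarFn)) (A.einsteinMixed μ σ) :=
    Rep.sum fun ε => (h.rep_gInv μ ε).mul ((h.rep_ricci ε σ).sub
      (((h.rep_g ε σ).smul (1 / 2)).mul h.rep_scalarFn))
  refine Rep.of_eq h1 ?_
  simp only [einsteinFn, mul_sub, Finset.sum_sub_distrib, ricciMixed]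
  rw [← h.gInv_mul_g, Matrix.mul_apply, Finset.sum_mul, Finset.smul_sum]
  simp only [smul_mul_assoc, mul_smul_comm, mul_assoc]

lemma divergence_einsteinMixed (h : A.IsRegularOn U) (q : U) (σ : Fin n) : A.divergence A.einsteinMixed σ q =
    (∑ a, ∑ μ, A.RN a σ μ q * A.PUp μ a q)
      + 1 / 2 * ∑ a, ∑ α, ∑ μ, A.RN a α μ q * A.PUpUp α μ σ a q := by
  have h1 := h.ring.bianchi_contracted h.g_mul_gInv h.gInv_mul_g h.transpose_gInv
    h.metric_Γ h.metric_C h.Γ_symm h.ricciMixed (fun _ _ => rfl) σ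
  have hdiv : Rep (∑ μ, (h.ring.δ μ (h.einsteinFn μ σ)
      + ∑ ε, (h.Γ μ μ ε * h.einsteinFn ε σ - h.Γ μ ε σ * h.einsteinFn μ ε)))
      (A.divergence A.einsteinMixed σ) :=
    Rep.sum fun μ => (h.rep_δ μ (h.rep_einsteinFn μ σ)).add (Rep.sum fun ε =>
      ((h.rep_Γ μ ε μ).mul (h.rep_einsteinFn ε σ)).sub
        ((h.rep_Γ ε σ μ).mul (h.rep_einsteinFn μ ε)))
  have hP : Rep (∑ a, ∑ μ, h.ring.R a σ μ * ∑ ε, h.gInv μ ε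
      * (-∑ β, h.ring.curvHV h.Γ h.C β a β ε)) fun q => ∑ a, ∑ μ, A.RN a σ μ q * A.PUp μ a q :=
    Rep.sum fun a => Rep.sum fun μ => (h.rep_R a σ μ).mul (Rep.sum fun ε =>
      (h.rep_gInv μ ε).mul (Rep.sum fun β => h.rep_curvHV β ε β a).neg)
  have hPP : Rep (∑ a, ∑ α, ∑ μ, h.ring.R a α μ * ∑ ε, h.gInv μ ε
      * h.ring.curvHV h.Γ h.C σ a α ε)
      fun q => ∑ a, ∑ α, ∑ μ, A.RN a α μ q * A.PUpUp α μ σ a q :=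
    Rep.sum fun a => Rep.sum fun α => Rep.sum fun μ => (h.rep_R a α μ).mul (Rep.sum fun ε =>
      (h.rep_gInv μ ε).mul (h.rep_curvHV α ε σ a))
  -- The Kronecker tensor is parallel: the two connection terms cancel, and the divergence of `½
  -- δ^μ_σ R` is a plain derivative of the scalar.
  have hdelta : ∑ μ, (h.ring.δ μ ((1 / 2 : ℝ) •
        ((1 : Matrix (Fin n) (Fin n) (smoothFn U)) μ σ * h.scalarFn))
      + ∑ ε, (h.Γ μ μ ε * ((1 / 2 : ℝ) •
        ((1 : Matrix (Fin n) (Fin n) (smoothFn U)) ε σ * h.scalarFn))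
        - h.Γ μ ε σ * ((1 / 2 : ℝ) •
        ((1 : Matrix (Fin n) (Fin n) (smoothFn U)) μ ε * h.scalarFn))))
      = (1 / 2 : ℝ) • h.ring.δ σ h.scalarFn := by
    have e1 : ∀ μ, h.ring.δ μ ((1 / 2 : ℝ) •
        ((1 : Matrix (Fin n) (Fin n) (smoothFn U)) μ σ * h.scalarFn))
        = if μ = σ then (1 / 2 : ℝ) • h.ring.δ σ h.scalarFn else 0 := by
      intro μ
      rw [Derivation.map_smul]
      by_cases hμ : μ = σ
      · subst hμ; simp
      · simp [hμ]
    have e2 : ∀ μ, ∑ ε, (h.Γ μ μ ε * ((1 / 2 : ℝ) •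
          ((1 : Matrix (Fin n) (Fin n) (smoothFn U)) ε σ * h.scalarFn))
        - h.Γ μ ε σ * ((1 / 2 : ℝ) •
          ((1 : Matrix (Fin n) (Fin n) (smoothFn U)) μ ε * h.scalarFn))) = 0 := by
      intro μ
      simp [Matrix.one_apply]
    simp only [e1, e2, add_zero, Finset.sum_ite_eq', Finset.mem_univ, if_true]
  have hsplit : ∑ μ, (h.ring.δ μ (h.einsteinFn μ σ)
      + ∑ ε, (h.Γ μ μ ε * h.einsteinFn ε σ - h.Γ μ ε σ * h.einsteinFn μ ε))
      = ∑ μ, (h.ring.δ μ (h.ricciMixed μ σ)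
        + ∑ ε, (h.Γ μ μ ε * h.ricciMixed ε σ - h.Γ μ ε σ * h.ricciMixed μ ε))
        - (1 / 2 : ℝ) • h.ring.δ σ h.scalarFn := by
    rw [← hdelta, ← Finset.sum_sub_distrib]
    refine Finset.sum_congr rfl fun μ _ => ?_
    rw [einsteinFn, map_sub, add_sub_add_comm, ← Finset.sum_sub_distrib]
    congr 1
    exact Finset.sum_congr rfl fun ε _ => by simp only [einsteinFn]; ring
  have h2 := congrArg (eval q) hsplit
  have h3 := congrArg (eval q) h1
  have hsmul : ∀ x : smoothFn U, eval q ((1 / 2 : ℝ) • x) = 1 / 2 * eval q x := fun x => rfl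
  have htwo : eval q (2 : smoothFn U) = 2 := map_ofNat _ 2
  rw [hdiv.eval_eq, map_sub, hsmul] at h2
  rw [map_sub, map_add, map_mul, map_mul, htwo, hP.eval_eq, hPP.eval_eq] at h3
  change 2 * _ - eval q (h.ring.δ σ h.scalarFn) = _ at h3
  linear_combination h2 + h3 / 2

end LocalCoeff.IsRegularOn

/-! ## The coordinate image of the domain -/

section Manifold

open LocalCoeff TopologicalSpace

variable {n : ℕ} {M : Type*} [TopologicalSpace M]
  [ChartedSpace (EuclideanSpace ℝ (Fin n)) M] [IsManifold (𝓡 n) ∞ M]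

/-- On `e.target × ℝⁿ` the map `tangentPoint e` is the tangent map of `e.symm`, hence continuous
there; openness is needed to differentiate freely on the coordinate domain. -/
lemma isOpen_chartDom {W : Set (TangentBundle (𝓡 n) M)} (hW : IsOpen W)
    {e : OpenPartialHomeomorph M (EuclideanSpace ℝ (Fin n))}
    (he : e ∈ IsManifold.maximalAtlas (𝓡 n) ∞ M) : IsOpen (chartDom W e) := by
  have h1 := (contMDiffOn_symm_of_mem_maximalAtlas he).continuousOn_tangentMapWithin (by simp)
    e.open_target.uniqueMDiffOn
  have h2 : ContinuousOn (tangentPoint e) {p | p.1 ∈ e.target} := by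
    have h3 := h1.comp (tangentBundleModelSpaceHomeomorph (𝓡 n)).symm.continuous.continuousOn
      (s := {p : Phase n | p.1 ∈ e.target}) fun p hp => hp
    refine h3.congr fun p hp => ?_
    change _ = (⟨e.symm p.1, mfderivWithin (𝓡 n) (𝓡 n) e.symm e.target p.1 p.2⟩ :
      TangentBundle (𝓡 n) M)
    rw [mfderivWithin_of_isOpen e.open_target hp]
    rfl
  exact h2.isOpen_inter_preimage (e.open_target.preimage continuous_fst) hW

lemma EAPSpace.isRegularOn (S : EAPSpace n M)
    {e : OpenPartialHomeomorph M (EuclideanSpace ℝ (Fin n))}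
    (he : e ∈ IsManifold.maximalAtlas (𝓡 n) ∞ M) :
    (S.coeff e).IsRegularOn ⟨chartDom S.domain e, isOpen_chartDom S.isOpen_domain he⟩ where
  contDiffOn_N := S.smooth_N e he
  contDiffOn_lamH := S.smooth_lamH e he
  isUnit_det q hq := by
    have h1 := (Matrix.linearIndependent_rows_iff_isUnit
      (A := Matrix.of fun i α => (S.coeff e).lamH i α q)).1 (S.indep_lamH e he q hq)
    rw [Matrix.isUnit_iff_isUnit_det, ← Matrix.det_transpose] at h1
    exact h1

end Manifold

end EAP

end
theorem mainTheorem3 {n : ℕ} {M : Type*} [TopologicalSpace M]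
    [ChartedSpace (EuclideanSpace ℝ (Fin n)) M] [IsManifold (𝓡 n) ∞ M]
    (S : EAP.EAPSpace n M)
    (e : OpenPartialHomeomorph M (EuclideanSpace ℝ (Fin n)))
    (he : e ∈ IsManifold.maximalAtlas (𝓡 n) ∞ M)
    (p : EAP.Phase n) (hp : p ∈ EAP.chartDom S.domain e)
    (A : EAP.LocalCoeff n) (hA : A = S.coeff e) :
    (∀ μ ν, EAP.LocalCoeff.symm A.E μ ν p = 0 ↔
      EAP.LocalCoeff.symm A.ricci μ ν p - 1 / 2 * A.g μ ν p * A.scalar p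
        = A.energyMomentum μ ν p) ∧
    (∀ μ ν, EAP.LocalCoeff.symm A.E μ ν p = 0 →
      A.einstein μ ν p =
        1 / 2 * A.g μ ν p * (A.trace A.sigma p - A.trace A.varpi p)
          + (A.varpi μ ν p - A.sigma μ ν p)
          + 1 / 2 * A.g μ ν p * (2 * A.trace A.Z p - A.trace A.Q p)
          + 1 / 2 * ∑ β, A.divN β p * A.Omega β μ ν p
          - EAP.LocalCoeff.symm A.Z μ ν p + EAP.LocalCoeff.symm A.Q μ ν p
          - 1 / 2 * A.cyclicCR μ ν p) ∧
    (∀ σ, A.divergence A.einsteinMixed σ p =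
      (∑ a, ∑ μ, A.RN a σ μ p * A.PUp μ a p)
        + 1 / 2 * ∑ a, ∑ α, ∑ μ, A.RN a α μ p * A.PUpUp α μ σ a p) := by
  subst hA
  have h := S.isRegularOn he
  have hE := h.symm_E_eq ⟨p, hp⟩
  refine ⟨fun μ ν => ?_, fun μ ν h0 => ?_, h.divergence_einsteinMixed ⟨p, hp⟩⟩
  · rw [hE μ ν, mul_eq_zero, sub_eq_zero]
    norm_num
  · have h1 := hE μ ν
    have h2 := h.ricci_sub_ricci ⟨p, hp⟩ μ ν
    rw [h0] at h1
    simp only [EAP.LocalCoeff.symm, EAP.LocalCoeff.energyMomentum,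
      EAP.LocalCoeff.einstein] at h1 h2 ⊢
    -- The Ricci tensor is its symmetric part plus half of its antisymmetrisation; the latter is
    -- minus half the cyclic sum.
    linear_combination h1 / 2 + h2 / 2
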